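/- Let $\mathfrak A=\mathbb C\langle u_n^{(m)} : n\ge 2,\ m\ge 0\rangle$ be the free associative algebra on noncommuting symbols, with the derivation $\partial u_n^{(m)}=u_n^{(m+1)}$, $u_n=u_n^{(0)}$. Let $\mathcal R$ be the algebra of pseudo-differential operators $\sum_{i\ll\infty}v_i\partial^i$ with $v_i\in\mathfrak A$, let $I$ be its identity, and let $\mathfrak L=\partial+u_2\partial^{-1}+u_3\partial^{-2}+\cdots$. Write $\mathcal V_{\ge0}$ for the differential operator part of $\mathcal V$, $\mathcal V_{<0}=\mathcal V-\mathcal V_{\ge 0}$, and $\mathrm{res}\,\mathcal V$ for the coefficient of $\partial^{-1}$. On $\mathcal R$ put $S(\mathcal V)=\mathfrak L\mathcal V$, $\pi_+(\mathcal V)=\mathcal V_{\ge 0}$, $\pi_-(\mathcal V)=\mathcal V_{<0}$. Let $\mathcal O$ be the span of $S$ and all operators $S\pi_\pm S\cdots\pi_\pm S$ (all choices of signs), with the product $A\circ B=A\pi_+S\pi_-B$, and let $\mathcal A=\{\mathrm{res}(A(I)):A\in\mathcal O\}\subset\mathfrak A$. **(a) The algebra.** $A\mapsto\mathrm{res}(A(I))$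 is injective on $\mathcal O$, the product $\circ$ maps $\mathcal O\times\mathcal O$ into $\mathcal O$, and $\mathrm{res}((A\circ B)(I))=\mathrm{res}(A(I))\,\mathrm{res}(B(I))$ for $A,B\in\mathcal O$. There is exactly one bilinear product $\circ$ on $\mathbb A=\mathbb Cf\oplus\mathcal A$ such that for all $A,B\in\mathcal O$ $$f\circ f=-\mathrm{res}(\mathfrak L),\quad f\circ\mathrm{res}(A(I))=\mathrm{res}((S\pi_-A)(I)),\quad \mathrm{res}(A(I))\circ f=-\mathrm{res}((A\pi_+S)(I)),$$ $$\mathrm{res}(A(I))\circ\mathrm{res}(B(I))=\mathrm{res}(A(I))\,\mathrm{res}(B(I)).$$ With the associator $(a,b,c)=(a\circ b)\circ c-a\circ(b\circ c)$, the algebra $(\mathbb A,\circ)$ is weakly nonassociative: $(a,b\circ c,d)=0$ for all $a,b,c,d\in\mathbb A$. Its middle nucleus $\{b:(a,b,c)=0\ \forall a,c\}$ is $\mathcal A$, and it is generated by $f$. Put $a\circ_1b=a\circ b$ and $a\circ_{n+1}b=a\circ(f\circ_nb)-(a\circ f)\circ_nb$. Then for all $m,n\ge1$ and $A,B\in\mathcal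 O$ $$f\circ_nf=-\mathrm{res}(\mathfrak L^n),\quad f\circ_n\mathrm{res}(A(I))=\mathrm{res}(\mathfrak L^n A(I)_{<0}),\quad \mathrm{res}(A(I))\circ_nf=-\mathrm{res}((A\pi_+S^n)(I)),$$ $$\mathrm{res}(A(I))\circ_n\mathrm{res}(B(I))=\mathrm{res}((A\pi_+S^n\pi_-B)(I)),\quad \mathrm{res}(\mathfrak L^m)\circ_nf=-\mathrm{res}((\mathfrak L^m)_{<0}\mathfrak L^n).$$ **(b) The hierarchies.** Let the $u_n$ depend on times $t_1,t_2,\dots$: let $\mathfrak B$ be any unital associative $\mathbb C$-algebra with pairwise commuting derivations $\partial_{t_1},\partial_{t_2},\dots$, let $\partial=\partial_{t_1}$, and let elements of $\mathfrak B$, again denoted $u_n$ ($n\ge2$), be given (the case $\mathfrak B=\mathfrak A$ with the free symbols is included). Let $\mathrm{ev}:\mathfrak A\to\mathfrak B$ be the algebra homomorphism with $u_n^{(m)}\mapsto\partial_{t_1}^mu_n$, and let $\mathfrak L=\partial+u_2\partial^{-1}+u_3\partial^{-2}+\cdots$ now have coefficients in $\mathfrak B$. The hierarchy of ordinary differential equations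 $f_{t_n}=f\circ_nf$, $n=1,2,\dots$, means: for every $n\ge 1$ there is a derivation $\delta_n$ of $(\mathbb A,\circ)$ with $\delta_n(f)=f\circ_nf$, $\delta_n(\mathcal A)\subset\mathcal A$, and $\mathrm{ev}(\delta_n(a))=\partial_{t_n}\mathrm{ev}(a)$ for all $a\in\mathcal A$. 1. This hierarchy implies, for all $m,n\ge1$, $$\partial_{t_n}\mathrm{res}(\mathfrak L^m)=\mathrm{res}\big([(\mathfrak L^n)_{\ge0},\mathfrak L^m]\big)=\partial_{t_m}\mathrm{res}(\mathfrak L^n).$$ Moreover $\mathfrak B$, with its derivations $\partial_{t_n}$, then embeds into a $\mathbb C$-algebra with pairwise commuting derivations $\partial_{t_n}$ containing an element $\phi$ with $\phi_{t_n}=\mathrm{res}(\mathfrak L^n)$ for all $n\ge1$ (in particular $\phi_{t_1}=u_2$). Whenever $\phi\in\mathfrak B$ satisfies $\phi_{t_n}=\mathrm{res}(\mathfrak L^n)$ for all $n\geq 1$, it solves the pKP equation $$(4\phi_{t_3}-\phi_{t_1t_1t_1}-6\,\phi_{t_1}{}^2)_{t_1}-3\,\phi_{t_2t_2}+6\,[\phi_{t_1},\phi_{t_2}]=0$$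 and the whole pKP hierarchy $$\sum_{i,j,k=1}^3\varepsilon_{ijk}\big(\lambda_i^{-1}(\phi_{[\lambda_i]}-\phi)+\phi\,\phi_{[\lambda_i]}\big)_{[\lambda_k]}=0,$$ an identity of formal power series in commuting indeterminates $\lambda_1,\lambda_2,\lambda_3$, where $G_{[\lambda]}=\exp\big(\sum_{k\ge1}\tfrac{\lambda^k}{k}\partial_{t_k}\big)G$ and $\varepsilon_{ijk}$ is totally antisymmetric with $\varepsilon_{123}=1$. 2. The hierarchy $f_{t_n}=f\circ_nf$ ($n\ge1$) holds if and only if the Gelfand–Dickey system $\partial_{t_n}\mathfrak L=[(\mathfrak L^n)_{\ge0},\mathfrak L]$ ($n\ge1$) holds. The latter is equivalent to $\partial_{t_n}(\mathfrak L^m)=[(\mathfrak L^n)_{\ge0},\mathfrak L^m]$ for all $m,n\ge1$. -/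

import Mathlib

universe u

namespace WNAGD

noncomputable section



/-! ### Derivations of not necessarily commutative or associative products -/

/-- A linear map `d` is a derivation of the (possibly noncommutative, nonassociative) bilinear
product `μ`. -/
def IsDerivationOf {M : Type*} [AddCommGroup M] [Module ℂ M]
    (μ : M →ₗ[ℂ] M →ₗ[ℂ] M) (d : M →ₗ[ℂ] M) : Prop :=
  ∀ x y : M, d (μ x y) = μ (d x) y + μ x (d y)

/-! ### Pseudo-differential operators -/

section PseudoDiff

variable {R : Type*} [Ring R] [Algebra ℂ R]

/-- Formal pseudo-differential operators `∑_{i ≪ ∞} v_i ∂^i`, as the space of coefficient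
families `i ↦ v_i` on `ℤ` that vanish for all large `i`. -/
def PDO (R : Type*) [Ring R] [Algebra ℂ R] : Submodule ℂ (ℤ → R) where
  carrier := {V | ∃ N : ℤ, ∀ i, N < i → V i = 0}
  zero_mem' := ⟨0, fun _ _ => rfl⟩
  add_mem' := by
    rintro V W ⟨N, hN⟩ ⟨M, hM⟩
    exact ⟨max N M, fun i hi => by
      simp [hN i (lt_of_le_of_lt (le_max_left _ _) hi),
        hM i (lt_of_le_of_lt (le_max_right _ _) hi)]⟩
  smul_mem' := by
    rintro c V ⟨N, hN⟩
    exact ⟨N, fun i hi => by simp [hN i hi]⟩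

/-- One term of the coefficient of `∂^k` in the product `V W`. It comes from
`v_i ∂^i w_j ∂^j = ∑_{l ≥ 0} (i choose l) v_i D^l(w_j) ∂^{i+j-l}` with `i + j - l = k`;
here `D` is the derivation of the coefficient algebra. -/
def mulTerm (D : R →ₗ[ℂ] R) (V W : ℤ → R) (k : ℤ) (p : ℤ × ℕ) : R :=
  (Ring.choose p.1 p.2 : ℤ) • (V p.1 * (D ^ p.2) (W (k - p.1 + p.2)))

theorem mulTerm_support_finite (D : R →ₗ[ℂ] R) (V W : PDO R) (k : ℤ) :
    (Function.support (mulTerm D V.1 W.1 k)).Finite := by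
  obtain ⟨V, N, hN⟩ := V
  obtain ⟨W, M, hM⟩ := W
  refine ((Set.finite_Icc (k - M) N).prod (Set.finite_Iic (N + M - k).toNat)).subset ?_
  rintro ⟨i, l⟩ h
  have h1 : i ≤ N := by
    by_contra hi
    exact h (by simp [mulTerm, hN i (not_le.mp hi)])
  have h2 : k - i + l ≤ M := by
    by_contra hi
    exact h (by simp [mulTerm, hM _ (not_le.mp hi)])
  simp only [Set.mem_prod, Set.mem_Icc, Set.mem_Iic]
  omega

/-- The product of the algebra of pseudo-differential operators whose coefficient algebra
carries the derivation `D`. -/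
def mul (D : R →ₗ[ℂ] R) : PDO R →ₗ[ℂ] PDO R →ₗ[ℂ] PDO R :=
  LinearMap.mk₂ ℂ
    (fun V W => ⟨fun k => ∑ᶠ p : ℤ × ℕ, mulTerm D V.1 W.1 k p, by
      obtain ⟨V, N, hN⟩ := V
      obtain ⟨W, M, hM⟩ := W
      refine ⟨N + M, fun k hk => finsum_eq_zero_of_forall_eq_zero ?_⟩
      rintro ⟨i, l⟩
      by_cases hi : N < i
      · simp [mulTerm, hN i hi]
      · simp [mulTerm, hM (k - i + l) (by omega)]⟩)
    (fun V V' W => Subtype.ext <| funext fun k => by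
      refine Eq.trans (finsum_congr fun p => ?_)
        (finsum_add_distrib (mulTerm_support_finite D V W k) (mulTerm_support_finite D V' W k))
      simp [mulTerm, add_mul])
    (fun c V W => Subtype.ext <| funext fun k => by
      refine Eq.trans (finsum_congr fun p => ?_)
        (smul_finsum' c (mulTerm_support_finite D V W k)).symm
      simp only [mulTerm, Submodule.coe_smul, Pi.smul_apply, smul_mul_assoc]
      rw [smul_comm])
    (fun V W W' => Subtype.ext <| funext fun k => by
      refine Eq.trans (finsum_congr fun p => ?_)
        (finsum_add_distrib (mulTerm_support_finite D V W k) (mulTerm_support_finite D V W' k))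
      simp [mulTerm, mul_add])
    (fun c V W => Subtype.ext <| funext fun k => by
      refine Eq.trans (finsum_congr fun p => ?_)
        (smul_finsum' c (mulTerm_support_finite D V W k)).symm
      simp only [mulTerm, Submodule.coe_smul, Pi.smul_apply, map_smul, mul_smul_comm]
      rw [smul_comm])

/-- The identity `I = ∂^0`. -/
def one : PDO R := ⟨fun i => if i = 0 then 1 else 0, 0, fun i hi => by simp [hi.ne']⟩

/-- Powers `V^n`. -/
def pow (D : R →ₗ[ℂ] R) (V : PDO R) : ℕ → PDO R
  | 0 => one
  | n + 1 => mul D V (pow D V n)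

/-- The commutator `[V, W] = V W - W V`. -/
def bracket (D : R →ₗ[ℂ] R) (V W : PDO R) : PDO R := mul D V W - mul D W V

/-- `π₊`: the projection `V ↦ V_{≥0}` to the differential operator part. -/
def projPos : PDO R →ₗ[ℂ] PDO R where
  toFun V := ⟨fun i => if 0 ≤ i then V.1 i else 0, by
    obtain ⟨V, N, hN⟩ := V
    exact ⟨N, fun i hi => by simp [hN i hi]⟩⟩
  map_add' V W := by
    ext i
    by_cases h : 0 ≤ i <;> simp [h]
  map_smul' c V := by
    ext i
    by_cases h : 0 ≤ i <;> simp [h]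

/-- `π₋`: the map `V ↦ V_{<0} = V - V_{≥0}`. -/
def projNeg : PDO R →ₗ[ℂ] PDO R := LinearMap.id - projPos

/-- The residue: the coefficient of `∂^{-1}`. -/
def res : PDO R →ₗ[ℂ] R := LinearMap.proj (-1 : ℤ) ∘ₗ (PDO R).subtype

/-- A linear map of the coefficient algebra acts on pseudo-differential operators
coefficientwise. -/
def mapCoeff (d : R →ₗ[ℂ] R) (V : PDO R) : PDO R :=
  ⟨fun i => d (V.1 i), by
    obtain ⟨V, N, hN⟩ := V
    exact ⟨N, fun i hi => by simp [hN i hi]⟩⟩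

/-- `𝔏 = ∂ + u₂ ∂⁻¹ + u₃ ∂⁻² + ⋯`. The family `u` is indexed so that `u k` is the
coefficient usually written `u_{k+2}`, i.e. the coefficient of `∂^{-(k+1)}`. -/
def lax (u : ℕ → R) : PDO R :=
  ⟨fun i => if i = 1 then 1 else if i < 0 then u (-i - 1).toNat else 0,
    1, fun i hi => by simp [hi.ne', show ¬ i < 0 by omega]⟩

end PseudoDiff

/-! ### The free differential algebra and the residue algebra -/

/-- The algebra of polynomials over `ℂ` in the noncommuting, algebraically independent symbols
`u_n^{(m)}`, `n ≥ 2`, `m ≥ 0`; the generator with index `(k, m)` is `u_{k+2}^{(m)}`. -/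
abbrev Poly : Type := FreeAlgebra ℂ (ℕ × ℕ)

/-- The algebra homomorphism `a ↦ a + ε ∂a`, `ε² = 0`, with `∂ u_n^{(m)} = u_n^{(m+1)}`. -/
def dualLift : Poly →ₐ[ℂ] TrivSqZeroExt Poly Poly :=
  FreeAlgebra.lift ℂ fun p =>
    TrivSqZeroExt.inl (FreeAlgebra.ι ℂ p) + TrivSqZeroExt.inr (FreeAlgebra.ι ℂ (p.1, p.2 + 1))

/-- The derivation `∂` of the algebra of polynomials in the `u_n^{(m)}`. -/
def dPoly : Poly →ₗ[ℂ] Poly where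
  toFun a := (dualLift a).snd
  map_add' a b := by simp
  map_smul' c a := by simp

theorem dPoly_ι (k m : ℕ) :
    dPoly (FreeAlgebra.ι ℂ (k, m)) = FreeAlgebra.ι ℂ (k, m + 1) := by
  simp [dPoly, dualLift]

theorem dualLift_fst (a : Poly) : (dualLift a).fst = a := by
  have h : (TrivSqZeroExt.fstHom ℂ Poly Poly).comp dualLift = AlgHom.id ℂ Poly := by
    apply FreeAlgebra.hom_ext
    funext p
    simp [dualLift]
  exact DFunLike.congr_fun h a

theorem dPoly_mul (a b : Poly) : dPoly (a * b) = dPoly a * b + a * dPoly b := by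
  simp [dPoly, dualLift_fst, add_comm]

/-- The generic `𝔏`, with coefficients the free symbols `u_n = u_n^{(0)}`. -/
def genLax : PDO Poly := lax fun k => FreeAlgebra.ι ℂ (k, 0)

/-- The operator `S(V) = 𝔏 V`. -/
def opS : Module.End ℂ (PDO Poly) := mul dPoly genLax

/-- `π₊` for `true`, `π₋` for `false`. -/
def opProj (s : Bool) : Module.End ℂ (PDO Poly) := if s then projPos else projNeg

/-- The operators `S π_± S π_± ⋯ π_± S`, for an arbitrary finite list of signs; the empty list
gives `S`. -/
def opWord : List Bool → Module.End ℂ (PDO Poly)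
  | [] => opS
  | s :: l => opS * opProj s * opWord l

/-- The space `𝒪` spanned by `S` and all `S π_± S π_± ⋯ π_± S`. -/
def opSpace : Submodule ℂ (Module.End ℂ (PDO Poly)) := Submodule.span ℂ (Set.range opWord)

/-- The product `A ∘ B = A π₊ S π₋ B` on `𝒪`. -/
def opMul (A B : Module.End ℂ (PDO Poly)) : Module.End ℂ (PDO Poly) :=
  A * projPos * opS * projNeg * B

/-- `A ↦ res(A(I))`. -/
def resAt : Module.End ℂ (PDO Poly) →ₗ[ℂ] Poly := res ∘ₗ LinearMap.applyₗ (one : PDO Poly)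

/-- `𝒜 = {res(A(I)) : A ∈ 𝒪}`. -/
def resAlg : Submodule ℂ Poly := opSpace.map resAt

/-- The underlying space `𝔸 = ℂ f ⊕ 𝒜` of the augmented algebra. -/
abbrev Aug : Type := ℂ × resAlg

/-- The augmenting element `f`. -/
def augF : Aug := (1, 0)

/-- The element `x` of `𝔸 = ℂ f ⊕ 𝒜` is the element `v` of `𝒜`. -/
def IsElt (x : Aug) (v : Poly) : Prop := x.1 = 0 ∧ (x.2 : Poly) = v

/-- The bilinear product `∘` of `𝔸`: it extends the product of `𝒜`, and, for `A ∈ 𝒪`,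
`f ∘ f = -res 𝔏`, `f ∘ res(A(I)) = res(𝔏 A(I)_{<0})`, `res(A(I)) ∘ f = -res(A(𝔏_{≥0}))`.
The last two right-hand sides are `res((S π₋ A)(I))` and `-res((A π₊ S)(I))`. -/
structure IsAugProduct (μ : Aug →ₗ[ℂ] Aug →ₗ[ℂ] Aug) : Prop where
  f_f : IsElt (μ augF augF) (-res genLax)
  f_res : ∀ A ∈ opSpace, ∀ x : Aug, IsElt x (resAt A) →
    IsElt (μ augF x) (res (mul dPoly genLax (projNeg (A one))))
  res_f : ∀ A ∈ opSpace, ∀ x : Aug, IsElt x (resAt A) →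
    IsElt (μ x augF) (-res (A (projPos genLax)))
  res_res : ∀ A ∈ opSpace, ∀ B ∈ opSpace, ∀ x y : Aug, IsElt x (resAt A) → IsElt y (resAt B) →
    IsElt (μ x y) (resAt A * resAt B)

/-! ### Weakly nonassociative algebras -/

section WNA

variable {M : Type*} [AddCommGroup M] [Module ℂ M]

/-- The associator `(a, b, c) = (a ∘ b) ∘ c - a ∘ (b ∘ c)`. -/
def assoc (μ : M →ₗ[ℂ] M →ₗ[ℂ] M) (a b c : M) : M := μ (μ a b) c - μ a (μ b c)

/-- Weak nonassociativity: `(a, b ∘ c, d) = 0` for all `a, b, c, d`. -/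
def IsWNA (μ : M →ₗ[ℂ] M →ₗ[ℂ] M) : Prop := ∀ a b c d : M, assoc μ a (μ b c) d = 0

/-- The middle nucleus. -/
def middleNucleus (μ : M →ₗ[ℂ] M →ₗ[ℂ] M) : Set M := {b | ∀ a c : M, assoc μ a b c = 0}

/-- The algebra `(M, ∘)` is generated by `f`. -/
def IsGeneratedBy (μ : M →ₗ[ℂ] M →ₗ[ℂ] M) (f : M) : Prop :=
  ∀ N : Submodule ℂ M, f ∈ N → (∀ x ∈ N, ∀ y ∈ N, μ x y ∈ N) → N = ⊤

/-- The products `∘_n`, `n ≥ 1`: `a ∘_1 b = a ∘ b` and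
`a ∘_{n+1} b = a ∘ (f ∘_n b) - (a ∘ f) ∘_n b`. (The value at `n = 0` is not used.) -/
def circ (μ : M →ₗ[ℂ] M →ₗ[ℂ] M) (f : M) : ℕ → M → M → M
  | 0 => fun _ _ => 0
  | 1 => fun a b => μ a b
  | n + 2 => fun a b => μ a (circ μ f (n + 1) f b) - circ μ f (n + 1) (μ a f) b

end WNA

/-! ### Dependence on times -/

section Times

variable {B : Type*} [Ring B] [Algebra ℂ B]

/-- `D 1, D 2, …` are commuting derivations `∂_{t_1}, ∂_{t_2}, …` of the associative algebra `B`.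
(`D 0` is not used.) -/
structure IsTimes (D : ℕ → B →ₗ[ℂ] B) : Prop where
  leibniz : ∀ n, 1 ≤ n → IsDerivationOf (LinearMap.mul ℂ B) (D n)
  comm : ∀ m n, 1 ≤ m → 1 ≤ n → ∀ b : B, D m (D n b) = D n (D m b)

/-- The evaluation of polynomials in the symbols `u_n^{(m)}` at given elements `u_n` of `B`,
with `u_n^{(m)} = ∂^m u_n`, `∂ = ∂_{t_1}`. -/
def evalAt (D : ℕ → B →ₗ[ℂ] B) (u : ℕ → B) : Poly →ₐ[ℂ] B :=
  FreeAlgebra.lift ℂ fun p => ((D 1) ^ p.2) (u p.1)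

/-- The hierarchy of ordinary differential equations `f_{t_n} = f ∘_n f`, `n = 1, 2, …`, in the
algebra `(𝔸, ∘)` when the `u_n` depend on the times as elements of `B`: for every `n`, setting
`f_{t_n} := f ∘_n f` extends the action of `∂_{t_n}` on (the values of) the elements of `𝒜`
to a derivation of `(𝔸, ∘)`. -/
def ODEHierarchy (μ : Aug →ₗ[ℂ] Aug →ₗ[ℂ] Aug) (D : ℕ → B →ₗ[ℂ] B) (u : ℕ → B) : Prop :=
  ∀ n, 1 ≤ n → ∃ δ : Aug →ₗ[ℂ] Aug,
    IsDerivationOf μ δ ∧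
    δ augF = circ μ augF n augF augF ∧
    ∀ a : resAlg, (δ (0, a)).1 = 0 ∧
      evalAt D u ((δ (0, a)).2 : Poly) = D n (evalAt D u (a : Poly))

/-- The Gelfand-Dickey system `∂_{t_n} 𝔏 = [(𝔏^n)_{≥0}, 𝔏]`, `n = 1, 2, …`. -/
def GelfandDickey (D : ℕ → B →ₗ[ℂ] B) (u : ℕ → B) : Prop :=
  ∀ n, 1 ≤ n → mapCoeff (D n) (lax u) =
    bracket (D 1) (projPos (pow (D 1) (lax u) n)) (lax u)

/-- The system `∂_{t_n} 𝔏^m = [(𝔏^n)_{≥0}, 𝔏^m]`, `m, n = 1, 2, …`. -/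
def GelfandDickeyPowers (D : ℕ → B →ₗ[ℂ] B) (u : ℕ → B) : Prop :=
  ∀ m n, 1 ≤ m → 1 ≤ n → mapCoeff (D n) (pow (D 1) (lax u) m) =
    bracket (D 1) (projPos (pow (D 1) (lax u) n)) (pow (D 1) (lax u) m)

/-- `φ_{t_n} = res(𝔏^n)`, `n = 1, 2, …`; in particular `φ_{t_1} = u_2`. -/
def IsPotential (D : ℕ → B →ₗ[ℂ] B) (u : ℕ → B) (φ : B) : Prop :=
  ∀ n, 1 ≤ n → D n φ = res (pow (D 1) (lax u) n)

/-- The potential KP equation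
`(4 φ_{t_3} - φ_{t_1 t_1 t_1} - 6 φ_{t_1}²)_{t_1} - 3 φ_{t_2 t_2} + 6 [φ_{t_1}, φ_{t_2}] = 0`. -/
def PKPEquation (D : ℕ → B →ₗ[ℂ] B) (φ : B) : Prop :=
  D 1 ((4 : ℂ) • D 3 φ - D 1 (D 1 (D 1 φ)) - (6 : ℂ) • (D 1 φ * D 1 φ))
    - (3 : ℂ) • D 2 (D 2 φ) + (6 : ℂ) • (D 1 φ * D 2 φ - D 2 φ * D 1 φ) = 0

/-- The power series `∑_{k ≥ 1} (λ^k / k) ∂_{t_k}` in one indeterminate `λ`. -/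
def shiftGen (D : ℕ → B →ₗ[ℂ] B) : PowerSeries (Module.End ℂ B) :=
  PowerSeries.mk fun k => if k = 0 then 0 else ((k : ℂ)⁻¹) • (D k : Module.End ℂ B)

/-- The coefficient of `λ^n` in the Taylor expansion `exp(∑_{k ≥ 1} (λ^k / k) ∂_{t_k})` of the
shift `t ↦ t + [λ]`, `[λ] = (λ, λ²/2, λ³/3, …)`. -/
def shiftCoeff (D : ℕ → B →ₗ[ℂ] B) (n : ℕ) : Module.End ℂ B :=
  ∑ r ∈ Finset.range (n + 1),
    ((r.factorial : ℂ)⁻¹) • PowerSeries.coeff n (shiftGen D ^ r)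

/-- `G ↦ G_{[λ_k]}` on power series in `λ_1, λ_2, λ_3` with coefficients in `B`. -/
def miwa (D : ℕ → B →ₗ[ℂ] B) (k : Fin 3) (G : MvPowerSeries (Fin 3) B) :
    MvPowerSeries (Fin 3) B :=
  fun α => ∑ j ∈ Finset.range (α k + 1),
    shiftCoeff D j (MvPowerSeries.coeff (α - Finsupp.single k j) G)

/-- `λ_i⁻¹ H`, for a power series `H` divisible by `λ_i`. -/
def divVar (i : Fin 3) (H : MvPowerSeries (Fin 3) B) : MvPowerSeries (Fin 3) B :=
  fun α => MvPowerSeries.coeff (α + Finsupp.single i 1) H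

/-- The potential KP hierarchy in functional form,
`∑_{i,j,k} ε_{ijk} (λ_i⁻¹ (φ_{[λ_i]} - φ) + φ φ_{[λ_i]})_{[λ_k]} = 0`; the sum runs over the
permutations `σ = (i, j, k)` with their signs. -/
def PKPHierarchy (D : ℕ → B →ₗ[ℂ] B) (φ : B) : Prop :=
  let Φ : MvPowerSeries (Fin 3) B := MvPowerSeries.C φ
  ∑ σ : Equiv.Perm (Fin 3), ((Equiv.Perm.sign σ : ℤˣ) : ℤ) •
    miwa D (σ 2) (divVar (σ 0) (miwa D (σ 0) Φ - Φ) + Φ * miwa D (σ 0) Φ) = 0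

end Times

end

end WNAGD

namespace WNAGD

noncomputable section

/-! ### Calculus of pseudo-differential operators -/

section Calculus

variable {R : Type*} [Ring R] [Algebra ℂ R] {R' : Type*} [Ring R'] [Algebra ℂ R']

/-! Multiplicativity rests on two facts about residues. Only the product of the leading symbol `∂`
with `v ∂⁻¹` reaches order `≥ 0` in `𝔏 V_{<0}`, so `π₊ S π₋ V` is multiplication by `res V`; and
every operator in `𝒪` commutes with right multiplication by a function.

Injectivity of `A ↦ res(A(I))` is a dimension count. Give `u_n^{(m)}` weight `n + m`. Monomials of
weight at most `w + 2` correspond to sign words of length at most `w` (`signs`), and every such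
monomial is a combination of residues of those words (`coeff_mem_resFil`, `monomial_mem_resFil`).
Monomials are independent in the free algebra, so finitely many residues spanning at least as many
independent vectors are independent. Closure of the residues under `∂` comes from the first flow.

The flows are lifted to operators through `X_n = d_n - (𝔏^n)_{≥0}`, where `d_n` is the
Gelfand-Dickey derivation of the free differential algebra. It commutes with `S`, and `[X_n, π₊] =
π₊ S^n π₋`. Thus `d_n` maps `𝒜` into itself by an explicit operator `flowOp n` on `𝒪`, and with `f ↦
-res 𝔏^n` it becomes a derivation `augFlow n` of `𝔸`. Since `f` generates `𝔸`, this is the only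
derivation with that value at `f`. This uniqueness gives the equivalence of the hierarchy `f_{t_n} =
f ∘_n f` with the Gelfand-Dickey system; it also gives commutativity of the flows, because `res
[(𝔏^n)_{≥0}, 𝔏^m]` is symmetric in `m, n`.

The same symmetry makes `res 𝔏^n` a closed family, which is integrated by adjoining a free potential
`φ` (`exists_extension`).

For pKP, Newton's recursion shows `f_{[λ]} = ∑ λ^n F_n` with left powers `F_0 = f`, `F_{n+1} = f ∘
F_n`, i.e. `λ⁻¹(f_{[λ]} - f) = f ∘ f_{[λ]}`. Evaluation with `f ↦ -φ` intertwines the flows and is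
multiplicative on `𝒜`. Its defect on products with `f` is all that remains of `λ⁻¹(φ_{[λ]} - φ) + φ
φ_{[λ]}`; after a second shift this is symmetric in the two parameters up to a term depending on one
of them only, and antisymmetrization kills both. -/

@[ext]
theorem PDO.ext' {V W : PDO R} (h : ∀ k, V.1 k = W.1 k) : V = W := Subtype.ext (funext h)

@[simp] theorem PDO.add_coe (V W : PDO R) (k : ℤ) : (V + W).1 k = V.1 k + W.1 k := rfl
@[simp] theorem PDO.sub_coe (V W : PDO R) (k : ℤ) : (V - W).1 k = V.1 k - W.1 k := rfl
@[simp] theorem PDO.neg_coe (V : PDO R) (k : ℤ) : (-V).1 k = -V.1 k := rfl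

theorem PDO.sum_coe {ι : Type*} (s : Finset ι) (V : ι → PDO R) (k : ℤ) :
    (∑ i ∈ s, V i).1 k = ∑ i ∈ s, (V i).1 k := by
  classical
  induction s using Finset.induction_on with
  | empty => simp
  | insert a s ha ih => simp [Finset.sum_insert ha, ih]

/-- The operator acting by a linear map on the coefficients. -/
def coeffMap (d : R →ₗ[ℂ] R') : PDO R →ₗ[ℂ] PDO R' where
  toFun V := ⟨fun i => d (V.1 i), by
    obtain ⟨V, N, hN⟩ := V
    exact ⟨N, fun i hi => by simp [hN i hi]⟩⟩
  map_add' V W := by ext; simp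
  map_smul' c V := by ext; simp

@[simp] theorem coeffMap_coe (d : R →ₗ[ℂ] R') (V : PDO R) (k : ℤ) :
    (coeffMap d V).1 k = d (V.1 k) := rfl

theorem mapCoeff_eq (d : R →ₗ[ℂ] R) (V : PDO R) : mapCoeff d V = coeffMap d V := rfl

/-- Right multiplication by `∂ ^ n`. -/
def shift (n : ℤ) : PDO R →ₗ[ℂ] PDO R where
  toFun V := ⟨fun i => V.1 (i - n), by
    obtain ⟨V, N, hN⟩ := V
    exact ⟨N + n, fun i hi => hN _ (by omega)⟩⟩
  map_add' V W := by ext; simp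
  map_smul' c V := by ext; simp

@[simp] theorem shift_coe (n : ℤ) (V : PDO R) (k : ℤ) : (shift n V).1 k = V.1 (k - n) := rfl

@[simp] theorem projPos_coe (V : PDO R) (k : ℤ) :
    (projPos V).1 k = if 0 ≤ k then V.1 k else 0 := rfl

@[simp] theorem projNeg_coe (V : PDO R) (k : ℤ) :
    (projNeg V).1 k = if 0 ≤ k then 0 else V.1 k := by
  by_cases h : 0 ≤ k <;> simp [projNeg, h]

theorem projPos_add_projNeg (V : PDO R) : projPos V + projNeg V = V := by
  simp [projNeg]

@[simp] theorem one_coe (k : ℤ) : (one : PDO R).1 k = if k = 0 then 1 else 0 := rfl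

theorem res_eq (V : PDO R) : res V = V.1 (-1) := rfl

theorem finsum_eq_finsum_comp {α β M : Type*} [AddCommMonoid M] {f : β → M} {g : α → β}
    (hg : Function.Injective g) (h : Function.support f ⊆ Set.range g) :
    ∑ᶠ b, f b = ∑ᶠ a, f (g a) := by
  rw [← finsum_mem_range hg, ← finsum_mem_support, ← finsum_mem_inter_support f (Set.range g),
    Set.inter_eq_right.mpr h]

variable (D : R →ₗ[ℂ] R)

theorem mul_coe (V W : PDO R) (k : ℤ) :
    (mul D V W).1 k = ∑ᶠ p : ℤ × ℕ, mulTerm D V.1 W.1 k p := rfl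

theorem mul_coe_eq_zero {V W : PDO R} {N M : ℤ} (hV : ∀ i, N < i → V.1 i = 0)
    (hW : ∀ i, M < i → W.1 i = 0) (k : ℤ) (hk : N + M < k) : (mul D V W).1 k = 0 := by
  refine finsum_eq_zero_of_forall_eq_zero ?_
  rintro ⟨i, l⟩
  by_cases hi : N < i
  · simp [mulTerm, hV i hi]
  · simp [mulTerm, hW (k - i + l) (by omega)]

theorem mul_coe_leading {V W : PDO R} {N M : ℤ} (hV : ∀ i, N < i → V.1 i = 0)
    (hW : ∀ i, M < i → W.1 i = 0) : (mul D V W).1 (N + M) = V.1 N * W.1 M := by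
  rw [mul_coe, finsum_eq_single _ (N, 0)]
  · simp [mulTerm]
  · rintro ⟨i, l⟩ h
    by_cases hi : N < i
    · simp [mulTerm, hV i hi]
    · have : M < N + M - i + l := by
        by_contra hc
        exact h (Prod.ext (show i = N by omega) (show l = 0 by omega))
      simp [mulTerm, hW _ this]

theorem mul_coe_eq_zero_of_pos {V W : PDO R} (hV : ∀ i, i < 0 → V.1 i = 0)
    (hW : ∀ i, i < 0 → W.1 i = 0) (k : ℤ) (hk : k < 0) : (mul D V W).1 k = 0 := by
  refine finsum_eq_zero_of_forall_eq_zero ?_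
  rintro ⟨i, l⟩
  by_cases hi : i < 0
  · simp [mulTerm, hV i hi]
  · by_cases hl : i < l
    · obtain ⟨n, rfl⟩ := Int.eq_ofNat_of_zero_le (not_lt.mp hi)
      have : Ring.choose (n : ℤ) l = 0 := by
        rw [Ring.choose_natCast, Nat.choose_eq_zero_of_lt (by omega)]; rfl
      simp [mulTerm, this]
    · simp [mulTerm, hW (k - i + l) (by omega)]

theorem res_mul_projPos_projPos (V W : PDO R) : res (mul D (projPos V) (projPos W)) = 0 :=
  mul_coe_eq_zero_of_pos D (fun i hi => by simp [not_le.mpr hi])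
    (fun i hi => by simp [not_le.mpr hi]) _ (by norm_num)

theorem projNeg_coe_eq_zero (V : PDO R) (i : ℤ) (hi : -1 < i) : (projNeg V).1 i = 0 := by
  simp [show 0 ≤ i by omega]

theorem res_mul_projNeg_projNeg (V W : PDO R) : res (mul D (projNeg V) (projNeg W)) = 0 :=
  mul_coe_eq_zero D (projNeg_coe_eq_zero V) (projNeg_coe_eq_zero W) _ (by norm_num)

theorem projNeg_mul_projPos_projPos (V W : PDO R) :
    projNeg (mul D (projPos V) (projPos W)) = 0 := by
  ext k
  by_cases hk : 0 ≤ k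
  · simp [hk]
  · have := mul_coe_eq_zero_of_pos D (V := projPos V) (W := projPos W)
      (fun i hi => by simp [not_le.mpr hi]) (fun i hi => by simp [not_le.mpr hi]) k (by omega)
    simp [this]

theorem projPos_mul_projNeg_projNeg (V W : PDO R) :
    projPos (mul D (projNeg V) (projNeg W)) = 0 := by
  ext k
  by_cases hk : 0 ≤ k
  · have := mul_coe_eq_zero D (projNeg_coe_eq_zero V) (projNeg_coe_eq_zero W) k (by omega)
    simp [this]
  · simp [hk]

theorem one_mul_pdo (W : PDO R) : mul D one W = W := by
  ext k
  rw [mul_coe, finsum_eq_single _ (0, 0)]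
  · simp [mulTerm]
  · rintro ⟨i, l⟩ h
    by_cases hi : i = 0
    · subst hi
      have hl : 0 < l := Nat.pos_of_ne_zero fun hl => h (by rw [hl])
      simp [mulTerm, Ring.choose_zero_pos ℤ hl]
    · simp [mulTerm, hi]

/-- A multiplier acting on the right, at a single power of `∂`. -/
theorem mul_coe_single {V W : PDO R} (hW : ∀ i, i ≠ 0 → W.1 i = 0) (k : ℤ) (l : ℕ)
    (h : ∀ n, n ≠ l → (Ring.choose (k + n) n : ℤ) • (V.1 (k + n) * (D ^ n) (W.1 0)) = 0) :
    (mul D V W).1 k = (Ring.choose (k + l) l : ℤ) • (V.1 (k + l) * (D ^ l) (W.1 0)) := by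
  rw [mul_coe, finsum_eq_single _ (k + l, l)]
  · simp [mulTerm]
  · rintro ⟨i, n⟩ hp
    by_cases hi : k - i + n = 0
    · obtain rfl : i = k + n := by omega
      have := h n (fun hn => hp (by rw [hn]))
      simpa only [mulTerm, hi] using this
    · simp [mulTerm, hW _ hi]

section Derivation

variable {D} (hD : ∀ a b, D (a * b) = D a * b + a * D b)
include hD

theorem derivation_one : D 1 = 0 := by
  have := hD 1 1
  simp only [mul_one, one_mul] at this
  simpa using this


theorem derivation_pow_one (l : ℕ) (hl : l ≠ 0) : (D ^ l) 1 = 0 := by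
  obtain ⟨n, rfl⟩ := Nat.exists_eq_succ_of_ne_zero hl
  simp [pow_succ, derivation_one hD]

theorem mul_one_pdo (V : PDO R) : mul D V one = V := by
  ext k
  rw [mul_coe_single D (l := 0)]
  · simp
  · intro i hi
    simp [hi]
  · intro n hn
    simp [derivation_pow_one hD n hn]

end Derivation

theorem mulTerm_finite (V W : PDO R) (k : ℤ) :
    Function.HasFiniteSupport (mulTerm D V.1 W.1 k) := mulTerm_support_finite D V W k

/-- Left multiplication by `∂`. -/
def dLeft : PDO R →ₗ[ℂ] PDO R := shift 1 + coeffMap D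

@[simp] theorem dLeft_coe (V : PDO R) (k : ℤ) : (dLeft D V).1 k = V.1 (k - 1) + D (V.1 k) := rfl

/-- This is `(V ∂) W = V (∂ W)`, the germ of associativity. It amounts to Pascal's rule: the
difference of the binomial coefficients at `i + 1` and `i` is one at `l`, which moves one more `D`
onto the coefficients of `W`. -/
theorem shift_mul (V W : PDO R) : mul D (shift 1 V) W = mul D V (dLeft D W) := by
  have key : mul D (shift 1 V) W - mul D V (shift 1 W) = mul D V (coeffMap D W) := by
    ext k
    let F : ℤ × ℕ → R := fun p =>
      (Ring.choose (p.1 + 1) p.2 - Ring.choose p.1 p.2 : ℤ) •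
        (V.1 p.1 * (D ^ p.2) (W.1 (k - 1 - p.1 + p.2)))
    have h1 : (mul D (shift 1 V) W).1 k =
        ∑ᶠ p : ℤ × ℕ, mulTerm D (shift 1 V).1 W.1 k (p.1 + 1, p.2) := by
      rw [mul_coe, ← finsum_comp_equiv ((Equiv.addRight (1 : ℤ)).prodCongr (Equiv.refl ℕ))]
      rfl
    have hf : Function.HasFiniteSupport
        (fun p : ℤ × ℕ => mulTerm D (shift 1 V).1 W.1 k (p.1 + 1, p.2)) :=
      ((mulTerm_support_finite D (shift 1 V) W k).preimage
        (((Equiv.addRight (1 : ℤ)).prodCongr (Equiv.refl ℕ)).injective.injOn)).subset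
        (fun p hp => hp)
    have h2 : (mul D (shift 1 V) W - mul D V (shift 1 W)).1 k = ∑ᶠ p, F p := by
      rw [PDO.sub_coe, h1, mul_coe, ← finsum_sub_distrib hf (mulTerm_finite D V (shift 1 W) k)]
      refine finsum_congr ?_
      rintro ⟨i, l⟩
      simp only [mulTerm, F, shift_coe, sub_smul, add_sub_cancel_right]
      congr 4 <;> ring_nf
    rw [h2, finsum_eq_finsum_comp (f := F) (g := fun p : ℤ × ℕ => (p.1, p.2 + 1))]
    · rw [mul_coe]
      refine finsum_congr ?_
      rintro ⟨i, l⟩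
      have : (Ring.choose (i + 1) (l + 1) - Ring.choose i (l + 1) : ℤ) = Ring.choose i l := by
        rw [Ring.choose_succ_succ]; ring
      simp only [mulTerm, F, this, coeffMap_coe, pow_succ, Module.End.mul_apply]
      push_cast
      ring_nf
    · rintro ⟨i, l⟩ ⟨j, m⟩ h
      simpa using h
    · rintro ⟨i, l⟩ h
      cases l with
      | zero => simp [F] at h
      | succ l => exact ⟨(i, l), rfl⟩
  rw [dLeft, LinearMap.add_apply, map_add, ← key]
  abel

theorem mul_shift_right (V W : PDO R) (n : ℤ) : mul D V (shift n W) = shift n (mul D V W) := by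
  ext k
  rw [shift_coe, mul_coe, mul_coe]
  refine finsum_congr ?_
  rintro ⟨i, l⟩
  simp only [mulTerm, shift_coe]
  ring_nf

theorem coeffMap_mulLeft_mul (a : R) (V W : PDO R) :
    mul D (coeffMap (LinearMap.mulLeft ℂ a) V) W =
      coeffMap (LinearMap.mulLeft ℂ a) (mul D V W) := by
  ext k
  simp only [coeffMap_coe, mul_coe, LinearMap.mulLeft_apply]
  have := AddMonoidHom.map_finsum (AddMonoidHom.mulLeft a) (mulTerm_finite D V W k)
  simp only [AddMonoidHom.coe_mulLeft] at this
  rw [this]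
  refine finsum_congr ?_
  rintro ⟨i, l⟩
  simp only [mulTerm, LinearMap.mulLeft_apply, coeffMap_coe, mul_assoc, mul_smul_comm]

theorem pow_comm_of_comm {d E : Module.End ℂ R} (h : ∀ a, d (E a) = E (d a)) (l : ℕ) (a : R) :
    d ((E ^ l) a) = (E ^ l) (d a) := by
  have : Commute d E := LinearMap.ext h
  exact DFunLike.congr_fun (this.pow_right l) a

theorem coeffMap_derivation_mul {d : R →ₗ[ℂ] R} (hd : ∀ a b, d (a * b) = d a * b + a * d b)
    (hc : ∀ a, d (D a) = D (d a)) (V W : PDO R) :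
    coeffMap d (mul D V W) = mul D (coeffMap d V) W + mul D V (coeffMap d W) := by
  ext k
  simp only [coeffMap_coe, mul_coe, PDO.add_coe]
  have := AddMonoidHom.map_finsum d.toAddMonoidHom (mulTerm_finite D V W k)
  simp only [LinearMap.toAddMonoidHom_coe] at this
  rw [this, ← finsum_add_distrib (mulTerm_finite D (coeffMap d V) W k)
    (mulTerm_finite D V (coeffMap d W) k)]
  refine finsum_congr ?_
  rintro ⟨i, l⟩
  simp only [mulTerm, map_zsmul, hd, coeffMap_coe, smul_add, pow_comm_of_comm hc]

theorem coeffMap_algHom_mul {D' : R' →ₗ[ℂ] R'} (e : R →ₐ[ℂ] R') (he : ∀ a, e (D a) = D' (e a))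
    (V W : PDO R) : coeffMap e.toLinearMap (mul D V W) =
      mul D' (coeffMap e.toLinearMap V) (coeffMap e.toLinearMap W) := by
  have hp : ∀ (l : ℕ) (a : R), e ((D ^ l) a) = (D' ^ l) (e a) := by
    intro l
    induction l with
    | zero => simp
    | succ l ih => intro a; simp [pow_succ, ih, he]
  ext k
  simp only [coeffMap_coe, mul_coe]
  have := AddMonoidHom.map_finsum e.toLinearMap.toAddMonoidHom (mulTerm_finite D V W k)
  simp only [LinearMap.toAddMonoidHom_coe] at this
  rw [this]
  refine finsum_congr ?_
  rintro ⟨i, l⟩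
  simp [mulTerm, hp]

/-! ### Associativity of the product of pseudo-differential operators. -/

section Associativity

variable {D} (hD : ∀ a b, D (a * b) = D a * b + a * D b)
include hD

theorem dLeft_mul (V W : PDO R) : mul D (dLeft D V) W = dLeft D (mul D V W) := by
  have h1 : dLeft D (mul D V W) = shift 1 (mul D V W) + coeffMap D (mul D V W) := rfl
  have h2 : dLeft D V = shift 1 V + coeffMap D V := rfl
  have h3 : dLeft D W = shift 1 W + coeffMap D W := rfl
  rw [h1, h2, map_add, LinearMap.add_apply, shift_mul, h3, map_add, mul_shift_right,
    coeffMap_derivation_mul D hD (fun _ => rfl)]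
  abel

theorem dLeft_surjective : Function.Surjective (dLeft D) := by
  intro V
  refine ⟨mul D (shift (-1) one) V, ?_⟩
  have : dLeft D (shift (-1) one) = one := by
    ext k
    by_cases h : k + 1 = 0
    · simp [h, derivation_one hD]
    · simp [h]
  rw [← dLeft_mul hD, this, one_mul_pdo]

/-- The operators `U` with `(U V) W = U (V W)` for all `V`, `W`. -/
def assocLeft (D : R →ₗ[ℂ] R) : Submodule ℂ (PDO R) where
  carrier := {U | ∀ V W, mul D (mul D U V) W = mul D U (mul D V W)}
  zero_mem' := by intro V W; simp
  add_mem' := by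
    intro U U' h h' V W
    simp [h V W, h' V W]
  smul_mem' := by
    intro c U h V W
    simp [h V W]

/-- Right multiplication by `∂` preserves the left-associating operators since `(U ∂) V = U (∂ V)`.
As left multiplication by `∂` is surjective, the factor `∂` can also be cancelled, which reaches the
negative powers. -/
theorem shift_one_mem_assocLeft (n : ℤ) : shift n one ∈ assocLeft D := by
  have up : ∀ U ∈ assocLeft D, shift 1 U ∈ assocLeft D := by
    intro U hU V W
    rw [shift_mul, shift_mul, hU, dLeft_mul hD]
  have down : ∀ U : PDO R, shift 1 U ∈ assocLeft D → U ∈ assocLeft D := by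
    intro U hU V W
    obtain ⟨V, rfl⟩ := dLeft_surjective hD V
    have := hU V W
    rwa [shift_mul, shift_mul, ← dLeft_mul hD] at this
  have add : ∀ m n : ℤ, ∀ U : PDO R, shift m (shift n U) = shift (n + m) U := by
    intro m n U
    ext k
    simp only [shift_coe]
    ring_nf
  induction n using Int.induction_on with
  | zero =>
    intro V W
    have : shift 0 (one : PDO R) = one := by ext k; simp
    rw [this, one_mul_pdo, one_mul_pdo]
  | succ i ih =>
    have := up _ ih
    rwa [add] at this
  | pred i ih =>
    refine down _ ?_
    rw [add]
    convert ih using 2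
    ring_nf

theorem mem_assocLeft_of_finite (U : PDO R) (M : ℤ) (hU : ∀ i, i < M → U.1 i = 0) :
    U ∈ assocLeft D := by
  obtain ⟨N, hN⟩ := U.2
  have : U = ∑ i ∈ Finset.Icc M N,
      coeffMap (LinearMap.mulLeft ℂ (U.1 i)) (shift i one) := by
    ext k
    rw [PDO.sum_coe]
    by_cases hk : k ∈ Finset.Icc M N
    · rw [Finset.sum_eq_single k]
      · simp
      · intro b _ hb
        have : k - b ≠ 0 := by omega
        simp [this]
      · exact fun h => absurd hk h
    · rw [Finset.sum_eq_zero]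
      · simp only [Finset.mem_Icc, not_and_or, not_le] at hk
        rcases hk with hk | hk
        · exact hU k hk
        · exact hN k hk
      · intro b hb
        have : k - b ≠ 0 := by
          intro h
          exact hk (by rwa [show k = b by omega])
        simp [this]
  rw [this]
  refine Submodule.sum_mem _ fun i _ V W => ?_
  simp only [coeffMap_mulLeft_mul, shift_one_mem_assocLeft hD i V W]

/-- The product of pseudo-differential operators is associative. -/
theorem mul_assoc_pdo (U V W : PDO R) : mul D (mul D U V) W = mul D U (mul D V W) := by
  ext k
  obtain ⟨NV, hV⟩ := V.2
  obtain ⟨NW, hW⟩ := W.2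
  obtain ⟨NU, hNU⟩ := U.2
  -- Terms of `U` of order below `M` contribute to either triple product only in orders below `k`.
  -- Hence `U` may be truncated to finitely many terms when the coefficient of `∂^k` is compared.
  let M := k - NV - NW
  let U₁ : PDO R := ⟨fun i => if M ≤ i then U.1 i else 0, NU, fun i hi => by simp [hNU i hi]⟩
  have h₁ : U₁ ∈ assocLeft D := mem_assocLeft_of_finite hD U₁ M fun i hi => by
    simp [U₁, not_le.mpr hi]
  have h₂ : ∀ i, M - 1 < i → (U - U₁).1 i = 0 := by
    intro i hi
    have : M ≤ i := by omega
    simp [U₁, this]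
  have hU : U = U₁ + (U - U₁) := by abel
  have e₁ : (mul D (mul D (U - U₁) V) W).1 k = 0 :=
    mul_coe_eq_zero D (fun i hi => mul_coe_eq_zero D h₂ hV i hi) hW k (by omega)
  have e₂ : (mul D (U - U₁) (mul D V W)).1 k = 0 :=
    mul_coe_eq_zero D h₂ (fun i hi => mul_coe_eq_zero D hV hW i hi) k (by omega)
  rw [hU]
  simp only [map_add, LinearMap.add_apply, PDO.add_coe, e₁, e₂, h₁ V W]

/-- Left multiplication is an algebra morphism to the endomorphisms. -/
theorem mul_mul_end (U V : PDO R) :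
    (mul D (mul D U V) : Module.End ℂ (PDO R)) = mul D U * mul D V :=
  LinearMap.ext fun W => mul_assoc_pdo hD U V W

theorem mul_pow_end (V : PDO R) (n : ℕ) :
    (mul D (pow D V n) : Module.End ℂ (PDO R)) = (mul D V : Module.End ℂ (PDO R)) ^ n := by
  induction n with
  | zero => ext1 W; simp [pow, one_mul_pdo]
  | succ n ih => rw [pow, mul_mul_end hD, ih, pow_succ']

theorem mul_pow_pow (V : PDO R) (m n : ℕ) :
    mul D (pow D V m) (pow D V n) = pow D V (m + n) := by
  induction m with
  | zero => simp [pow, one_mul_pdo]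
  | succ m ih => rw [pow, mul_assoc_pdo hD, ih, Nat.succ_add, pow]

theorem bracket_mul (U V W : PDO R) :
    bracket D U (mul D V W) = mul D (bracket D U V) W + mul D V (bracket D U W) := by
  simp only [bracket, map_sub, LinearMap.sub_apply, mul_assoc_pdo hD]
  abel

end Associativity

/-- The multiplication operator `b ∂⁰`. -/
def const : R →ₗ[ℂ] PDO R where
  toFun b := ⟨fun i => if i = 0 then b else 0, 0, fun i hi => by simp [hi.ne']⟩
  map_add' a b := by ext k; by_cases h : k = 0 <;> simp [h]
  map_smul' c b := by ext k; by_cases h : k = 0 <;> simp [h]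

@[simp] theorem const_coe (b : R) (k : ℤ) : (const b).1 k = if k = 0 then b else 0 := rfl

/-- A term `v_{n-1} ∂^{n-1} b` with `n ≥ 1` would reach `∂⁻¹` with the coefficient `(n-1 choose n) =
0`. -/
theorem res_mul_const (V : PDO R) (b : R) : res (mul D V (const b)) = res V * b := by
  rw [res_eq, mul_coe_single D (l := 0)]
  · simp [res_eq]
  · intro i hi
    simp [hi]
  · intro n hn
    obtain ⟨m, rfl⟩ := Nat.exists_eq_succ_of_ne_zero hn
    have : Ring.choose (-1 + (m.succ : ℕ) : ℤ) m.succ = 0 := by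
      rw [show (-1 + (m.succ : ℕ) : ℤ) = (m : ℕ) by push_cast; ring, Ring.choose_natCast,
        Nat.choose_succ_self]
      rfl
    rw [this, zero_smul]

theorem projPos_mul_const (V : PDO R) (b : R) :
    projPos (mul D V (const b)) = mul D (projPos V) (const b) := by
  have hV := projPos_add_projNeg V
  conv_lhs => rw [← hV]
  ext k
  rw [map_add, LinearMap.add_apply]
  by_cases hk : 0 ≤ k
  · have : (mul D (projNeg V) (const b)).1 k = 0 :=
      mul_coe_eq_zero D (projNeg_coe_eq_zero V) (M := 0) (fun i hi => by simp [hi.ne']) k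
        (by omega)
    simp [hk, this]
  · have : (mul D (projPos V) (const b)).1 k = 0 :=
      mul_coe_eq_zero_of_pos D (fun i hi => by simp [not_le.mpr hi])
        (fun i hi => by simp [hi.ne]) k (by omega)
    simp [hk, this]

theorem projNeg_mul_const (V : PDO R) (b : R) :
    projNeg (mul D V (const b)) = mul D (projNeg V) (const b) := by
  have := projPos_mul_const D V b
  simp only [projNeg, LinearMap.sub_apply, LinearMap.id_apply, map_sub, this]

end Calculus

/-! ### Powers of the Lax operator -/

section Lax

variable {R : Type*} [Ring R] [Algebra ℂ R] {D : R →ₗ[ℂ] R}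

theorem lax_coe (u : ℕ → R) (k : ℤ) :
    (lax u).1 k = if k = 1 then 1 else if k < 0 then u (-k - 1).toNat else 0 := rfl

theorem lax_coe_neg (u : ℕ → R) (k : ℕ) : (lax u).1 (-(k : ℤ) - 1) = u k := by
  rw [lax_coe, if_neg (by omega), if_pos (by omega)]
  congr 1
  omega

theorem projPos_lax (u : ℕ → R) : projPos (lax u) = shift 1 one := by
  ext k
  by_cases hk : 0 ≤ k
  · by_cases h1 : k = 1
    · simp [h1, lax_coe]
    · have : k - 1 ≠ 0 := by omega
      simp [hk, lax_coe, h1, not_lt.mpr hk, this]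
  · have : k - 1 ≠ 0 := by omega
    simp [hk, this]

theorem bracket_projPos (V : PDO R) (W : PDO R) :
    bracket D (projPos V) W = bracket D V W - bracket D (projNeg V) W := by
  have : projPos V = V - projNeg V := by simp [projNeg]
  rw [bracket, this]
  simp only [bracket, map_sub, LinearMap.sub_apply]
  abel

section Derivation

variable (hD : ∀ a b, D (a * b) = D a * b + a * D b)
include hD

theorem pow_one_pdo (V : PDO R) : pow D V 1 = V := by
  rw [pow, pow, mul_one_pdo hD]

theorem bracket_pow_pow (V : PDO R) (m n : ℕ) : bracket D (pow D V m) (pow D V n) = 0 := by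
  rw [bracket, mul_pow_pow hD, mul_pow_pow hD, add_comm, sub_self]

theorem bracket_pow_self (V : PDO R) (n : ℕ) : bracket D (pow D V n) V = 0 := by
  conv_lhs => rw [← pow_one_pdo hD V, pow_one_pdo hD V]
  have := bracket_pow_pow hD V n 1
  rwa [pow_one_pdo hD] at this

/-- Makes the Lax equation consistent with the shape of `𝔏`. As `𝔏^n` commutes with `𝔏`, the bracket
equals `-[(𝔏^n)_{<0}, 𝔏]`, of order at most `0`, and the two leading coefficients cancel because `𝔏`
is monic. -/
theorem bracket_projPos_lax_coe (u : ℕ → R) (n : ℕ) (k : ℤ) (hk : 0 ≤ k) :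
    (bracket D (projPos (pow D (lax u) n)) (lax u)).1 k = 0 := by
  rw [bracket_projPos, bracket_pow_self hD, zero_sub, PDO.neg_coe, bracket, PDO.sub_coe]
  have hN := projNeg_coe_eq_zero (pow D (lax u) n)
  have hL : ∀ i, 1 < i → (lax u).1 i = 0 := fun i hi => by
    rw [lax_coe, if_neg hi.ne', if_neg (by omega)]
  rcases hk.eq_or_lt with rfl | hk
  · have h1 := mul_coe_leading D hN hL
    have h2 := mul_coe_leading D hL hN
    norm_num at h1 h2
    rw [h1, h2]
    simp [lax_coe]
  · rw [mul_coe_eq_zero D hN hL k (by omega), mul_coe_eq_zero D hL hN k (by omega)]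
    simp

theorem bracket_derivation_lax (V : PDO R) : bracket D (shift 1 one) V = coeffMap D V := by
  rw [bracket, shift_mul, one_mul_pdo, mul_shift_right, mul_one_pdo hD]
  simp [dLeft]

omit hD in
theorem res_bracket_projPos (V W : PDO R) :
    res (bracket D (projPos V) W) = res (bracket D (projPos V) (projNeg W)) := by
  conv_lhs => rw [← projPos_add_projNeg W]
  simp [bracket, res_mul_projPos_projPos]

/-- Split both factors of `[V^n, V^m] = 0` into parts of order `≥ 0` and `< 0`. Products of parts of
equal type have no residue, so the residues of the two mixed brackets cancel. -/
theorem res_bracket_pow_symm (V : PDO R) (m n : ℕ) :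
    res (bracket D (projPos (pow D V n)) (pow D V m)) =
      res (bracket D (projPos (pow D V m)) (pow D V n)) := by
  have h := congrArg res (bracket_pow_pow hD V n m)
  rw [res_bracket_projPos, res_bracket_projPos (pow D V m)]
  rw [← projPos_add_projNeg (pow D V n), ← projPos_add_projNeg (pow D V m)] at h
  simp only [bracket, map_add, LinearMap.add_apply, map_sub, map_zero, res_mul_projPos_projPos,
    res_mul_projNeg_projNeg] at h ⊢
  rw [← sub_eq_zero, ← h]
  abel

end Derivation
end Lax

/-! ### The operator space -/

theorem dPoly_leibniz : ∀ a b, dPoly (a * b) = dPoly a * b + a * dPoly b := dPoly_mul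

@[simp] theorem opProj_true : opProj true = projPos := rfl
@[simp] theorem opProj_false : opProj false = projNeg := rfl

theorem projPos_add_projNeg_end :
    (projPos + projNeg : Module.End ℂ (PDO Poly)) = 1 :=
  LinearMap.ext projPos_add_projNeg

theorem opWord_append (l l' : List Bool) (s : Bool) :
    opWord (l ++ s :: l') = opWord l * opProj s * opWord l' := by
  induction l with
  | nil => rfl
  | cons t l ih => rw [List.cons_append, opWord, ih, opWord]; simp only [mul_assoc]

/-- The span of the words with at most `w` factors `S`. -/
def opFil (w : ℕ) : Submodule ℂ (Module.End ℂ (PDO Poly)) :=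
  Submodule.span ℂ (opWord '' {l | l.length + 1 ≤ w})

theorem opWord_mem_opFil (l : List Bool) : opWord l ∈ opFil (l.length + 1) :=
  Submodule.subset_span ⟨l, le_refl (l.length + 1), rfl⟩

theorem opFil_mono {a b : ℕ} (h : a ≤ b) : opFil a ≤ opFil b :=
  Submodule.span_mono (Set.image_mono fun _ hl => le_trans hl h)

theorem opFil_le_opSpace (a : ℕ) : opFil a ≤ opSpace :=
  Submodule.span_mono (Set.image_subset_range _ _)

theorem opSpace_eq_iSup : opSpace = ⨆ a, opFil a := by
  refine le_antisymm (Submodule.span_le.mpr ?_) (iSup_le opFil_le_opSpace)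
  rintro _ ⟨l, rfl⟩
  exact Submodule.mem_iSup_of_mem _ (opWord_mem_opFil l)

theorem exists_mem_opFil {A : Module.End ℂ (PDO Poly)} (hA : A ∈ opSpace) :
    ∃ a, A ∈ opFil a := by
  rw [opSpace_eq_iSup] at hA
  exact (Submodule.mem_iSup_of_directed _
    (Monotone.directed_le fun _ _ h => opFil_mono h)).mp hA

theorem opS_mem_opFil : opS ∈ opFil 1 := opWord_mem_opFil []

theorem opS_mem : opS ∈ opSpace := opFil_le_opSpace 1 opS_mem_opFil

theorem mul_opProj_mul_mem_opFil {A B : Module.End ℂ (PDO Poly)} {a b : ℕ} (s : Bool)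
    (hA : A ∈ opFil a) (hB : B ∈ opFil b) : A * opProj s * B ∈ opFil (a + b) := by
  induction hA using Submodule.span_induction with
  | zero => simp
  | add X Y _ _ hX hY => rw [add_mul, add_mul]; exact add_mem hX hY
  | smul c X _ hX => rw [smul_mul_assoc, smul_mul_assoc]; exact Submodule.smul_mem _ c hX
  | mem X hX =>
    obtain ⟨l, hl, rfl⟩ := hX
    induction hB using Submodule.span_induction with
    | zero => simp
    | add X Y _ _ hX hY => rw [mul_add]; exact add_mem hX hY
    | smul c X _ hX => rw [mul_smul_comm]; exact Submodule.smul_mem _ c hX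
    | mem X hX =>
      obtain ⟨l', hl', rfl⟩ := hX
      rw [← opWord_append]
      refine opFil_mono ?_ (opWord_mem_opFil _)
      simp only [Set.mem_ofPred_eq] at hl hl'
      simp only [List.length_append, List.length_cons]
      omega

theorem mul_projPos_mul_mem_opFil {A B : Module.End ℂ (PDO Poly)} {a b : ℕ}
    (hA : A ∈ opFil a) (hB : B ∈ opFil b) : A * projPos * B ∈ opFil (a + b) :=
  mul_opProj_mul_mem_opFil true hA hB

theorem mul_projNeg_mul_mem_opFil {A B : Module.End ℂ (PDO Poly)} {a b : ℕ}
    (hA : A ∈ opFil a) (hB : B ∈ opFil b) : A * projNeg * B ∈ opFil (a + b) :=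
  mul_opProj_mul_mem_opFil false hA hB

theorem mul_mem_opFil {A B : Module.End ℂ (PDO Poly)} {a b : ℕ}
    (hA : A ∈ opFil a) (hB : B ∈ opFil b) : A * B ∈ opFil (a + b) := by
  have : A * B = A * projPos * B + A * projNeg * B := by
    rw [← add_mul, ← mul_add, projPos_add_projNeg_end, mul_one]
  rw [this]
  exact add_mem (mul_projPos_mul_mem_opFil hA hB) (mul_projNeg_mul_mem_opFil hA hB)

theorem opMul_mem_opFil {A B : Module.End ℂ (PDO Poly)} {a b : ℕ}
    (hA : A ∈ opFil a) (hB : B ∈ opFil b) : opMul A B ∈ opFil (a + 1 + b) :=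
  mul_projNeg_mul_mem_opFil (mul_projPos_mul_mem_opFil hA opS_mem_opFil) hB

theorem opS_pow_mem_opFil {n : ℕ} (hn : 1 ≤ n) : opS ^ n ∈ opFil n := by
  induction n, hn using Nat.le_induction with
  | base => simpa using opS_mem_opFil
  | succ n _ ih => rw [pow_succ]; exact mul_mem_opFil ih opS_mem_opFil

section Mem

variable {A B : Module.End ℂ (PDO Poly)} (hA : A ∈ opSpace) (hB : B ∈ opSpace)
include hA hB

theorem mul_projPos_mul_mem : A * projPos * B ∈ opSpace := by
  obtain ⟨a, ha⟩ := exists_mem_opFil hA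
  obtain ⟨b, hb⟩ := exists_mem_opFil hB
  exact opFil_le_opSpace _ (mul_projPos_mul_mem_opFil ha hb)

theorem mul_projNeg_mul_mem : A * projNeg * B ∈ opSpace := by
  obtain ⟨a, ha⟩ := exists_mem_opFil hA
  obtain ⟨b, hb⟩ := exists_mem_opFil hB
  exact opFil_le_opSpace _ (mul_projNeg_mul_mem_opFil ha hb)

theorem opMul_mem : opMul A B ∈ opSpace :=
  mul_projNeg_mul_mem (mul_projPos_mul_mem hA opS_mem) hB

end Mem

theorem opS_pow_mem {n : ℕ} (hn : 1 ≤ n) : opS ^ n ∈ opSpace :=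
  opFil_le_opSpace _ (opS_pow_mem_opFil hn)

theorem opS_pow_apply (n : ℕ) (V : PDO Poly) :
    (opS ^ n) V = mul dPoly (pow dPoly genLax n) V :=
  (DFunLike.congr_fun (mul_pow_end dPoly_leibniz genLax n) V).symm

theorem opS_pow_one (n : ℕ) : (opS ^ n) one = pow dPoly genLax n := by
  rw [opS_pow_apply, mul_one_pdo dPoly_leibniz]

theorem opS_apply (V : PDO Poly) : opS V = mul dPoly genLax V := rfl

theorem opS_one : opS one = genLax := mul_one_pdo dPoly_leibniz _

theorem resAt_eq (A : Module.End ℂ (PDO Poly)) : resAt A = res (A one) := rfl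

/-- Left multiplication by `𝔏` commutes with right multiplications by associativity, and right
multiplication by a function respects the splitting by order. -/
theorem apply_mul_const {A : Module.End ℂ (PDO Poly)} (hA : A ∈ opSpace) (V : PDO Poly)
    (b : Poly) : A (mul dPoly V (const b)) = mul dPoly (A V) (const b) := by
  induction hA using Submodule.span_induction with
  | zero => simp
  | add X Y _ _ hX hY => simp [hX, hY]
  | smul c X _ hX => simp [hX]
  | mem X hX =>
    obtain ⟨l, rfl⟩ := hX
    induction l with
    | nil => exact (mul_assoc_pdo dPoly_leibniz _ _ _).symm
    | cons s l ih =>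
      simp only [opWord, Module.End.mul_apply, ih]
      have : opProj s (mul dPoly (opWord l V) (const b)) =
          mul dPoly (opProj s (opWord l V)) (const b) := by
        cases s
        · exact projNeg_mul_const _ _ _
        · exact projPos_mul_const _ _ _
      rw [this]
      exact (mul_assoc_pdo dPoly_leibniz _ _ _).symm

/-- `𝔏` has order `1` and `V_{<0}` order at most `-1`, so only the product of leading coefficients
survives. It is the reason why `A π₊ S π₋ B` turns into a product of residues. -/
theorem projPos_opS_projNeg (V : PDO Poly) : projPos (opS (projNeg V)) = const (res V) := by
  ext1 k
  have hL : ∀ i, 1 < i → genLax.1 i = 0 := fun i hi => by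
    rw [genLax, lax_coe, if_neg hi.ne', if_neg (by omega)]
  have hN := projNeg_coe_eq_zero V
  rw [projPos_coe, const_coe, opS_apply]
  split_ifs with h1 h2 h2
  · subst h2
    have := mul_coe_leading dPoly hL hN
    norm_num at this
    rw [this]
    simp [genLax, lax_coe, res_eq]
  · exact mul_coe_eq_zero dPoly hL hN k (by omega)
  · omega
  · rfl

theorem resAt_opMul {A : Module.End ℂ (PDO Poly)} (hA : A ∈ opSpace)
    (B : Module.End ℂ (PDO Poly)) : resAt (opMul A B) = resAt A * resAt B := by
  have h : opMul A B one = A (projPos (opS (projNeg (B one)))) := rfl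
  rw [resAt_eq, h, projPos_opS_projNeg, ← one_mul_pdo dPoly (const _), apply_mul_const hA,
    res_mul_const]
  rfl

/-! ### The flows on the free differential algebra -/

section FreeDerivation

variable {X : Type*}

/-- The algebra homomorphism `a ↦ a + ε d a` with prescribed `d` on the generators. -/
def freeDual (g : X → FreeAlgebra ℂ X) :
    FreeAlgebra ℂ X →ₐ[ℂ] TrivSqZeroExt (FreeAlgebra ℂ X) (FreeAlgebra ℂ X) :=
  FreeAlgebra.lift ℂ fun x => TrivSqZeroExt.inl (FreeAlgebra.ι ℂ x) + TrivSqZeroExt.inr (g x)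

/-- The derivation of a free algebra with prescribed values on the generators. -/
def freeDer (g : X → FreeAlgebra ℂ X) : FreeAlgebra ℂ X →ₗ[ℂ] FreeAlgebra ℂ X where
  toFun a := (freeDual g a).snd
  map_add' a b := by simp
  map_smul' c a := by simp

@[simp] theorem freeDer_ι (g : X → FreeAlgebra ℂ X) (x : X) :
    freeDer g (FreeAlgebra.ι ℂ x) = g x := by
  simp [freeDer, freeDual]

theorem freeDual_fst (g : X → FreeAlgebra ℂ X) (a : FreeAlgebra ℂ X) :
    (freeDual g a).fst = a := by
  have h : (TrivSqZeroExt.fstHom ℂ (FreeAlgebra ℂ X) (FreeAlgebra ℂ X)).comp (freeDual g) =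
      AlgHom.id ℂ _ := by
    apply FreeAlgebra.hom_ext
    funext p
    simp [freeDual]
  exact DFunLike.congr_fun h a

theorem freeDer_mul (g : X → FreeAlgebra ℂ X) (a b : FreeAlgebra ℂ X) :
    freeDer g (a * b) = freeDer g a * b + a * freeDer g b := by
  simp [freeDer, freeDual_fst, add_comm]

/-- Two derivations along a homomorphism agree if they agree on the generators. -/
theorem derivation_ext {C : Type*} [Ring C] [Algebra ℂ C] (e : FreeAlgebra ℂ X →ₐ[ℂ] C)
    (d d' : FreeAlgebra ℂ X →ₗ[ℂ] C) (hd : ∀ a b, d (a * b) = d a * e b + e a * d b)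
    (hd' : ∀ a b, d' (a * b) = d' a * e b + e a * d' b)
    (h : ∀ x, d (FreeAlgebra.ι ℂ x) = d' (FreeAlgebra.ι ℂ x)) : d = d' := by
  have one_eq : ∀ d : FreeAlgebra ℂ X →ₗ[ℂ] C,
      (∀ a b, d (a * b) = d a * e b + e a * d b) → d 1 = 0 := by
    intro d hd
    simpa using hd 1 1
  ext a
  induction a using FreeAlgebra.induction with
  | grade0 r => simp [Algebra.algebraMap_eq_smul_one, one_eq d hd, one_eq d' hd']
  | grade1 x => exact h x
  | mul a b ha hb => rw [hd, hd', ha, hb]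
  | add a b ha hb => rw [map_add, map_add, ha, hb]

end FreeDerivation

/-- The differential operator `(𝔏^n)_{≥0}`. -/
def posPow (n : ℕ) : PDO Poly := projPos (pow dPoly genLax n)

/-- The Gelfand-Dickey flow on the free differential algebra. -/
def dFlow (n : ℕ) : Poly →ₗ[ℂ] Poly :=
  freeDer fun p => (dPoly ^ p.2) ((bracket dPoly (posPow n) genLax).1 (-(p.1 : ℤ) - 1))

theorem dFlow_mul (n : ℕ) (a b : Poly) : dFlow n (a * b) = dFlow n a * b + a * dFlow n b :=
  freeDer_mul _ a b

theorem dPoly_pow_ι (k m : ℕ) :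
    (dPoly ^ m) (FreeAlgebra.ι ℂ (k, 0)) = FreeAlgebra.ι ℂ (k, m) := by
  induction m with
  | zero => rfl
  | succ m ih => rw [pow_succ', Module.End.mul_apply, ih, dPoly_ι]

theorem dFlow_dPoly (n : ℕ) (a : Poly) : dFlow n (dPoly a) = dPoly (dFlow n a) := by
  have : dFlow n ∘ₗ dPoly - dPoly ∘ₗ dFlow n = 0 := by
    refine derivation_ext (AlgHom.id ℂ _) _ _ ?_ (by simp) ?_
    · intro a b
      simp only [LinearMap.sub_apply, LinearMap.comp_apply, dPoly_mul, dFlow_mul, map_add,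
        AlgHom.id_apply]
      noncomm_ring
    · rintro ⟨k, m⟩
      simp only [LinearMap.sub_apply, LinearMap.comp_apply, dPoly_ι, dFlow, freeDer_ι, pow_succ',
        Module.End.mul_apply, sub_self, LinearMap.zero_apply]
  exact sub_eq_zero.mp (DFunLike.congr_fun this a)

/-- The definition of `dFlow` prescribes only the coefficients of negative order; in the others both
sides vanish, by `bracket_projPos_lax_coe`. -/
theorem coeffMap_dFlow_genLax (n : ℕ) :
    coeffMap (dFlow n) genLax = bracket dPoly (posPow n) genLax := by
  ext k
  by_cases hk : 0 ≤ k
  · rw [posPow, genLax, bracket_projPos_lax_coe dPoly_leibniz _ _ _ hk, coeffMap_coe, lax_coe,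
      if_neg (not_lt.mpr hk)]
    split_ifs
    · exact derivation_one (dFlow_mul n)
    · simp
  · obtain ⟨j, rfl⟩ : ∃ j : ℕ, k = -(j : ℤ) - 1 := ⟨(-k - 1).toNat, by omega⟩
    rw [coeffMap_coe, genLax, lax_coe_neg, dFlow, freeDer_ι]
    rfl

/-- Since `𝔏_{≥0} = ∂` and `[∂, V]` differentiates the coefficients of `V`, the first flow will be
`∂` itself. -/
theorem posPow_one : posPow 1 = shift 1 one := by
  rw [posPow, pow_one_pdo dPoly_leibniz, genLax, projPos_lax]

theorem dFlow_one : dFlow 1 = dPoly := by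
  refine derivation_ext (AlgHom.id ℂ _) _ _ (dFlow_mul 1) dPoly_mul ?_
  rintro ⟨k, m⟩
  rw [dFlow, freeDer_ι, posPow_one, bracket_derivation_lax dPoly_leibniz, coeffMap_coe, genLax,
    lax_coe_neg, ← pow_comm_of_comm (fun _ => rfl), dPoly_pow_ι]

theorem end_neg_mem {p : Submodule ℂ (Module.End ℂ (PDO Poly))} {A : Module.End ℂ (PDO Poly)}
    (hA : A ∈ p) : -A ∈ p := by
  have : -A = (-1 : ℂ) • A := by ext1 V; simp
  rw [this]
  exact p.smul_mem _ hA

theorem end_sub_mem {p : Submodule ℂ (Module.End ℂ (PDO Poly))} {A B : Module.End ℂ (PDO Poly)}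
    (hA : A ∈ p) (hB : B ∈ p) : A - B ∈ p := by
  have : A - B = A + -B := by ext1 V; simp [sub_eq_add_neg]
  rw [this]
  exact p.add_mem hA (end_neg_mem hB)

/-- The operator `d_n - (𝔏^n)_{≥0}` on pseudo-differential operators. -/
def flowX (n : ℕ) : Module.End ℂ (PDO Poly) := coeffMap (dFlow n) - mul dPoly (posPow n)

/-- The Lax equation in the form `[d_n - (𝔏^n)_{≥0}, 𝔏] = 0`. -/
theorem flowX_mul_opS (n : ℕ) : flowX n * opS = opS * flowX n := by
  ext1 V
  have h := coeffMap_derivation_mul dPoly (dFlow_mul n) (dFlow_dPoly n) genLax V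
  simp only [flowX, Module.End.mul_apply, LinearMap.sub_apply, opS_apply, map_sub, h,
    coeffMap_dFlow_genLax, bracket, mul_assoc_pdo dPoly_leibniz]
  abel

/-- With `P = (𝔏^n)_{≥0}`, the part `P V_{≥0}` is already a differential operator, so the commutator
with `π₊` leaves `(P V_{<0})_{≥0}`. There `P` may be replaced by `𝔏^n`, because `(𝔏^n)_{<0} V_{<0}`
has negative order. -/
theorem flowX_mul_projPos (n : ℕ) :
    flowX n * projPos = projPos * flowX n + projPos * opS ^ n * projNeg := by
  ext1 V
  have h1 : coeffMap (dFlow n) (projPos V) = projPos (coeffMap (dFlow n) V) := by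
    ext k
    by_cases hk : 0 ≤ k <;> simp [hk]
  have h2 := projPos_add_projNeg (mul dPoly (posPow n) (projPos V))
  rw [posPow, projNeg_mul_projPos_projPos, add_zero] at h2
  have h3 : projPos ((opS ^ n) (projNeg V)) = projPos (mul dPoly (posPow n) (projNeg V)) := by
    rw [opS_pow_apply, ← projPos_add_projNeg (pow dPoly genLax n), map_add, LinearMap.add_apply,
      map_add, projPos_mul_projNeg_projNeg, add_zero, posPow]
  have h4 : V = projPos V + projNeg V := (projPos_add_projNeg V).symm
  simp only [flowX, Module.End.mul_apply, LinearMap.sub_apply, LinearMap.add_apply, map_sub, h1,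
    h3]
  conv_rhs => rw [show mul dPoly (posPow n) V = mul dPoly (posPow n) (projPos V) +
    mul dPoly (posPow n) (projNeg V) by rw [← map_add, ← h4]]
  rw [map_add, posPow, h2]
  abel

theorem flowX_mul_projNeg (n : ℕ) :
    flowX n * projNeg = projNeg * flowX n - projPos * opS ^ n * projNeg := by
  have h := flowX_mul_projPos n
  have e : flowX n * projNeg = flowX n - flowX n * projPos := by
    ext1 V; simp [projNeg]
  have e' : projNeg * flowX n = flowX n - projPos * flowX n := by
    ext1 V; simp [projNeg]
  rw [e, e', h]
  ext1 V
  simp only [LinearMap.sub_apply, LinearMap.add_apply]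
  abel

/-- Commuting `X_n` through a word leaves each `S` intact and replaces one `π_±` at a time by `± π₊
S^n π₋`, which adds `n` factors `S`. -/
theorem flowX_commutator_mem {n : ℕ} (hn : 1 ≤ n) {A : Module.End ℂ (PDO Poly)} {a : ℕ}
    (hA : A ∈ opFil a) : flowX n * A - A * flowX n ∈ opFil (a + n) := by
  induction hA using Submodule.span_induction with
  | zero =>
    convert Submodule.zero_mem _ using 1
    ext1 V; simp
  | add X Y _ _ hX hY =>
    convert add_mem hX hY using 1
    ext1 V
    simp only [LinearMap.sub_apply, LinearMap.add_apply, Module.End.mul_apply, map_add]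
    abel
  | smul c X _ hX =>
    convert Submodule.smul_mem _ c hX using 1
    ext1 V
    simp only [LinearMap.sub_apply, LinearMap.smul_apply, Module.End.mul_apply, map_smul, smul_sub]
  | mem X hX =>
    obtain ⟨l, hl, rfl⟩ := hX
    refine opFil_mono (Nat.add_le_add_right hl n) ?_
    clear hl
    induction l with
    | nil =>
      convert Submodule.zero_mem _ using 1
      rw [opWord, flowX_mul_opS]
      ext1 V
      simp
    | cons s l ih =>
      have e : flowX n * opWord (s :: l) - opWord (s :: l) * flowX n =
          opS * opProj s * (flowX n * opWord l - opWord l * flowX n) +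
          opS * (flowX n * opProj s - opProj s * flowX n) * opWord l := by
        have h := fun V => DFunLike.congr_fun (flowX_mul_opS n) V
        simp only [Module.End.mul_apply] at h
        ext1 V
        simp only [opWord, LinearMap.sub_apply, LinearMap.add_apply, Module.End.mul_apply, map_sub, h]
        abel
      rw [e]
      refine add_mem ?_ ?_
      · refine opFil_mono ?_ (mul_opProj_mul_mem_opFil s opS_mem_opFil ih)
        simp only [List.length_cons]
        omega
      · have key : opS * (projPos * opS ^ n * projNeg) * opWord l ∈ opFil (1 + n + (l.length + 1)) := by
          rw [← mul_assoc, ← mul_assoc]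
          exact mul_projNeg_mul_mem_opFil
            (mul_projPos_mul_mem_opFil opS_mem_opFil (opS_pow_mem_opFil hn)) (opWord_mem_opFil l)
        refine opFil_mono (a := 1 + n + (l.length + 1)) (by simp only [List.length_cons]; omega) ?_
        cases s
        · convert end_neg_mem key using 1
          rw [opProj_false, flowX_mul_projNeg]
          ext1 V
          simp
        · convert key using 1
          rw [opProj_true, flowX_mul_projPos]
          ext1 V
          simp

/-- The action of the flow on residues, lifted to operators. -/
def flowOp (n : ℕ) (A : Module.End ℂ (PDO Poly)) : Module.End ℂ (PDO Poly) :=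
  flowX n * A - A * flowX n + opS ^ n * projNeg * A - A * projPos * opS ^ n

theorem flowOp_mem_opFil {n : ℕ} (hn : 1 ≤ n) {A : Module.End ℂ (PDO Poly)} {a : ℕ}
    (hA : A ∈ opFil a) : flowOp n A ∈ opFil (a + n) := by
  refine end_sub_mem (add_mem (flowX_commutator_mem hn hA) ?_)
    (mul_projPos_mul_mem_opFil hA (opS_pow_mem_opFil hn))
  rw [add_comm]
  exact mul_projNeg_mul_mem_opFil (opS_pow_mem_opFil hn) hA

theorem flowOp_mem {n : ℕ} (hn : 1 ≤ n) {A : Module.End ℂ (PDO Poly)} (hA : A ∈ opSpace) :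
    flowOp n A ∈ opSpace := by
  obtain ⟨a, ha⟩ := exists_mem_opFil hA
  exact opFil_le_opSpace _ (flowOp_mem_opFil hn ha)

theorem res_posPow_mul (n : ℕ) (V : PDO Poly) :
    res (mul dPoly (posPow n) V) = res ((opS ^ n) (projNeg V)) := by
  have h : V = projPos V + projNeg V := (projPos_add_projNeg V).symm
  have h' := (projPos_add_projNeg (pow dPoly genLax n)).symm
  rw [opS_pow_apply]
  conv_lhs => rw [h]
  conv_rhs => rw [h']
  simp only [map_add, LinearMap.add_apply, posPow, res_mul_projPos_projPos,
    res_mul_projNeg_projNeg, zero_add, add_zero]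

theorem coeffMap_one {R : Type*} [Ring R] [Algebra ℂ R] {d : R →ₗ[ℂ] R}
    (hd : ∀ a b, d (a * b) = d a * b + a * d b) : coeffMap d one = 0 := by
  ext k
  by_cases hk : k = 0 <;> simp [hk, derivation_one hd]

/-- Write `d_n = X_n + (𝔏^n)_{≥0}` on `A(I)`. Under the residue the second summand gives `S^n π₋ A`,
while moving `X_n` past `A` produces the commutator and, from `X_n I = -(𝔏^n)_{≥0}`, the term `-A π₊
S^n`. -/
theorem dFlow_resAt (n : ℕ) (A : Module.End ℂ (PDO Poly)) :
    dFlow n (resAt A) = resAt (flowOp n A) := by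
  have h1 : flowX n one = -projPos ((opS ^ n) one) := by
    simp [flowX, coeffMap_one (dFlow_mul n), mul_one_pdo dPoly_leibniz, opS_pow_one, posPow]
  have h2 : dFlow n (resAt A) =
      res (flowX n (A one)) + res (mul dPoly (posPow n) (A one)) := by
    simp [flowX, res_eq, resAt_eq]
  rw [h2, res_posPow_mul, flowOp]
  simp only [resAt_eq, LinearMap.sub_apply, LinearMap.add_apply, Module.End.mul_apply, h1, map_sub,
    map_add, map_neg]
  abel

/-! ### Residues generate the augmentation ideal freely -/

/-- The residues of the words with at most `w` factors `S`. -/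
def resFil (w : ℕ) : Submodule ℂ Poly := (opFil w).map resAt

theorem resFil_mono {a b : ℕ} (h : a ≤ b) : resFil a ≤ resFil b :=
  Submodule.map_mono (opFil_mono h)

theorem resFil_le_resAlg (a : ℕ) : resFil a ≤ resAlg := Submodule.map_mono (opFil_le_opSpace a)

theorem mul_mem_resFil {x y : Poly} {a b : ℕ} (hx : x ∈ resFil a) (hy : y ∈ resFil b) :
    x * y ∈ resFil (a + b + 1) := by
  obtain ⟨A, hA, rfl⟩ := hx
  obtain ⟨B, hB, rfl⟩ := hy
  rw [← resAt_opMul (opFil_le_opSpace _ hA)]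
  refine resFil_mono ?_ ⟨_, opMul_mem_opFil hA hB, rfl⟩
  omega

theorem dPoly_mem_resFil {x : Poly} {a : ℕ} (hx : x ∈ resFil a) : dPoly x ∈ resFil (a + 1) := by
  obtain ⟨A, hA, rfl⟩ := hx
  rw [← dFlow_one, dFlow_resAt]
  exact ⟨_, flowOp_mem_opFil le_rfl hA, rfl⟩

theorem dPoly_pow_mem_resFil {x : Poly} {a : ℕ} (hx : x ∈ resFil a) (l : ℕ) :
    (dPoly ^ l) x ∈ resFil (a + l) := by
  induction l with
  | zero => simpa using hx
  | succ l ih =>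
    rw [pow_succ', Module.End.mul_apply]
    exact dPoly_mem_resFil ih

theorem genLax_mul (W : PDO Poly) :
    mul dPoly genLax W = dLeft dPoly W + mul dPoly (projNeg genLax) W := by
  conv_lhs => rw [← projPos_add_projNeg genLax]
  rw [map_add, LinearMap.add_apply, genLax, projPos_lax, shift_mul, one_mul_pdo]

/-- Comparing coefficients of `∂^{-k-1}` in `𝔏 W = ∂ W + 𝔏_{<0} W` with `W = A(I)_{<0}` expresses
the next coefficient of `A(I)` through a coefficient of `(S π₋ A)(I)`, a derivative, and products of
earlier coefficients. All terms have the same weight, so the bound `a + k` propagates. -/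
theorem coeff_mem_resFil (k : ℕ) : ∀ (a : ℕ) (A : Module.End ℂ (PDO Poly)), A ∈ opFil a →
    (A one).1 (-(k : ℤ) - 1) ∈ resFil (a + k) := by
  induction k using Nat.strong_induction_on with
  | _ k ih =>
  intro a A hA
  cases k with
  | zero => exact ⟨A, hA, rfl⟩
  | succ k =>
    have h1 := ih k k.lt_succ_self _ _ (mul_projNeg_mul_mem_opFil opS_mem_opFil hA)
    have h2 := dPoly_mem_resFil (ih k k.lt_succ_self _ _ hA)
    have h3 : (mul dPoly (projNeg genLax) (projNeg (A one))).1 (-(k : ℤ) - 1) ∈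
        resFil (a + (k + 1)) := by
      rw [mul_coe]
      refine finsum_induction (· ∈ resFil (a + (k + 1))) (zero_mem _)
        (fun _ _ => add_mem) ?_
      rintro ⟨i, l⟩
      simp only [mulTerm]
      refine zsmul_mem ?_ _
      by_cases hi : 0 ≤ i
      · simp [hi]
      by_cases hj : 0 ≤ -(k : ℤ) - 1 - i + l
      · rw [projNeg_coe (A one), if_pos hj]
        simp
      obtain ⟨p, rfl⟩ : ∃ p : ℕ, i = -(p : ℤ) - 1 := ⟨(-i - 1).toNat, by omega⟩
      obtain ⟨q, hq⟩ : ∃ q : ℕ, -(k : ℤ) - 1 - (-(p : ℤ) - 1) + l = -(q : ℤ) - 1 :=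
        ⟨(-(-(k : ℤ) - 1 - (-(p : ℤ) - 1) + l) - 1).toNat, by omega⟩
      have hp := ih p (by omega) _ _ opS_mem_opFil
      rw [opS_one] at hp
      have hq' := dPoly_pow_mem_resFil (ih q (by omega) _ _ hA) l
      rw [hq, projNeg_coe, projNeg_coe, if_neg (by omega), if_neg (by omega)]
      exact resFil_mono (by omega) (mul_mem_resFil hp hq')
    have h4 : (A one).1 (-((k + 1 : ℕ) : ℤ) - 1) =
        ((opS * projNeg * A : Module.End ℂ (PDO Poly)) one).1 (-(k : ℤ) - 1) - dPoly ((A one).1 (-(k : ℤ) - 1)) -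
          (mul dPoly (projNeg genLax) (projNeg (A one))).1 (-(k : ℤ) - 1) := by
      have : (opS * projNeg * A : Module.End ℂ (PDO Poly)) one = mul dPoly genLax (projNeg (A one)) := rfl
      rw [this, genLax_mul, PDO.add_coe, dLeft_coe, projNeg_coe, projNeg_coe, if_neg (by omega),
        if_neg (by omega)]
      have : -((k + 1 : ℕ) : ℤ) - 1 = -(k : ℤ) - 1 - 1 := by push_cast; ring
      rw [this]
      abel
    rw [h4]
    exact sub_mem (sub_mem (resFil_mono (by omega) h1) (resFil_mono (by omega) h2)) h3

theorem ι_mem_resFil (k m : ℕ) : FreeAlgebra.ι ℂ (k, m) ∈ resFil (k + m + 1) := by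
  have h := coeff_mem_resFil k _ _ opS_mem_opFil
  rw [opS_one, genLax, lax_coe_neg] at h
  have := dPoly_pow_mem_resFil h m
  rw [dPoly_pow_ι] at this
  exact resFil_mono (by omega) this

/-- The weight of a monomial, for `u_n^{(m)}` of weight `n + m`. -/
def weight (l : List (ℕ × ℕ)) : ℕ := (l.map fun p => p.1 + p.2 + 2).sum

/-- The monomial with given letters. -/
def monomial (l : List (ℕ × ℕ)) : Poly := (l.map (FreeAlgebra.ι ℂ)).prod

/-- A letter of weight `w` needs at most `w - 1` factors `S`; each multiplication costs one more, so
the deficit stays one for every nonempty monomial. -/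
theorem monomial_mem_resFil (p : ℕ × ℕ) (l : List (ℕ × ℕ)) :
    monomial (p :: l) ∈ resFil (weight (p :: l) - 1) := by
  induction l generalizing p with
  | nil => simpa [monomial, weight] using ι_mem_resFil p.1 p.2
  | cons q l ih =>
    have h := mul_mem_resFil (ι_mem_resFil p.1 p.2) (ih q)
    have e : monomial (p :: q :: l) = FreeAlgebra.ι ℂ p * monomial (q :: l) := by
      simp [monomial]
    rw [e]
    refine resFil_mono ?_ h
    simp only [weight, List.map_cons, List.sum_cons]
    omega

theorem linearIndependent_monomial : LinearIndependent ℂ monomial := by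
  have h := (FreeAlgebra.basisFreeMonoid ℂ (ℕ × ℕ)).linearIndependent
  have e : monomial = fun l => FreeAlgebra.basisFreeMonoid ℂ (ℕ × ℕ) (FreeMonoid.ofList l) := by
    funext l
    simp [monomial, FreeAlgebra.basisFreeMonoid, FreeAlgebra.equivMonoidAlgebraFreeMonoid,
      FreeMonoid.lift_apply]
  rw [e]
  exact h.comp _ FreeMonoid.ofList.injective

/-- The sign word attached to a monomial. -/
def signs : List (ℕ × ℕ) → List Bool
  | [] => []
  | [p] => List.replicate p.2 false ++ List.replicate p.1 true
  | p :: q :: l => List.replicate p.2 false ++ List.replicate p.1 true ++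
      true :: false :: signs (q :: l)

/-- A letter with index `(k, m)` contributes a block of length `k + m`, two less than its weight;
the separators make up for this at all but one letter. -/
theorem length_signs (p : ℕ × ℕ) (l : List (ℕ × ℕ)) :
    (signs (p :: l)).length + 2 = weight (p :: l) := by
  induction l generalizing p with
  | nil => simp [signs, weight]; omega
  | cons q l ih =>
    have := ih q
    simp only [signs, weight, List.map_cons, List.sum_cons, List.length_append,
      List.length_replicate, List.length_cons] at this ⊢
    omega

/-- Cutting a word at every occurrence of `+ -` leaves blocks of minus signs followed by plus signs,
from which the letters are read off. -/
theorem signs_surjective (w : List Bool) : ∃ p l, signs (p :: l) = w := by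
  induction w with
  | nil => exact ⟨(0, 0), [], rfl⟩
  | cons s w ih =>
    obtain ⟨⟨k, m⟩, l, rfl⟩ := ih
    cases s with
    | false =>
      refine ⟨(k, m + 1), l, ?_⟩
      cases l <;> simp [signs, List.replicate_succ]
    | true =>
      cases m with
      | zero =>
        refine ⟨(k + 1, 0), l, ?_⟩
        cases l <;> simp [signs, List.replicate_succ]
      | succ m =>
        refine ⟨(0, 0), (k, m) :: l, ?_⟩
        cases l <;> simp [signs, List.replicate_succ]

/-- Each word `w` picks out a monomial `v w`. These are independent and lie in the span of the
residues, so the dimension of the span is at least the number of residues. -/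
theorem linearIndependent_resAt_opWord_le (n : ℕ) :
    LinearIndependent ℂ fun w : {w : List Bool // w.length ≤ n} => resAt (opWord w) := by
  have : Finite {w : List Bool // w.length ≤ n} := List.finite_length_le Bool n
  have := Fintype.ofFinite {w : List Bool // w.length ≤ n}
  rw [linearIndependent_iff_card_le_finrank_span]
  choose p l hpl using signs_surjective
  let v : {w : List Bool // w.length ≤ n} → List (ℕ × ℕ) := fun w => p w :: l w
  have hv : Function.Injective v := fun w w' h => by
    have := congrArg signs h
    simp only [v, hpl] at this
    exact Subtype.ext this
  have hmem : ∀ w, monomial (v w) ∈ Submodule.span ℂ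
      (Set.range fun w : {w : List Bool // w.length ≤ n} => resAt (opWord w)) := by
    intro w
    have h1 : monomial (v w) ∈ resFil (n + 1) := by
      refine resFil_mono ?_ (monomial_mem_resFil (p w) (l w))
      rw [← length_signs, hpl]
      have := w.2
      omega
    rw [resFil, opFil, Submodule.map_span] at h1
    refine Submodule.span_mono ?_ h1
    rintro _ ⟨_, ⟨w', hw', rfl⟩, rfl⟩
    exact ⟨⟨w', Nat.le_of_succ_le_succ hw'⟩, rfl⟩
  have hli := linearIndependent_monomial.comp v hv
  have hfin : Module.Finite ℂ (Submodule.span ℂ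
      (Set.range fun w : {w : List Bool // w.length ≤ n} => resAt (opWord w))) :=
    Module.Finite.span_of_finite ℂ (Set.finite_range _)
  have hli' : LinearIndependent ℂ (fun w => (⟨monomial (v w), hmem w⟩ : Submodule.span ℂ
      (Set.range fun w : {w : List Bool // w.length ≤ n} => resAt (opWord w)))) :=
    LinearIndependent.of_comp (Submodule.subtype _) hli
  exact hli'.fintype_card_le_finrank

theorem linearIndependent_resAt_opWord :
    LinearIndependent ℂ fun w : List Bool => resAt (opWord w) := by
  rw [linearIndependent_iff_finset_linearIndependent]
  intro s
  obtain ⟨n, hn⟩ : ∃ n, ∀ w ∈ s, w.length ≤ n :=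
    ⟨s.sup List.length, fun w hw => Finset.le_sup (f := List.length) hw⟩
  exact (linearIndependent_resAt_opWord_le n).comp
    (fun w : s => ⟨w.1, hn w.1 w.2⟩) (fun w w' h => Subtype.ext (congrArg (fun x => x.1) h))

theorem resAt_injective {A : Module.End ℂ (PDO Poly)} (hA : A ∈ opSpace) (h : resAt A = 0) :
    A = 0 := by
  obtain ⟨c, rfl⟩ := Finsupp.mem_span_range_iff_exists_finsupp.mp hA
  have : c = 0 := by
    refine linearIndependent_iff.mp linearIndependent_resAt_opWord c ?_
    rw [Finsupp.linearCombination_apply, ← h, map_finsuppSum]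
    simp
  rw [this, Finsupp.sum_zero_index]

/-! ### The augmented algebra -/

theorem exists_resAlg_proj : ∃ q : Poly →ₗ[ℂ] resAlg, q ∘ₗ resAlg.subtype = LinearMap.id :=
  LinearMap.exists_leftInverse_of_injective _ (Submodule.ker_subtype _)

/-- A linear extension of the inclusion of `𝒜` into `𝔸`. -/
def inc : Poly →ₗ[ℂ] Aug := LinearMap.inr ℂ ℂ resAlg ∘ₗ exists_resAlg_proj.choose

theorem inc_coe (x : resAlg) : inc (x : Poly) = (0, x) := by
  have := DFunLike.congr_fun exists_resAlg_proj.choose_spec x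
  simp only [LinearMap.comp_apply, Submodule.subtype_apply, LinearMap.id_apply] at this
  simp [inc, this]

theorem isElt_inc {v : Poly} (hv : v ∈ resAlg) : IsElt (inc v) v := by
  have := inc_coe ⟨v, hv⟩
  simp only at this
  rw [this]
  exact ⟨rfl, rfl⟩

theorem isElt_iff {v : Poly} (hv : v ∈ resAlg) {x : Aug} : IsElt x v ↔ x = inc v := by
  refine ⟨?_, fun h => h ▸ isElt_inc hv⟩
  rintro ⟨h1, h2⟩
  rw [← h2, inc_coe]
  exact Prod.ext h1 rfl

/-- The element of `𝔸` given by the residue of an operator. -/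
def el (A : Module.End ℂ (PDO Poly)) : Aug := inc (resAt A)

theorem resAt_mem {A : Module.End ℂ (PDO Poly)} (hA : A ∈ opSpace) : resAt A ∈ resAlg :=
  ⟨A, hA, rfl⟩

theorem eq_el {A : Module.End ℂ (PDO Poly)} (hA : A ∈ opSpace) {x : Aug}
    (hx : IsElt x (resAt A)) : x = el A :=
  (isElt_iff (resAt_mem hA)).mp hx

theorem isElt_el {A : Module.End ℂ (PDO Poly)} (hA : A ∈ opSpace) : IsElt (el A) (resAt A) :=
  isElt_inc (resAt_mem hA)

theorem el_neg (A : Module.End ℂ (PDO Poly)) : el (-A) = -el A := by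
  simp [el, resAt_eq]

theorem isElt_neg_el {A : Module.End ℂ (PDO Poly)} (hA : A ∈ opSpace) :
    IsElt (-el A) (-resAt A) := by
  have h : -A ∈ opSpace := end_neg_mem hA
  have := isElt_el h
  rwa [el_neg, show resAt (-A) = -resAt A by simp [resAt_eq]] at this

theorem el_split (A B : Module.End ℂ (PDO Poly)) :
    el (A * B) = el (A * projPos * B) + el (A * projNeg * B) := by
  simp only [el, resAt_eq, Module.End.mul_apply, ← map_add, projPos_add_projNeg]

theorem el_eq_zero {A : Module.End ℂ (PDO Poly)} (hA : A ∈ opSpace) (h : el A = 0) : A = 0 := by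
  refine resAt_injective hA ?_
  have := isElt_el hA
  rw [h] at this
  exact this.2.symm

theorem exists_el_of_fst_eq_zero {x : Aug} (hx : x.1 = 0) : ∃ A ∈ opSpace, x = el A := by
  obtain ⟨A, hA, h⟩ := x.2.2
  refine ⟨A, hA, eq_el hA ⟨hx, h.symm⟩⟩

theorem exists_aug_eq (x : Aug) : ∃ A ∈ opSpace, x = x.1 • augF + el A := by
  obtain ⟨A, hA, h⟩ := exists_el_of_fst_eq_zero (x := x - x.1 • augF) (by simp [augF])
  exact ⟨A, hA, by rw [← h]; abel⟩

/-- The inverse of `A ↦ res(A(I))`. -/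
def resInv : resAlg →ₗ[ℂ] Module.End ℂ (PDO Poly) :=
  opSpace.subtype ∘ₗ (LinearEquiv.ofBijective
    (resAt.restrict (p := opSpace) (q := resAlg) fun _ hA => resAt_mem hA)
    ⟨by
      intro A B h
      have h : resAt A.1 = resAt B.1 := congrArg Subtype.val h
      have := resAt_injective (end_sub_mem A.2 B.2) (by
        rw [resAt_eq, LinearMap.sub_apply, map_sub, sub_eq_zero]
        exact h)
      refine Subtype.ext (LinearMap.ext fun V => sub_eq_zero.mp ?_)
      exact DFunLike.congr_fun this V, by
      rintro ⟨_, A, hA, rfl⟩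
      exact ⟨⟨A, hA⟩, rfl⟩⟩).symm.toLinearMap

theorem resInv_spec {A : Module.End ℂ (PDO Poly)} (hA : A ∈ opSpace) (x : resAlg)
    (hx : (x : Poly) = resAt A) : resInv x = A := by
  have : x = ⟨resAt A, resAt_mem hA⟩ := Subtype.ext hx
  subst this
  simp only [resInv, LinearMap.comp_apply, LinearEquiv.coe_coe, Submodule.subtype_apply]
  have : ∀ (e : opSpace ≃ₗ[ℂ] resAlg), e ⟨A, hA⟩ = ⟨resAt A, resAt_mem hA⟩ →
      ((e.symm ⟨resAt A, resAt_mem hA⟩ : opSpace) : Module.End ℂ (PDO Poly)) = A := by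
    intro e he
    rw [← he, e.symm_apply_apply]
  exact this _ rfl

/-- `res(A(I)) ↦ res(𝔏 A(I)_{<0})`. -/
def leftF : resAlg →ₗ[ℂ] Poly :=
  res ∘ₗ opS ∘ₗ projNeg ∘ₗ LinearMap.applyₗ (one : PDO Poly) ∘ₗ resInv

/-- `res(A(I)) ↦ res(A(𝔏_{≥0}))`. -/
def rightF : resAlg →ₗ[ℂ] Poly :=
  res ∘ₗ LinearMap.applyₗ (projPos genLax) ∘ₗ resInv

/-- The product of `𝔸`. -/
def augMul : Aug →ₗ[ℂ] Aug →ₗ[ℂ] Aug :=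
  LinearMap.mk₂ ℂ
    (fun x y => inc (-((x.1 * y.1) • res genLax) + x.1 • leftF y.2 - y.1 • rightF x.2 +
      (x.2 : Poly) * (y.2 : Poly)))
    (fun x x' y => by
      simp only [Prod.fst_add, Prod.snd_add, map_add, map_sub, map_neg, map_smul,
        Submodule.coe_add, add_mul, add_smul, smul_add]
      abel)
    (fun c x y => by
      simp only [Prod.smul_fst, Prod.smul_snd, map_add, map_sub, map_neg, map_smul,
        Submodule.coe_smul, smul_mul_assoc, smul_eq_mul]
      module)
    (fun x y y' => by
      simp only [Prod.fst_add, Prod.snd_add, map_add, map_sub, map_neg, map_smul,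
        Submodule.coe_add, mul_add, add_smul, smul_add]
      abel)
    (fun c x y => by
      simp only [Prod.smul_fst, Prod.smul_snd, map_add, map_sub, map_neg, map_smul,
        Submodule.coe_smul, mul_smul_comm, smul_eq_mul]
      module)

theorem augMul_apply (x y : Aug) : augMul x y =
    inc (-((x.1 * y.1) • res genLax) + x.1 • leftF y.2 - y.1 • rightF x.2 +
      (x.2 : Poly) * (y.2 : Poly)) := rfl

theorem resAt_left (A : Module.End ℂ (PDO Poly)) :
    resAt (opS * projNeg * A) = res (mul dPoly genLax (projNeg (A one))) := rfl

theorem resAt_right (A : Module.End ℂ (PDO Poly)) :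
    resAt (A * projPos * opS) = res (A (projPos genLax)) := by
  simp only [resAt_eq, Module.End.mul_apply, opS_one]

theorem resAt_opS : resAt opS = res genLax := by rw [resAt_eq, opS_one]

theorem mul_mem_resAlg {x y : Poly} (hx : x ∈ resAlg) (hy : y ∈ resAlg) : x * y ∈ resAlg := by
  obtain ⟨A, hA, rfl⟩ := hx
  obtain ⟨B, hB, rfl⟩ := hy
  rw [← resAt_opMul hA]
  exact resAt_mem (opMul_mem hA hB)

theorem isAugProduct_augMul : IsAugProduct augMul where
  f_f := by
    have h : -res genLax ∈ resAlg := by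
      rw [← resAt_opS]
      exact neg_mem (resAt_mem opS_mem)
    rw [isElt_iff h, augMul_apply]
    simp [augF]
  f_res A hA x hx := by
    have h := resAt_mem (mul_projNeg_mul_mem opS_mem hA)
    rw [← resAt_left, isElt_iff h, augMul_apply]
    simp [augF, hx.1, leftF, resInv_spec hA x.2 hx.2, resAt_left, opS_apply]
  res_f A hA x hx := by
    have h := neg_mem (resAt_mem (mul_projPos_mul_mem hA opS_mem))
    rw [← resAt_right, isElt_iff h, augMul_apply]
    simp [augF, hx.1, rightF, resInv_spec hA x.2 hx.2, resAt_right]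
  res_res A hA B hB x y hx hy := by
    have h := mul_mem_resAlg (resAt_mem hA) (resAt_mem hB)
    rw [isElt_iff h, augMul_apply]
    simp [hx.1, hy.1, hx.2, hy.2]

/-! ### Weak nonassociativity, middle nucleus, generation by `f`, and the products of all orders. -/

section Product

variable {μ : Aug →ₗ[ℂ] Aug →ₗ[ℂ] Aug} (hμ : IsAugProduct μ)
include hμ

theorem mu_f_f : μ augF augF = -el opS := by
  have h := hμ.f_f
  rw [← resAt_opS] at h
  have h' : -resAt opS ∈ resAlg := neg_mem (resAt_mem opS_mem)
  rw [(isElt_iff h').mp h, map_neg]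
  rfl

theorem mu_f_el {A : Module.End ℂ (PDO Poly)} (hA : A ∈ opSpace) :
    μ augF (el A) = el (opS * projNeg * A) :=
  eq_el (mul_projNeg_mul_mem opS_mem hA) (hμ.f_res A hA _ (isElt_el hA))

theorem mu_el_f {A : Module.End ℂ (PDO Poly)} (hA : A ∈ opSpace) :
    μ (el A) augF = -el (A * projPos * opS) := by
  have h := hμ.res_f A hA _ (isElt_el hA)
  have hm := resAt_mem (mul_projPos_mul_mem hA opS_mem)
  rw [← resAt_right, isElt_iff (neg_mem hm)] at h
  rw [h, map_neg]
  rfl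

theorem mu_el_el {A B : Module.End ℂ (PDO Poly)} (hA : A ∈ opSpace) (hB : B ∈ opSpace) :
    μ (el A) (el B) = el (opMul A B) := by
  have h := hμ.res_res A hA B hB _ _ (isElt_el hA) (isElt_el hB)
  rw [← resAt_opMul hA] at h
  exact eq_el (opMul_mem hA hB) h

theorem augProduct_unique {μ' : Aug →ₗ[ℂ] Aug →ₗ[ℂ] Aug} (hμ' : IsAugProduct μ') : μ' = μ := by
  refine LinearMap.ext₂ fun x y => ?_
  obtain ⟨A, hA, h⟩ := exists_aug_eq x
  obtain ⟨B, hB, h'⟩ := exists_aug_eq y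
  rw [h, h']
  simp only [map_add, map_smul, LinearMap.add_apply, LinearMap.smul_apply, mu_f_f hμ, mu_f_f hμ',
    mu_f_el hμ hB, mu_f_el hμ' hB, mu_el_f hμ hA, mu_el_f hμ' hA, mu_el_el hμ hA hB,
    mu_el_el hμ' hA hB]

/-- All elements of `𝒜` lie in the middle nucleus. -/
theorem assoc_el (x y : Aug) {B : Module.End ℂ (PDO Poly)} (hB : B ∈ opSpace) :
    assoc μ x (el B) y = 0 := by
  obtain ⟨A, hA, h⟩ := exists_aug_eq x
  obtain ⟨C, hC, h'⟩ := exists_aug_eq y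
  have hSB := mul_projNeg_mul_mem opS_mem hB
  have hBS := mul_projPos_mul_mem hB opS_mem
  have h1 : μ (μ augF (el B)) augF = μ augF (μ (el B) augF) := by
    rw [mu_f_el hμ hB, mu_el_f hμ hSB, mu_el_f hμ hB, map_neg, mu_f_el hμ hBS]
    rfl
  have h2 : μ (μ augF (el B)) (el C) = μ augF (μ (el B) (el C)) := by
    rw [mu_f_el hμ hB, mu_el_el hμ hSB hC, mu_el_el hμ hB hC, mu_f_el hμ (opMul_mem hB hC)]
    rfl
  have h3 : μ (μ (el A) (el B)) augF = μ (el A) (μ (el B) augF) := by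
    rw [mu_el_el hμ hA hB, mu_el_f hμ (opMul_mem hA hB), mu_el_f hμ hB, map_neg,
      mu_el_el hμ hA hBS]
    rfl
  have h4 : μ (μ (el A) (el B)) (el C) = μ (el A) (μ (el B) (el C)) := by
    rw [mu_el_el hμ hA hB, mu_el_el hμ (opMul_mem hA hB) hC, mu_el_el hμ hB hC,
      mu_el_el hμ hA (opMul_mem hB hC)]
    rfl
  rw [assoc, h, h']
  simp only [map_add, map_smul, LinearMap.add_apply, LinearMap.smul_apply, h1, h2, h3, h4]
  exact sub_self _

theorem mu_fst (x y : Aug) : (μ x y).1 = 0 := by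
  obtain ⟨A, hA, h⟩ := exists_aug_eq x
  obtain ⟨C, hC, h'⟩ := exists_aug_eq y
  have e : ∀ A, (el A).1 = 0 := fun A => rfl
  rw [h, h']
  simp [mu_f_f hμ, mu_f_el hμ hC, mu_el_f hμ hA, mu_el_el hμ hA hC, e]

theorem isWNA_of_isAugProduct : IsWNA μ := by
  intro a b c d
  obtain ⟨B, hB, h⟩ := exists_el_of_fst_eq_zero (mu_fst hμ b c)
  rw [h]
  exact assoc_el hμ a d hB

/-- The associator is `S π₊ S + S π₋ S = S²`. It is nonzero, so `f` itself is outside the middle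
nucleus. -/
theorem assoc_f_f_f : assoc μ augF augF augF = el (opS * opS) := by
  have hSS := opS_mem
  rw [assoc, mu_f_f hμ, map_neg, map_neg, LinearMap.neg_apply, mu_el_f hμ hSS, mu_f_el hμ hSS,
    el_split opS opS]
  abel

omit hμ in
theorem opS_mul_opS_ne_zero : opS * opS ≠ 0 := by
  intro h
  have h1 : (opS (opS one)).1 2 = 0 :=
    congrArg (fun A : Module.End ℂ (PDO Poly) => (A one).1 2) h
  have hL : ∀ i, 1 < i → genLax.1 i = 0 := fun i hi => by
    rw [genLax, lax_coe, if_neg hi.ne', if_neg (by omega)]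
  have h2 := mul_coe_leading dPoly hL hL
  norm_num at h2
  rw [opS_one, opS_apply, h2] at h1
  simp [genLax, lax_coe] at h1

theorem middleNucleus_eq : middleNucleus μ = {x : Aug | x.1 = 0} := by
  ext x
  constructor
  · intro hx
    obtain ⟨A, hA, h⟩ := exists_aug_eq x
    have h1 := hx augF augF
    have h2 : assoc μ augF x augF =
        x.1 • assoc μ augF augF augF + assoc μ augF (el A) augF := by
      conv_lhs => rw [h]
      simp only [assoc, map_add, map_smul, LinearMap.add_apply, LinearMap.smul_apply, smul_sub]
      abel
    rw [h2, assoc_el hμ _ _ hA, add_zero, assoc_f_f_f hμ] at h1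
    rcases smul_eq_zero.mp h1 with h1 | h1
    · exact h1
    · refine absurd (el_eq_zero ?_ h1) opS_mul_opS_ne_zero
      have := opS_pow_mem (n := 2) (by norm_num)
      rwa [pow_two] at this
  · intro hx a c
    obtain ⟨B, hB, rfl⟩ := exists_el_of_fst_eq_zero hx
    exact assoc_el hμ a c hB

theorem isGeneratedBy_augF : IsGeneratedBy μ augF := by
  intro N hf hN
  have hmem : ∀ j : ℕ, (opS * projPos) ^ j * opS ∈ opSpace := by
    intro j
    induction j with
    | zero => simpa using opS_mem
    | succ j ih =>
      have := mul_projPos_mul_mem opS_mem ih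
      rwa [← mul_assoc, ← pow_succ'] at this
  have hpow : ∀ j : ℕ, el ((opS * projPos) ^ j * opS) ∈ N := by
    intro j
    induction j with
    | zero =>
      have := N.neg_mem (hN _ hf _ hf)
      rw [mu_f_f hμ, neg_neg] at this
      simpa using this
    | succ j ih =>
      have := N.neg_mem (hN _ ih _ hf)
      rw [mu_el_f hμ (hmem j), neg_neg] at this
      rw [pow_succ]
      exact this
  -- The counter `j` collects a leading run of plus signs. At the first minus sign the word is `f ∘
  -- w'` if the run is empty, and otherwise a product `∘` of a shorter pure run with the rest.
  have hword : ∀ (w : List Bool) (j : ℕ), el ((opS * projPos) ^ j * opWord w) ∈ N := by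
    intro w
    induction w with
    | nil => exact hpow
    | cons s w ih =>
      have hw : opWord w ∈ opSpace := Submodule.subset_span ⟨w, rfl⟩
      have h0 : el (opWord w) ∈ N := by simpa using ih 0
      intro j
      cases s with
      | true =>
        have := ih (j + 1)
        rw [pow_succ] at this
        exact this
      | false =>
        cases j with
        | zero =>
          have := hN _ hf _ h0
          rw [mu_f_el hμ hw] at this
          rw [pow_zero, one_mul]
          exact this
        | succ j =>
          have := hN _ (hpow j) _ h0
          rw [mu_el_el hμ (hmem j) hw] at this
          rw [pow_succ]
          exact this
  have hel : ∀ A ∈ opSpace, el A ∈ N := by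
    intro A hA
    induction hA using Submodule.span_induction with
    | zero =>
      have : el 0 = 0 := by simp [el]
      rw [this]
      exact N.zero_mem
    | add X Y _ _ hX hY =>
      have : el (X + Y) = el X + el Y := by simp [el]
      rw [this]
      exact N.add_mem hX hY
    | smul c X _ hX =>
      have : el (c • X) = c • el X := by simp [el]
      rw [this]
      exact N.smul_mem c hX
    | mem X hX =>
      obtain ⟨w, rfl⟩ := hX
      simpa using hword w 0
  rw [eq_top_iff]
  intro x _
  obtain ⟨A, hA, h⟩ := exists_aug_eq x
  rw [h]
  exact N.add_mem (N.smul_mem _ hf) (hel A hA)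

/-- The products `∘_n` in terms of operators. -/
theorem circ_eq {n : ℕ} (hn : 1 ≤ n) :
    circ μ augF n augF augF = -el (opS ^ n) ∧
    (∀ A ∈ opSpace, circ μ augF n augF (el A) = el (opS ^ n * projNeg * A)) ∧
    (∀ A ∈ opSpace, circ μ augF n (el A) augF = -el (A * projPos * opS ^ n)) ∧
    (∀ A ∈ opSpace, ∀ B ∈ opSpace, circ μ augF n (el A) (el B) =
      el (A * projPos * opS ^ n * projNeg * B)) := by
  induction n, hn using Nat.le_induction with
  | base =>
    simp only [circ, pow_one]
    exact ⟨mu_f_f hμ, fun A hA => mu_f_el hμ hA, fun A hA => mu_el_f hμ hA,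
      fun A hA B hB => mu_el_el hμ hA hB⟩
  | succ n hn ih =>
    obtain ⟨h1, h2, h3, h4⟩ := ih
    obtain ⟨k, rfl⟩ : ∃ k, n = k + 1 := ⟨n - 1, by omega⟩
    have hS : opS ^ (k + 1) ∈ opSpace := opS_pow_mem hn
    have hnS : -opS ∈ opSpace := end_neg_mem opS_mem
    have hc : ∀ a b, circ μ augF (k + 1 + 1) a b =
      μ a (circ μ augF (k + 1) augF b) - circ μ augF (k + 1) (μ a augF) b := fun _ _ => rfl
    have hneg : ∀ A B : Module.End ℂ (PDO Poly), el (-A * B) = -el (A * B) := fun A B => by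
      rw [← el_neg]
      congr 1
    refine ⟨?_, fun A hA => ?_, fun A hA => ?_, fun A hA B hB => ?_⟩
    -- In all four cases the two terms of the recursion carry `π₋` and `π₊` between `S` and `S^n`,
    -- and `π₊ + π₋ = 1` merges them into `S^{n+1}`.
    · rw [hc, h1, mu_f_f hμ, ← el_neg opS, h3 _ hnS, map_neg, mu_f_el hμ hS, mul_assoc (-opS),
        hneg, ← mul_assoc, pow_succ' opS (k + 1),
        el_split opS (opS ^ (k + 1))]
      abel
    · have hSA := mul_projNeg_mul_mem hS hA
      rw [hc, h2 A hA, mu_f_f hμ, ← el_neg opS, h4 _ hnS A hA, mu_f_el hμ hSA,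
        mul_assoc (-opS), mul_assoc (-opS), mul_assoc (-opS), hneg, pow_succ' opS (k + 1)]
      have := el_split opS (opS ^ (k + 1) * projNeg * A)
      simp only [mul_assoc] at this ⊢
      rw [this]
      abel
    · have hAS := mul_projPos_mul_mem hA opS_mem
      have hnAS : -(A * projPos * opS) ∈ opSpace := end_neg_mem hAS
      rw [hc, h1, map_neg, mu_el_el hμ hA hS, mu_el_f hμ hA, ← el_neg (A * projPos * opS),
        h3 _ hnAS, mul_assoc (-(A * projPos * opS)), hneg, pow_succ' opS (k + 1), opMul]
      have := el_split (A * projPos * opS) (opS ^ (k + 1))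
      simp only [mul_assoc] at this ⊢
      rw [this]
      abel
    · have hAS := mul_projPos_mul_mem hA opS_mem
      have hnAS : -(A * projPos * opS) ∈ opSpace := end_neg_mem hAS
      have hSB := mul_projNeg_mul_mem hS hB
      rw [hc, h2 B hB, mu_el_el hμ hA hSB, mu_el_f hμ hA, ← el_neg (A * projPos * opS),
        h4 _ hnAS B hB]
      simp only [mul_assoc (-(A * projPos * opS)), hneg, opMul, pow_succ' opS (k + 1)]
      have := el_split (A * projPos * opS) (opS ^ (k + 1) * projNeg * B)
      simp only [mul_assoc] at this ⊢
      rw [this]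
      abel

end Product

/-- Both sides equal `res(V_{<0} W_{≥0})`. -/
theorem res_mul_projPos_right (V W : PDO Poly) :
    res (mul dPoly V (projPos W)) = res (mul dPoly (projNeg V) W) := by
  have h1 := res_mul_projPos_projPos dPoly V W
  have h2 := res_mul_projNeg_projNeg dPoly V W
  conv_lhs => rw [← projPos_add_projNeg V]
  conv_rhs => rw [← projPos_add_projNeg W]
  simp [h1, h2]

/-! ### The flows on the augmented algebra -/

theorem opS_pow_apply_opS (n : ℕ) (V : PDO Poly) : (opS ^ n) (opS V) = opS ((opS ^ n) V) :=
  DFunLike.congr_fun ((pow_succ opS n).symm.trans (pow_succ' opS n)) V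

theorem flowX_opS (n : ℕ) (V : PDO Poly) : flowX n (opS V) = opS (flowX n V) :=
  DFunLike.congr_fun (flowX_mul_opS n) V

theorem flowX_projPos (n : ℕ) (V : PDO Poly) :
    flowX n (projPos V) = projPos (flowX n V) + projPos ((opS ^ n) (projNeg V)) :=
  DFunLike.congr_fun (flowX_mul_projPos n) V

theorem projNeg_apply (V : PDO Poly) : projNeg V = V - projPos V := rfl

/-- This and the next two identities are the Leibniz rule for `f ∘ f`, `f ∘ a` and `a ∘ f`, lifted
from residues to operators. -/
theorem flowOp_opS (n : ℕ) : flowOp n opS + opS * projPos * opS ^ n = opS ^ n * projNeg * opS := by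
  ext1 V
  simp only [flowOp, LinearMap.add_apply, LinearMap.sub_apply, Module.End.mul_apply, flowX_opS]
  abel

theorem flowOp_left (n : ℕ) (A : Module.End ℂ (PDO Poly)) :
    flowOp n (opS * projNeg * A) + opS ^ n * projPos * opS * projNeg * A =
      opS * projNeg * flowOp n A := by
  ext1 V
  simp only [flowOp, LinearMap.add_apply, LinearMap.sub_apply, Module.End.mul_apply, flowX_opS,
    projNeg_apply, flowX_projPos, map_sub, map_add, opS_pow_apply_opS]
  abel

theorem flowOp_right (n : ℕ) (A : Module.End ℂ (PDO Poly)) :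
    flowOp n (A * projPos * opS) =
      flowOp n A * projPos * opS + A * projPos * opS * projNeg * opS ^ n := by
  ext1 V
  simp only [flowOp, LinearMap.add_apply, LinearMap.sub_apply, Module.End.mul_apply, flowX_opS,
    projNeg_apply, flowX_projPos, map_sub, map_add, opS_pow_apply_opS]
  abel

theorem el_add (A B : Module.End ℂ (PDO Poly)) : el (A + B) = el A + el B := by simp [el]

/-- The derivation of `𝔸` extending the `n`-th flow by `f ↦ -res 𝔏^n`. -/
def augFlow (n : ℕ) : Aug →ₗ[ℂ] Aug :=
  (LinearMap.fst ℂ ℂ resAlg).smulRight (-el (opS ^ n)) +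
    inc ∘ₗ dFlow n ∘ₗ resAlg.subtype ∘ₗ LinearMap.snd ℂ ℂ resAlg

theorem augFlow_augF (n : ℕ) : augFlow n augF = -el (opS ^ n) := by simp [augFlow, augF]

theorem augFlow_el {A : Module.End ℂ (PDO Poly)} (hA : A ∈ opSpace) (n : ℕ) :
    augFlow n (el A) = el (flowOp n A) := by
  have h := isElt_el hA
  rw [el] at h
  simp [augFlow, h.1, h.2, dFlow_resAt, el]

theorem augFlow_snd {n : ℕ} (hn : 1 ≤ n) (a : resAlg) :
    IsElt (augFlow n (0, a)) (dFlow n (a : Poly)) := by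
  obtain ⟨a, A, hA, rfl⟩ := a
  have := augFlow_el hA n
  rw [el, inc_coe ⟨resAt A, resAt_mem hA⟩] at this
  rw [this, dFlow_resAt]
  exact isElt_el (flowOp_mem hn hA)

theorem coeffMap_pow {R : Type*} [Ring R] [Algebra ℂ R] {D d : R →ₗ[ℂ] R}
    (hD : ∀ a b, D (a * b) = D a * b + a * D b) (hd : ∀ a b, d (a * b) = d a * b + a * d b)
    (hc : ∀ a, d (D a) = D (d a)) {P L : PDO R} (h : coeffMap d L = bracket D P L) (m : ℕ) :
    coeffMap d (pow D L m) = bracket D P (pow D L m) := by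
  induction m with
  | zero => rw [pow, coeffMap_one hd, bracket, one_mul_pdo, mul_one_pdo hD, sub_self]
  | succ m ih => rw [pow, coeffMap_derivation_mul D hd hc, bracket_mul hD, ih, h]

theorem dFlow_res_pow_symm (m n : ℕ) :
    dFlow n (res (pow dPoly genLax m)) = dFlow m (res (pow dPoly genLax n)) := by
  have h : ∀ m n, dFlow n (res (pow dPoly genLax m)) =
      res (bracket dPoly (posPow n) (pow dPoly genLax m)) := by
    intro m n
    rw [← coeffMap_pow dPoly_leibniz (dFlow_mul n) (dFlow_dPoly n) (coeffMap_dFlow_genLax n)]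
    rfl
  rw [h, h]
  exact res_bracket_pow_symm dPoly_leibniz _ _ _

/-! ### The augmented flows are commuting derivations, determined by their values on `f`. -/

section Product

variable {μ : Aug →ₗ[ℂ] Aug →ₗ[ℂ] Aug} (hμ : IsAugProduct μ)
include hμ

theorem augFlow_isDerivationOf {n : ℕ} (hn : 1 ≤ n) : IsDerivationOf μ (augFlow n) := by
  intro x y
  have hS := opS_pow_mem hn
  obtain ⟨A, hA, h⟩ := exists_aug_eq x
  obtain ⟨B, hB, h'⟩ := exists_aug_eq y
  have h1 : augFlow n (μ augF augF) = μ (augFlow n augF) augF + μ augF (augFlow n augF) := by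
    have e1 := congrArg el (flowOp_opS n)
    have e2 := el_split opS (opS ^ n)
    have e3 := el_split (opS ^ n) opS
    rw [← pow_succ] at e3
    rw [← pow_succ', e3] at e2
    rw [el_add] at e1
    rw [mu_f_f hμ, map_neg, augFlow_el opS_mem, augFlow_augF, map_neg, map_neg,
      LinearMap.neg_apply, mu_el_f hμ hS, mu_f_el hμ hS, neg_neg, eq_sub_of_add_eq e1,
      eq_sub_of_add_eq e2]
    abel
  have h2 : ∀ B ∈ opSpace, augFlow n (μ augF (el B)) =
      μ (augFlow n augF) (el B) + μ augF (augFlow n (el B)) := by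
    intro B hB
    have e1 := congrArg el (flowOp_left n B)
    rw [el_add] at e1
    rw [mu_f_el hμ hB, augFlow_el (mul_projNeg_mul_mem opS_mem hB), augFlow_augF, augFlow_el hB,
      map_neg, LinearMap.neg_apply, mu_el_el hμ hS hB, mu_f_el hμ (flowOp_mem hn hB), ← e1, opMul]
    abel
  have h3 : ∀ A ∈ opSpace, augFlow n (μ (el A) augF) =
      μ (augFlow n (el A)) augF + μ (el A) (augFlow n augF) := by
    intro A hA
    have e1 := congrArg el (flowOp_right n A)
    rw [el_add] at e1
    rw [mu_el_f hμ hA, map_neg, augFlow_el (mul_projPos_mul_mem hA opS_mem), e1, augFlow_augF,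
      augFlow_el hA, mu_el_f hμ (flowOp_mem hn hA), map_neg, mu_el_el hμ hA hS, opMul]
    abel
  -- On `𝒜` the product is that of polynomials, for which `dFlow n` is a derivation by construction.
  have h4 : ∀ A ∈ opSpace, ∀ B ∈ opSpace, augFlow n (μ (el A) (el B)) =
      μ (augFlow n (el A)) (el B) + μ (el A) (augFlow n (el B)) := by
    intro A hA B hB
    have hA' := flowOp_mem hn hA
    have hB' := flowOp_mem hn hB
    rw [mu_el_el hμ hA hB, augFlow_el (opMul_mem hA hB), augFlow_el hA, augFlow_el hB,
      mu_el_el hμ hA' hB, mu_el_el hμ hA hB']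
    rw [el, el, el, ← map_add inc, ← dFlow_resAt, resAt_opMul hA, resAt_opMul hA', resAt_opMul hA, dFlow_mul, dFlow_resAt,
      dFlow_resAt]
  rw [h, h']
  simp only [map_add, map_smul, LinearMap.add_apply, LinearMap.smul_apply, h1, h2 B hB, h3 A hA,
    h4 A hA B hB, smul_add]
  abel

/-- Derivations of `𝔸` are determined by their value on `f`. -/
theorem augDerivation_ext {d d' : Aug →ₗ[ℂ] Aug} (hd : IsDerivationOf μ d)
    (hd' : IsDerivationOf μ d') (h : d augF = d' augF) : d = d' := by
  have := isGeneratedBy_augF hμ (LinearMap.eqLocus d d') h (fun x hx y hy => by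
    rw [LinearMap.mem_eqLocus] at hx hy ⊢
    rw [hd, hd', hx, hy])
  exact LinearMap.eqLocus_eq_top.mp this

/-- The commutator of two derivations is a derivation, so it suffices that it kills `f`; this is the
symmetry of `d_n res 𝔏^m`. -/
theorem augFlow_comm {m n : ℕ} (hm : 1 ≤ m) (hn : 1 ≤ n) (x : Aug) :
    augFlow m (augFlow n x) = augFlow n (augFlow m x) := by
  have hm' := augFlow_isDerivationOf hμ hm
  have hn' := augFlow_isDerivationOf hμ hn
  have hd : IsDerivationOf μ (augFlow m ∘ₗ augFlow n - augFlow n ∘ₗ augFlow m) := by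
    intro x y
    simp only [LinearMap.sub_apply, LinearMap.comp_apply, hm' _ _, hn' _ _, map_add, map_sub]
    abel
  have h0 : IsDerivationOf μ (0 : Aug →ₗ[ℂ] Aug) := fun x y => by simp
  have := augDerivation_ext hμ hd h0 (by
    simp only [LinearMap.sub_apply, LinearMap.comp_apply, augFlow_augF, map_neg,
      LinearMap.zero_apply, augFlow_el (opS_pow_mem hm), augFlow_el (opS_pow_mem hn)]
    simp only [el, ← dFlow_resAt]
    simp only [resAt_eq, opS_pow_one, dFlow_res_pow_symm m n]
    abel)
  exact sub_eq_zero.mp (DFunLike.congr_fun this x)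

end Product

/-! ### Dependence on times -/

section Times

variable {B : Type*} [Ring B] [Algebra ℂ B] {D : ℕ → B →ₗ[ℂ] B} (hD : IsTimes D) (u : ℕ → B)

@[simp] theorem evalAt_ι (p : ℕ × ℕ) :
    evalAt D u (FreeAlgebra.ι ℂ p) = ((D 1) ^ p.2) (u p.1) := by
  simp [evalAt]

theorem coeffMap_evalAt_genLax : coeffMap (evalAt D u).toLinearMap genLax = lax u := by
  ext k
  rw [coeffMap_coe, genLax, lax_coe, lax_coe]
  split_ifs <;> simp

include hD

theorem IsTimes.mul {n : ℕ} (hn : 1 ≤ n) (a b : B) : D n (a * b) = D n a * b + a * D n b :=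
  hD.leibniz n hn a b

theorem evalAt_dPoly (a : Poly) : evalAt D u (dPoly a) = D 1 (evalAt D u a) := by
  have := derivation_ext (evalAt D u) ((evalAt D u).toLinearMap ∘ₗ dPoly)
    (D 1 ∘ₗ (evalAt D u).toLinearMap) (by simp [dPoly_mul]) (by simp [hD.mul le_rfl]) (by
      rintro ⟨k, m⟩
      simp [dPoly_ι, pow_succ'])
  exact DFunLike.congr_fun this a

theorem coeffMap_evalAt_pow (n : ℕ) :
    coeffMap (evalAt D u).toLinearMap (pow dPoly genLax n) = pow (D 1) (lax u) n := by
  induction n with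
  | zero =>
    ext k
    by_cases hk : k = 0 <;> simp [pow, hk]
  | succ n ih =>
    rw [pow, coeffMap_algHom_mul dPoly (evalAt D u) (evalAt_dPoly hD u), ih,
      coeffMap_evalAt_genLax, pow]

theorem evalAt_res_pow (n : ℕ) :
    evalAt D u (res (pow dPoly genLax n)) = res (pow (D 1) (lax u) n) := by
  rw [← coeffMap_evalAt_pow hD]
  rfl

theorem coeffMap_evalAt_bracket (n : ℕ) :
    coeffMap (evalAt D u).toLinearMap (bracket dPoly (posPow n) genLax) =
      bracket (D 1) (projPos (pow (D 1) (lax u) n)) (lax u) := by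
  have h : coeffMap (evalAt D u).toLinearMap (posPow n) =
      projPos (pow (D 1) (lax u) n) := by
    rw [← coeffMap_evalAt_pow hD, posPow]
    ext k
    by_cases hk : 0 ≤ k <;> simp [hk]
  rw [bracket, map_sub, coeffMap_algHom_mul dPoly (evalAt D u) (evalAt_dPoly hD u),
    coeffMap_algHom_mul dPoly (evalAt D u) (evalAt_dPoly hD u), h, coeffMap_evalAt_genLax, bracket]

/-- A Gelfand-Dickey flow is the image of the generic flow. -/
theorem evalAt_dFlow {n : ℕ} (hn : 1 ≤ n) (h : mapCoeff (D n) (lax u) =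
    bracket (D 1) (projPos (pow (D 1) (lax u) n)) (lax u)) (a : Poly) :
    evalAt D u (dFlow n a) = D n (evalAt D u a) := by
  have := derivation_ext (evalAt D u) ((evalAt D u).toLinearMap ∘ₗ dFlow n)
    (D n ∘ₗ (evalAt D u).toLinearMap) (by simp [dFlow_mul]) (by simp [hD.mul hn]) (by
      rintro ⟨k, m⟩
      have hp : ∀ a, evalAt D u ((dPoly ^ m) a) = ((D 1) ^ m) (evalAt D u a) := by
        induction m with
        | zero => simp
        | succ m ih => intro a; simp [pow_succ, ih, evalAt_dPoly hD]
      have hk := congrArg (fun V : PDO B => V.1 (-(k : ℤ) - 1))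
        (h.trans (coeffMap_evalAt_bracket hD u n).symm)
      simp only [mapCoeff_eq, coeffMap_coe, lax_coe_neg, AlgHom.toLinearMap_apply] at hk
      simp only [LinearMap.comp_apply, AlgHom.toLinearMap_apply, dFlow, freeDer_ι, hp, ← hk,
        evalAt_ι]
      rw [pow_comm_of_comm (hD.comm n 1 hn le_rfl)])
  exact DFunLike.congr_fun this a

theorem gelfandDickeyPowers_iff : GelfandDickeyPowers D u ↔ GelfandDickey D u := by
  constructor
  · intro h n hn
    have := h 1 n le_rfl hn
    rwa [pow_one_pdo (hD.mul le_rfl)] at this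
  · intro h m n _ hn
    exact coeffMap_pow (hD.mul le_rfl) (hD.mul hn) (hD.comm n 1 hn le_rfl) (h n hn) m

/-- Any admissible `δ` agrees with `augFlow n` at the generator `f`, hence everywhere. The hierarchy
thus says that evaluation intertwines `dFlow n` with `∂_{t_n}` on `𝒜`. -/
theorem odeHierarchy_iff {μ : Aug →ₗ[ℂ] Aug →ₗ[ℂ] Aug} (hμ : IsAugProduct μ) :
    ODEHierarchy μ D u ↔ GelfandDickey D u := by
  constructor
  · intro h n hn
    obtain ⟨δ, hδ, hf, hev⟩ := h n hn
    have heq : δ = augFlow n := by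
      refine augDerivation_ext hμ hδ (augFlow_isDerivationOf hμ hn) ?_
      rw [hf, (circ_eq hμ hn).1, augFlow_augF]
    subst heq
    rw [← coeffMap_evalAt_bracket hD u n, ← coeffMap_dFlow_genLax, mapCoeff_eq]
    ext k
    simp only [coeffMap_coe, AlgHom.toLinearMap_apply, genLax, lax_coe]
    split_ifs
    · simp [derivation_one (hD.mul hn), derivation_one (dFlow_mul n)]
    -- Every symbol `u_n` lies in `𝒜`, so the intertwining property can be read off on the
    -- coefficients of `𝔏`.
    · have hmem := resFil_le_resAlg _ (ι_mem_resFil (-k - 1).toNat 0)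
      have := (hev ⟨_, hmem⟩).2
      rw [(augFlow_snd hn _).2] at this
      simpa using this.symm
    · simp
  · intro h n hn
    refine ⟨augFlow n, augFlow_isDerivationOf hμ hn, ?_, fun a => ⟨(augFlow_snd hn a).1, ?_⟩⟩
    · rw [augFlow_augF, (circ_eq hμ hn).1]
    · rw [(augFlow_snd hn a).2, evalAt_dFlow hD u hn (h n hn)]

theorem res_pow_flow (h : GelfandDickey D u) {m n : ℕ} (hn : 1 ≤ n) :
    D n (res (pow (D 1) (lax u) m)) =
      res (bracket (D 1) (projPos (pow (D 1) (lax u) n)) (pow (D 1) (lax u) m)) := by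
  rw [← coeffMap_pow (hD.mul le_rfl) (hD.mul hn) (hD.comm n 1 hn le_rfl) (h n hn) m]
  rfl

theorem res_pow_flow_symm (h : GelfandDickey D u) {m n : ℕ} (hm : 1 ≤ m) (hn : 1 ≤ n) :
    D n (res (pow (D 1) (lax u) m)) = D m (res (pow (D 1) (lax u) n)) := by
  rw [res_pow_flow hD u h hn, res_pow_flow hD u h hm, res_bracket_pow_symm (hD.mul le_rfl)]

end Times

/-! ### Adjoining a free element to a differential algebra -/

section Adjoin

/-- The relations of the free product `B * ℂ[φ]`; the generator `none` is `φ`. -/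
inductive AdjoinRel (B : Type u) [Ring B] [Algebra ℂ B] :
    FreeAlgebra ℂ (Option B) → FreeAlgebra ℂ (Option B) → Prop
  | add (a b : B) : AdjoinRel B (FreeAlgebra.ι ℂ (some (a + b)))
      (FreeAlgebra.ι ℂ (some a) + FreeAlgebra.ι ℂ (some b))
  | mul (a b : B) : AdjoinRel B (FreeAlgebra.ι ℂ (some (a * b)))
      (FreeAlgebra.ι ℂ (some a) * FreeAlgebra.ι ℂ (some b))
  | scalar (c : ℂ) : AdjoinRel B (FreeAlgebra.ι ℂ (some (algebraMap ℂ B c)))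
      (algebraMap ℂ (FreeAlgebra ℂ (Option B)) c)

/-- The free product `B * ℂ[φ]`. -/
abbrev AdjoinFree (B : Type u) [Ring B] [Algebra ℂ B] : Type u := RingQuot (AdjoinRel B)

variable {B : Type u} [Ring B] [Algebra ℂ B]

/-- The inclusion of `B` in `B * ℂ[φ]`. -/
def adjIncl : B →ₐ[ℂ] AdjoinFree B :=
  AlgHom.ofLinearMap
    { toFun := fun b => RingQuot.mkAlgHom ℂ (AdjoinRel B) (FreeAlgebra.ι ℂ (some b))
      map_add' := fun a b => by
        rw [← map_add]
        exact RingQuot.mkAlgHom_rel ℂ (AdjoinRel.add a b)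
      map_smul' := fun c b => by
        rw [RingHom.id_apply, Algebra.smul_def,
          RingQuot.mkAlgHom_rel ℂ (AdjoinRel.mul (algebraMap ℂ B c) b), map_mul,
          RingQuot.mkAlgHom_rel ℂ (AdjoinRel.scalar c), AlgHom.commutes, Algebra.smul_def] }
    (by
      have := RingQuot.mkAlgHom_rel ℂ (AdjoinRel.scalar (B := B) 1)
      simpa using this)
    (fun a b => by
      have := RingQuot.mkAlgHom_rel ℂ (AdjoinRel.mul a b)
      simpa using this)

/-- The adjoined element `φ`. -/
def adjElt : AdjoinFree B := RingQuot.mkAlgHom ℂ (AdjoinRel B) (FreeAlgebra.ι ℂ none)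

theorem mkAlgHom_some (b : B) :
    RingQuot.mkAlgHom ℂ (AdjoinRel B) (FreeAlgebra.ι ℂ (some b)) = adjIncl b := rfl

section Lift

variable {A : Type*} [Ring A] [Algebra ℂ A]

/-- The universal property of `B * ℂ[φ]`. -/
def adjLift (g : B →ₐ[ℂ] A) (a : A) : AdjoinFree B →ₐ[ℂ] A :=
  RingQuot.liftAlgHom ℂ ⟨FreeAlgebra.lift ℂ fun o => o.elim a g, by
    rintro _ _ (⟨a, b⟩ | ⟨a, b⟩ | ⟨c⟩) <;> simp⟩

@[simp] theorem adjLift_incl (g : B →ₐ[ℂ] A) (a : A) (b : B) :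
    adjLift g a (adjIncl b) = g b := by
  rw [← mkAlgHom_some, adjLift, RingQuot.liftAlgHom_mkAlgHom_apply]
  simp

@[simp] theorem adjLift_elt (g : B →ₐ[ℂ] A) (a : A) : adjLift g a adjElt = a := by
  rw [adjElt, adjLift, RingQuot.liftAlgHom_mkAlgHom_apply]
  simp

theorem adjHom_ext {g g' : AdjoinFree B →ₐ[ℂ] A} (h : ∀ b, g (adjIncl b) = g' (adjIncl b))
    (h' : g adjElt = g' adjElt) : g = g' := by
  apply RingQuot.ringQuot_ext'
  apply FreeAlgebra.hom_ext
  funext o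
  cases o with
  | none => exact h'
  | some b => exact h b

end Lift

/-- Setting `φ = 0` retracts `B * ℂ[φ]` onto `B`. -/
theorem adjIncl_injective : Function.Injective (adjIncl : B → AdjoinFree B) := by
  refine Function.LeftInverse.injective (g := adjLift (AlgHom.id ℂ B) 0) fun b => ?_
  simp

section Derivation

variable {d : B →ₗ[ℂ] B} (hd : ∀ a b, d (a * b) = d a * b + a * d b) (r : B)

/-- The homomorphism `a ↦ a + ε d a` on `B`. -/
def dualIncl : B →ₐ[ℂ] TrivSqZeroExt (AdjoinFree B) (AdjoinFree B) :=
  AlgHom.ofLinearMap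
    { toFun := fun b => TrivSqZeroExt.inl (adjIncl b) + TrivSqZeroExt.inr (adjIncl (d b))
      map_add' := fun a b => by ext <;> simp
      map_smul' := fun c b => by ext <;> simp }
    (by ext <;> simp [derivation_one hd])
    (fun a b => by ext <;> simp [hd, add_comm])

/-- The derivation of `B * ℂ[φ]` extending `d` by `φ ↦ r`. -/
def adjDer : AdjoinFree B →ₗ[ℂ] AdjoinFree B where
  toFun x := (adjLift (dualIncl hd)
    (TrivSqZeroExt.inl adjElt + TrivSqZeroExt.inr (adjIncl r)) x).snd
  map_add' a b := by simp
  map_smul' c a := by simp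

theorem adjDer_fst (x : AdjoinFree B) : (adjLift (dualIncl hd)
    (TrivSqZeroExt.inl adjElt + TrivSqZeroExt.inr (adjIncl r)) x).fst = x := by
  have h : (TrivSqZeroExt.fstHom ℂ (AdjoinFree B) (AdjoinFree B)).comp (adjLift (dualIncl hd)
      (TrivSqZeroExt.inl adjElt + TrivSqZeroExt.inr (adjIncl r))) = AlgHom.id ℂ _ :=
    adjHom_ext (fun b => by simp [dualIncl]) (by simp)
  exact DFunLike.congr_fun h x

theorem adjDer_mul (x y : AdjoinFree B) :
    adjDer hd r (x * y) = adjDer hd r x * y + x * adjDer hd r y := by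
  simp only [adjDer, LinearMap.coe_mk, AddHom.coe_mk, map_mul, TrivSqZeroExt.snd_mul, adjDer_fst,
    smul_eq_mul, MulOpposite.smul_eq_mul_unop, MulOpposite.unop_op]
  rw [add_comm]

@[simp] theorem adjDer_incl (b : B) : adjDer hd r (adjIncl b) = adjIncl (d b) := by
  simp [adjDer, dualIncl]

@[simp] theorem adjDer_elt : adjDer hd r adjElt = adjIncl r := by simp [adjDer]

end Derivation

/-- Derivations of `B * ℂ[φ]` that agree on `B` and `φ` are equal. -/
theorem adjDer_ext {d d' : AdjoinFree B →ₗ[ℂ] AdjoinFree B}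
    (hd : ∀ a b, d (a * b) = d a * b + a * d b) (hd' : ∀ a b, d' (a * b) = d' a * b + a * d' b)
    (h : ∀ b, d (adjIncl b) = d' (adjIncl b)) (h' : d adjElt = d' adjElt) : d = d' := by
  have := derivation_ext (RingQuot.mkAlgHom ℂ (AdjoinRel B))
    (d ∘ₗ (RingQuot.mkAlgHom ℂ (AdjoinRel B)).toLinearMap)
    (d' ∘ₗ (RingQuot.mkAlgHom ℂ (AdjoinRel B)).toLinearMap)
    (by simp [hd]) (by simp [hd']) (by
      rintro (_ | b)
      · exact h'
      · exact h b)
  refine LinearMap.ext fun x => ?_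
  obtain ⟨y, rfl⟩ := RingQuot.mkAlgHom_surjective ℂ (AdjoinRel B) x
  exact DFunLike.congr_fun this y

theorem coeffMap_algHom_pow {C : Type*} [Ring C] [Algebra ℂ C] {D : B →ₗ[ℂ] B} {E : C →ₗ[ℂ] C}
    (j : B →ₐ[ℂ] C) (hj : ∀ b, j (D b) = E (j b)) (V : PDO B) (n : ℕ) :
    coeffMap j.toLinearMap (pow D V n) = pow E (coeffMap j.toLinearMap V) n := by
  induction n with
  | zero =>
    ext k
    by_cases hk : k = 0 <;> simp [pow, hk]
  | succ n ih => rw [pow, coeffMap_algHom_mul D j hj, ih, pow]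

theorem coeffMap_algHom_lax {C : Type*} [Ring C] [Algebra ℂ C] (j : B →ₐ[ℂ] C) (u : ℕ → B) :
    coeffMap j.toLinearMap (lax u) = lax fun k => j (u k) := by
  ext k
  rw [coeffMap_coe, lax_coe, lax_coe]
  split_ifs <;> simp

/-- A closed family `r_n` is integrated by adjoining a free potential. -/
theorem exists_extension {D : ℕ → B →ₗ[ℂ] B} (hD : IsTimes D) (r : ℕ → B)
    (hr : ∀ m n, 1 ≤ m → 1 ≤ n → D n (r m) = D m (r n)) :
    ∃ (E : ℕ → AdjoinFree B →ₗ[ℂ] AdjoinFree B), IsTimes E ∧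
      (∀ n, 1 ≤ n → ∀ b : B, E n (adjIncl b) = adjIncl (D n b)) ∧
      ∀ n, 1 ≤ n → E n adjElt = adjIncl (r n) := by
  let E : ℕ → AdjoinFree B →ₗ[ℂ] AdjoinFree B := fun n =>
    if hn : 1 ≤ n then adjDer (hD.mul hn) (r n) else 0
  have hE : ∀ n (hn : 1 ≤ n), E n = adjDer (hD.mul hn) (r n) := fun n hn => dif_pos hn
  refine ⟨E, ⟨fun n hn x y => ?_, fun m n hm hn x => ?_⟩, fun n hn b => ?_, fun n hn => ?_⟩
  · rw [hE n hn]
    exact adjDer_mul _ _ x y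
  · rw [hE n hn, hE m hm]
    -- The commutator is a derivation that vanishes on `B` because the times commute, and on `φ`
    -- because the family `r` is closed.
    have := adjDer_ext
      (d := adjDer (hD.mul hm) (r m) ∘ₗ adjDer (hD.mul hn) (r n) -
        adjDer (hD.mul hn) (r n) ∘ₗ adjDer (hD.mul hm) (r m)) (d' := 0)
      (fun a b => by
        simp only [LinearMap.sub_apply, LinearMap.comp_apply, adjDer_mul, map_add, sub_mul,
          mul_sub]
        abel)
      (by simp) (fun b => by simp [hD.comm m n hm hn]) (by simp [hr m n hm hn])
    exact sub_eq_zero.mp (DFunLike.congr_fun this x)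
  · rw [hE n hn, adjDer_incl]
  · rw [hE n hn, adjDer_elt]

theorem exists_potential {D : ℕ → B →ₗ[ℂ] B} (hD : IsTimes D) (u : ℕ → B)
    (h : GelfandDickey D u) :
    ∃ (C : Type u) (_ : Ring C) (_ : Algebra ℂ C) (E : ℕ → C →ₗ[ℂ] C)
      (j : B →ₐ[ℂ] C) (φ : C), IsTimes E ∧ Function.Injective j ∧
        (∀ n, 1 ≤ n → ∀ b : B, E n (j b) = j (D n b)) ∧
        IsPotential E (fun k => j (u k)) φ := by
  obtain ⟨E, hE, h1, h2⟩ := exists_extension hD (fun n => res (pow (D 1) (lax u) n))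
    (fun m n hm hn => res_pow_flow_symm hD u h hm hn)
  refine ⟨AdjoinFree B, inferInstance, inferInstance, E, adjIncl, adjElt, hE, adjIncl_injective,
    h1, fun n hn => ?_⟩
  rw [h2 n hn, ← coeffMap_algHom_lax, ← coeffMap_algHom_pow adjIncl (fun b => (h1 1 le_rfl b).symm)]
  rfl

end Adjoin

/-! ### The coefficients of the shift `t ↦ t + [λ]` -/

open Finset.HasAntidiagonal

section MiwaOp

variable {M : Type*} [AddCommGroup M] [Module ℂ M]

/-- The coefficients of `exp(∑ λ^k D_k / k)`, given by Newton's recursion. -/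
def miwaOp (D : ℕ → M →ₗ[ℂ] M) : ℕ → M →ₗ[ℂ] M
  | 0 => LinearMap.id
  | n + 1 => ((n + 1 : ℕ) : ℂ)⁻¹ • ∑ k : Fin (n + 1), D (n + 1 - k) ∘ₗ miwaOp D k

theorem miwaOp_zero (D : ℕ → M →ₗ[ℂ] M) (x : M) : miwaOp D 0 x = x := by
  rw [miwaOp]; rfl

/-- The family `D` with `D 0` replaced by `0`. -/
def posPart (D : ℕ → M →ₗ[ℂ] M) (k : ℕ) : M →ₗ[ℂ] M := if k = 0 then 0 else D k

theorem posPart_zero (D : ℕ → M →ₗ[ℂ] M) : posPart D 0 = 0 := rfl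

theorem posPart_of_pos (D : ℕ → M →ₗ[ℂ] M) {k : ℕ} (hk : 1 ≤ k) : posPart D k = D k :=
  if_neg (by omega)

theorem miwaOp_newton (D : ℕ → M →ₗ[ℂ] M) (n : ℕ) (x : M) :
    (n : ℂ) • miwaOp D n x =
      ∑ p ∈ antidiagonal n, posPart D p.1 (miwaOp D p.2 x) := by
  cases n with
  | zero => simp [posPart_zero]
  | succ n =>
    have h0 : ((n + 1 : ℕ) : ℂ) ≠ 0 := by exact_mod_cast n.succ_ne_zero
    rw [miwaOp, LinearMap.smul_apply, smul_inv_smul₀ h0, LinearMap.sum_apply,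
      Finset.Nat.antidiagonal_succ, Finset.sum_cons, posPart_zero, LinearMap.zero_apply, zero_add,
      Finset.sum_map, ← Finset.Nat.sum_antidiagonal_swap,
      Finset.Nat.sum_antidiagonal_eq_sum_range_succ_mk, Finset.sum_range]
    refine Finset.sum_congr rfl fun k _ => ?_
    have : n + 1 - (k : ℕ) = n - k + 1 := by omega
    simp [posPart, this]

/-- Newton's recursion determines a sequence from its zeroth term. The later identities for `miwaOp`
are obtained by verifying the recursion. -/
theorem eq_miwaOp_of_newton (D : ℕ → M →ₗ[ℂ] M) (F : ℕ → M)
    (h : ∀ n : ℕ, (n : ℂ) • F n = ∑ p ∈ antidiagonal n, posPart D p.1 (F p.2)) (n : ℕ) :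
    F n = miwaOp D n (F 0) := by
  induction n using Nat.strong_induction_on with
  | _ n ih =>
  rcases Nat.eq_zero_or_pos n with rfl | hn
  · rw [miwaOp_zero]
  · have h0 : (n : ℂ) ≠ 0 := by exact_mod_cast hn.ne'
    refine smul_right_injective _ h0 ?_
    simp only
    rw [h, miwaOp_newton]
    refine Finset.sum_congr rfl ?_
    rintro ⟨i, j⟩ hp
    rw [mem_antidiagonal] at hp
    simp only at hp ⊢
    rcases Nat.eq_zero_or_pos i with rfl | hi
    · simp [posPart_zero]
    · rw [ih j (by omega)]

theorem map_miwaOp {N : Type*} [AddCommGroup N] [Module ℂ N] {D : ℕ → M →ₗ[ℂ] M}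
    {E : ℕ → N →ₗ[ℂ] N} (e : M →ₗ[ℂ] N) (h : ∀ k, 1 ≤ k → ∀ x, e (D k x) = E k (e x)) (n : ℕ)
    (x : M) : e (miwaOp D n x) = miwaOp E n (e x) := by
  have := eq_miwaOp_of_newton E (fun n => e (miwaOp D n x)) (fun n => by
    rw [← map_smul, miwaOp_newton, map_sum]
    refine Finset.sum_congr rfl fun p _ => ?_
    rcases Nat.eq_zero_or_pos p.1 with hp | hp
    · simp [hp, posPart_zero]
    · rw [posPart_of_pos _ hp, posPart_of_pos _ hp, h _ hp]) n
  rwa [miwaOp_zero] at this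

theorem miwaOp_comm {D : ℕ → M →ₗ[ℂ] M}
    (h : ∀ m n, 1 ≤ m → 1 ≤ n → ∀ x, D m (D n x) = D n (D m x)) (m n : ℕ) (x : M) :
    miwaOp D m (miwaOp D n x) = miwaOp D n (miwaOp D m x) :=
  map_miwaOp (miwaOp D m) (fun k hk x =>
    (map_miwaOp (D k) (fun l hl x => h k l hk hl x) m x).symm) n x

theorem sum_antidiagonal_left {A : Type*} [AddCommMonoid A] (f : ℕ → ℕ → ℕ → A) (n : ℕ) :
    ∑ p ∈ antidiagonal n, ∑ q ∈ antidiagonal p.1, f q.1 q.2 p.2 =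
      ∑ p ∈ antidiagonal n, ∑ q ∈ antidiagonal p.2, f p.1 q.1 q.2 := by
  rw [Finset.sum_sigma', Finset.sum_sigma']
  refine Finset.sum_nbij' (fun s => ⟨(s.2.1, s.2.2 + s.1.2), (s.2.2, s.1.2)⟩)
    (fun s => ⟨(s.1.1 + s.2.1, s.2.2), (s.1.1, s.2.1)⟩) ?_ ?_ ?_ ?_ ?_
  all_goals
    rintro ⟨⟨a, b⟩, c, d⟩ h
    simp only [Finset.mem_sigma, mem_antidiagonal] at h
    obtain ⟨h1, h2⟩ := h
    subst h1
  · subst h2; simp [add_assoc]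
  · subst h2; simp [add_assoc]
  · subst h2; rfl
  · subst h2; rfl
  · rfl

theorem sum_antidiagonal_right {A : Type*} [AddCommMonoid A] (f : ℕ → ℕ → ℕ → A) (n : ℕ) :
    ∑ p ∈ antidiagonal n, ∑ q ∈ antidiagonal p.2, f q.1 p.1 q.2 =
      ∑ p ∈ antidiagonal n, ∑ q ∈ antidiagonal p.2, f p.1 q.1 q.2 := by
  rw [← sum_antidiagonal_left f, ← sum_antidiagonal_left fun a b c => f b a c]
  refine Finset.sum_congr rfl fun p _ => ?_
  exact Finset.Nat.sum_antidiagonal_swap (f := fun q => f q.1 q.2 p.2)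

theorem isDerivationOf_posPart {μ : M →ₗ[ℂ] M →ₗ[ℂ] M} {D : ℕ → M →ₗ[ℂ] M}
    (h : ∀ k, 1 ≤ k → IsDerivationOf μ (D k)) (k : ℕ) : IsDerivationOf μ (posPart D k) := by
  rcases Nat.eq_zero_or_pos k with rfl | hk
  · intro x y; simp [posPart_zero]
  · rw [posPart_of_pos _ hk]; exact h k hk

theorem miwaOp_mul {μ : M →ₗ[ℂ] M →ₗ[ℂ] M} {D : ℕ → M →ₗ[ℂ] M}
    (h : ∀ k, 1 ≤ k → IsDerivationOf μ (D k)) (n : ℕ) (x y : M) :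
    miwaOp D n (μ x y) =
      ∑ p ∈ antidiagonal n, μ (miwaOp D p.1 x) (miwaOp D p.2 y) := by
  have hθ := isDerivationOf_posPart h
  have := eq_miwaOp_of_newton D
    (fun n => ∑ p ∈ antidiagonal n, μ (miwaOp D p.1 x) (miwaOp D p.2 y)) (fun n => by
      simp only [map_sum, hθ _ _ _, Finset.sum_add_distrib]
      have e1 := sum_antidiagonal_left
        (fun i a b => μ (posPart D i (miwaOp D a x)) (miwaOp D b y)) n
      have e2 := sum_antidiagonal_right
        (fun i a b => μ (miwaOp D a x) (posPart D i (miwaOp D b y))) n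
      rw [← e1, ← e2, ← Finset.sum_add_distrib, Finset.smul_sum]
      refine Finset.sum_congr rfl fun p hp => ?_
      rw [mem_antidiagonal] at hp
      simp only [← map_sum, ← LinearMap.sum_apply, ← miwaOp_newton]
      rw [← hp]
      simp only [map_smul, LinearMap.smul_apply]
      push_cast
      rw [add_smul]) n
  simp only [antidiagonal_zero, Finset.sum_singleton, miwaOp_zero] at this
  exact this.symm

end MiwaOp

/-! ### Newton's recursion for the coefficients of the exponential series. -/

section ShiftCoeff

variable {E : Type*} [Ring E]

/-- The operator `λ d/dλ` on power series. -/
def euler (F : PowerSeries E) : PowerSeries E := PowerSeries.mk fun n => n • PowerSeries.coeff n F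

theorem euler_mul (F G : PowerSeries E) : euler (F * G) = euler F * G + F * euler G := by
  ext n
  simp only [euler, PowerSeries.coeff_mk, PowerSeries.coeff_mul, map_add, Finset.smul_sum,
    ← Finset.sum_add_distrib]
  refine Finset.sum_congr rfl fun p hp => ?_
  rw [mem_antidiagonal] at hp
  rw [← hp, add_smul, smul_mul_assoc, mul_smul_comm]

theorem euler_pow {G : PowerSeries E}
    (h : ∀ i j, Commute (PowerSeries.coeff i G) (PowerSeries.coeff j G)) (r : ℕ) :
    euler (G ^ (r + 1)) = (r + 1) • (euler G * G ^ r) := by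
  have hc : Commute (euler G) G := by
    ext n
    rw [PowerSeries.coeff_mul, PowerSeries.coeff_mul, ← Finset.Nat.sum_antidiagonal_swap]
    refine Finset.sum_congr rfl fun p _ => ?_
    simp only [euler, PowerSeries.coeff_mk, Prod.fst_swap, Prod.snd_swap]
    exact ((h _ _).smul_left _).eq
  induction r with
  | zero => simp
  | succ r ih =>
    rw [pow_succ', euler_mul, ih, mul_smul_comm, ← mul_assoc, ← hc.eq, mul_assoc, ← pow_succ',
      succ_nsmul' _ (r + 1)]

theorem coeff_pow_eq_zero {G : PowerSeries E} (h : PowerSeries.coeff 0 G = 0) (r : ℕ) :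
    ∀ n, n < r → PowerSeries.coeff n (G ^ r) = 0 := by
  induction r with
  | zero => intro n hn; omega
  | succ r ih =>
    intro n hn
    rw [pow_succ', PowerSeries.coeff_mul]
    refine Finset.sum_eq_zero fun p hp => ?_
    rw [mem_antidiagonal] at hp
    rcases Nat.eq_zero_or_pos p.1 with h0 | h0
    · rw [h0, h, zero_mul]
    · rw [ih p.2 (by omega), mul_zero]

variable {B : Type*} [Ring B] [Algebra ℂ B] {D : ℕ → B →ₗ[ℂ] B}

/-- Apply `λ d/dλ` to `exp(G)`: as the coefficients of `G` commute, the result is `(λ G') exp(G)`,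
and `λ G' = ∑ λ^k ∂_{t_k}`. -/
theorem shiftCoeff_newton (hD : IsTimes D) (n : ℕ) :
    (n : ℂ) • shiftCoeff D n =
      ∑ p ∈ antidiagonal n, (posPart D p.1 : Module.End ℂ B) * shiftCoeff D p.2 := by
  have hG : ∀ k, PowerSeries.coeff k (shiftGen D) =
      if k = 0 then 0 else ((k : ℂ)⁻¹) • (D k : Module.End ℂ B) := fun k => by
    rw [shiftGen, PowerSeries.coeff_mk]
  have hcomm : ∀ i j, Commute (PowerSeries.coeff i (shiftGen D))
      (PowerSeries.coeff j (shiftGen D)) := by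
    intro i j
    rw [hG, hG]
    split_ifs with hi hj
    · exact Commute.zero_left _
    · exact Commute.zero_left _
    · exact Commute.zero_right _
    · refine Commute.smul_left (Commute.smul_right ?_ _) _
      exact LinearMap.ext (hD.comm i j (by omega) (by omega))
  have h0 : PowerSeries.coeff 0 (shiftGen D) = 0 := by rw [hG, if_pos rfl]
  have hE : ∀ k, PowerSeries.coeff k (euler (shiftGen D)) = (posPart D k : Module.End ℂ B) := by
    intro k
    rw [euler, PowerSeries.coeff_mk, hG]
    rcases Nat.eq_zero_or_pos k with rfl | hk
    · simp [posPart_zero]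
    · have : (k : ℂ) ≠ 0 := by exact_mod_cast hk.ne'
      rw [posPart_of_pos _ hk, if_neg hk.ne', ← Nat.cast_smul_eq_nsmul ℂ, smul_smul,
        mul_inv_cancel₀ this, one_smul]
  have key : ∀ r, ((r + 1).factorial : ℂ)⁻¹ • ((n : ℂ) • PowerSeries.coeff n (shiftGen D ^ (r + 1)))
      = ∑ p ∈ antidiagonal n, (posPart D p.1 : Module.End ℂ B) *
        ((r.factorial : ℂ)⁻¹ • PowerSeries.coeff p.2 (shiftGen D ^ r)) := by
    intro r
    have h1 : (n : ℂ) • PowerSeries.coeff n (shiftGen D ^ (r + 1)) =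
        PowerSeries.coeff n (euler (shiftGen D ^ (r + 1))) := by
      rw [euler, PowerSeries.coeff_mk, Nat.cast_smul_eq_nsmul]
    have hr : ((r + 1 : ℕ) : ℂ) ≠ 0 := by exact_mod_cast r.succ_ne_zero
    rw [h1, euler_pow hcomm, map_nsmul, ← Nat.cast_smul_eq_nsmul ℂ, smul_smul, Nat.factorial_succ,
      Nat.cast_mul, mul_inv, mul_right_comm, inv_mul_cancel₀ hr, one_mul, PowerSeries.coeff_mul,
      Finset.smul_sum]
    refine Finset.sum_congr rfl fun p _ => ?_
    rw [hE, mul_smul_comm]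
  rw [shiftCoeff, Finset.smul_sum, Finset.sum_range_succ']
  have hlast : (n : ℂ) • ((Nat.factorial 0 : ℂ)⁻¹ • PowerSeries.coeff n (shiftGen D ^ 0)) = 0 := by
    rcases Nat.eq_zero_or_pos n with rfl | hn
    · simp
    · simp [PowerSeries.coeff_one, hn.ne']
  rw [hlast, add_zero]
  simp only [smul_comm (n : ℂ), key]
  rw [Finset.sum_comm]
  refine Finset.sum_congr rfl fun p hp => ?_
  rw [mem_antidiagonal] at hp
  rw [← Finset.mul_sum]
  rcases Nat.eq_zero_or_pos p.1 with hp1 | hp1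
  · rw [hp1, posPart_zero]
    ext1 x
    simp
  · congr 1
    rw [shiftCoeff]
    -- `G` has no constant term, so `G^r` starts at `λ^r` and the longer range adds only zeros.
    refine (Finset.sum_subset (Finset.range_subset_range.mpr (by omega)) fun r _ hr => ?_).symm
    rw [Finset.mem_range] at hr
    rw [coeff_pow_eq_zero h0 r p.2 (by omega), smul_zero]

theorem shiftCoeff_eq_miwaOp (hD : IsTimes D) (n : ℕ) (x : B) :
    shiftCoeff D n x = miwaOp D n x := by
  have h0 : shiftCoeff D 0 x = x := by simp [shiftCoeff]
  have := eq_miwaOp_of_newton D (fun n => shiftCoeff D n x) (fun n => by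
    have := DFunLike.congr_fun (shiftCoeff_newton hD n) x
    simpa using this) n
  rwa [h0] at this

end ShiftCoeff

/-! ### The potential KP hierarchy -/

section LeftPowers

/-- The left powers `f, f ∘ f, f ∘ (f ∘ f), …`. -/
def leftPow (μ : Aug →ₗ[ℂ] Aug →ₗ[ℂ] Aug) : ℕ → Aug
  | 0 => augF
  | n + 1 => μ augF (leftPow μ n)

/-- The operators `(S π_-)^j S`. -/
def negWord (j : ℕ) : Module.End ℂ (PDO Poly) := (opS * projNeg) ^ j * opS

theorem negWord_succ (j : ℕ) : negWord (j + 1) = opS * projNeg * negWord j := by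
  rw [negWord, pow_succ', mul_assoc]; rfl

theorem negWord_mem (j : ℕ) : negWord j ∈ opSpace := by
  induction j with
  | zero => simpa [negWord] using opS_mem
  | succ j ih => rw [negWord_succ]; exact mul_projNeg_mul_mem opS_mem ih

variable {μ : Aug →ₗ[ℂ] Aug →ₗ[ℂ] Aug} (hμ : IsAugProduct μ)
include hμ

theorem leftPow_succ (j : ℕ) : leftPow μ (j + 1) = -el (negWord j) := by
  induction j with
  | zero => simp [leftPow, negWord, mu_f_f hμ]
  | succ j ih => rw [leftPow, ih, map_neg, mu_f_el hμ (negWord_mem j), negWord_succ]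

theorem exists_leftPow_eq_el {j : ℕ} (hj : 1 ≤ j) : ∃ A ∈ opSpace, leftPow μ j = el A := by
  obtain ⟨k, rfl⟩ : ∃ k, j = k + 1 := ⟨j - 1, by omega⟩
  exact ⟨-negWord k, end_neg_mem (negWord_mem k), by rw [leftPow_succ hμ, el_neg]⟩

theorem mu_el_leftPow {A : Module.End ℂ (PDO Poly)} (hA : A ∈ opSpace) (j : ℕ) :
    μ (el A) (leftPow μ j) = -el (A * projPos * negWord j) := by
  cases j with
  | zero => rw [leftPow, mu_el_f hμ hA]; simp [negWord]
  | succ j =>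
    rw [leftPow_succ hμ, map_neg, mu_el_el hμ hA (negWord_mem j), negWord_succ, opMul]
    simp only [mul_assoc]

/-- Inserting `π₊ = 1 - π₋` after `S^k` turns each summand into a difference of consecutive terms
`S^k (S π₋)^{n-k} S`, so the sum telescopes. -/
theorem sum_augFlow_leftPow (n : ℕ) : augFlow (n + 1) augF +
    ∑ p ∈ antidiagonal n, μ (posPart augFlow p.1 augF) (leftPow μ p.2) = leftPow μ (n + 1) := by
  rw [Finset.Nat.sum_antidiagonal_eq_sum_range_succ_mk, Finset.sum_range_succ', posPart_zero]
  simp only [LinearMap.zero_apply, map_zero, add_zero]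
  have h : ∀ k ∈ Finset.range n,
      μ (posPart augFlow (k + 1) augF) (leftPow μ (n - (k + 1))) =
        el (opS ^ (k + 1) * negWord (n - (k + 1))) - el (opS ^ k * negWord (n - k)) := by
    intro k hk
    rw [Finset.mem_range] at hk
    have e : n - k = n - (k + 1) + 1 := by omega
    rw [posPart_of_pos _ (by omega), augFlow_augF, map_neg, LinearMap.neg_apply,
      mu_el_leftPow hμ (opS_pow_mem (by omega)), neg_neg, e, negWord_succ,
      el_split (opS ^ (k + 1)) (negWord (n - (k + 1))), pow_succ]
    simp only [mul_assoc]
    abel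
  rw [Finset.sum_congr rfl h,
    Finset.sum_range_sub (fun k => el (opS ^ k * negWord (n - k))), augFlow_augF, leftPow_succ hμ]
  simp only [negWord, pow_succ, pow_zero, one_mul, Nat.sub_self, Nat.sub_zero]
  abel

/-- Coefficientwise form of `f_{[λ]} = f + λ f ∘ f_{[λ]}`: the left powers satisfy Newton's
recursion. -/
theorem miwaOp_augFlow_augF (n : ℕ) : miwaOp augFlow n augF = leftPow μ n := by
  symm
  refine eq_miwaOp_of_newton augFlow (leftPow μ) (fun n => ?_) n
  induction n with
  | zero => simp [posPart_zero]
  | succ n ih =>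
    have hθ := isDerivationOf_posPart (μ := μ) (D := augFlow)
      fun k hk => augFlow_isDerivationOf hμ hk
    rw [Finset.Nat.sum_antidiagonal_succ']
    simp only [leftPow, hθ _ _ _, Finset.sum_add_distrib, ← map_sum]
    rw [← ih, map_smul]
    have := sum_augFlow_leftPow hμ n
    rw [← add_assoc, posPart_of_pos _ (by omega : 1 ≤ n + 1), this, leftPow]
    push_cast
    module

end LeftPowers

/-! ### Evaluation of `𝔸` at a potential, and the pKP equation. -/

section Potential

variable {B : Type*} [Ring B] [Algebra ℂ B] {D : ℕ → B →ₗ[ℂ] B} (u : ℕ → B) (φ : B)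

/-- Evaluation on `𝔸`, with `f ↦ -φ`. -/
def evalAug (D : ℕ → B →ₗ[ℂ] B) (u : ℕ → B) (φ : B) : Aug →ₗ[ℂ] B :=
  (LinearMap.fst ℂ ℂ resAlg).smulRight (-φ) +
    (evalAt D u).toLinearMap ∘ₗ resAlg.subtype ∘ₗ LinearMap.snd ℂ ℂ resAlg

theorem evalAug_augF : evalAug D u φ augF = -φ := by simp [evalAug, augF]

theorem evalAug_el {A : Module.End ℂ (PDO Poly)} (hA : A ∈ opSpace) :
    evalAug D u φ (el A) = evalAt D u (resAt A) := by
  have h := isElt_el hA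
  simp [evalAug, h.1, h.2]

section Flow

variable (hD : IsTimes D) (hu : GelfandDickey D u) {φ : B} (hφ : IsPotential D u φ)
include hD hu hφ

theorem evalAug_augFlow (n : ℕ) (hn : 1 ≤ n) (x : Aug) :
    evalAug D u φ (augFlow n x) = D n (evalAug D u φ x) := by
  obtain ⟨A, hA, h⟩ := exists_aug_eq x
  rw [h]
  simp only [map_add, map_smul]
  rw [augFlow_augF, augFlow_el hA, map_neg, evalAug_el u φ (opS_pow_mem hn), evalAug_augF,
    evalAug_el u φ (flowOp_mem hn hA), evalAug_el u φ hA, ← dFlow_resAt,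
    evalAt_dFlow hD u hn (hu n hn), resAt_eq, opS_pow_one, evalAt_res_pow hD, map_neg, hφ n hn]

theorem evalAug_miwaOp (n : ℕ) (x : Aug) :
    evalAug D u φ (miwaOp augFlow n x) = miwaOp D n (evalAug D u φ x) :=
  map_miwaOp (evalAug D u φ) (evalAug_augFlow u hD hu hφ) n x

end Flow

/-- The defect of multiplicativity of the evaluation. -/
def defect (μ : Aug →ₗ[ℂ] Aug →ₗ[ℂ] Aug) (D : ℕ → B →ₗ[ℂ] B) (u : ℕ → B) (φ : B)
    (x y : Aug) : B :=
  evalAug D u φ (μ x y) - evalAug D u φ x * evalAug D u φ y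

variable {μ : Aug →ₗ[ℂ] Aug →ₗ[ℂ] Aug} (hμ : IsAugProduct μ)
include hμ

theorem defect_el_el {A A' : Module.End ℂ (PDO Poly)} (hA : A ∈ opSpace) (hA' : A' ∈ opSpace) :
    defect μ D u φ (el A) (el A') = 0 := by
  rw [defect, mu_el_el hμ hA hA', evalAug_el u φ (opMul_mem hA hA'), evalAug_el u φ hA,
    evalAug_el u φ hA', resAt_opMul hA, map_mul, sub_self]

variable (hD : IsTimes D) (hu : GelfandDickey D u) {φ : B} (hφ : IsPotential D u φ)
include hD hu hφ

theorem miwaOp_potential (n : ℕ) :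
    miwaOp D n φ = -evalAug D u φ (leftPow μ n) := by
  rw [← miwaOp_augFlow_augF hμ, evalAug_miwaOp u hD hu hφ, evalAug_augF, map_neg, neg_neg]

theorem miwaOp_defect (m : ℕ) (x y : Aug) :
    miwaOp D m (defect μ D u φ x y) =
      ∑ p ∈ antidiagonal m,
        defect μ D u φ (miwaOp augFlow p.1 x) (miwaOp augFlow p.2 y) := by
  simp only [defect]
  rw [map_sub, Finset.sum_sub_distrib, ← evalAug_miwaOp u hD hu hφ,
    miwaOp_mul (fun k hk => augFlow_isDerivationOf hμ hk), map_sum]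
  have := miwaOp_mul (μ := LinearMap.mul ℂ B) (D := D) (fun k hk => hD.leibniz k hk) m
    (evalAug D u φ x) (evalAug D u φ y)
  simp only [LinearMap.mul_apply'] at this
  rw [this]
  simp only [evalAug_miwaOp u hD hu hφ]

/-- The coefficient of `λ^n` in `λ⁻¹(φ_{[λ]} - φ) + φ φ_{[λ]}`. -/
theorem potential_coeff (n : ℕ) :
    miwaOp D (n + 1) φ + φ * miwaOp D n φ = -defect μ D u φ augF (leftPow μ n) := by
  rw [miwaOp_potential u hμ hD hu hφ, miwaOp_potential u hμ hD hu hφ, defect, leftPow,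
    evalAug_augF]
  noncomm_ring

omit hD hu hφ in
theorem exists_miwaOp_leftPow_eq_el (m : ℕ) {n : ℕ} (hn : 1 ≤ n) :
    ∃ A ∈ opSpace, miwaOp augFlow m (leftPow μ n) = el A := by
  have : ∀ x : Aug, x.1 = 0 → (miwaOp augFlow m x).1 = 0 := by
    intro x hx
    -- The flows map all of `𝔸` into `𝒜`, so the projection to the `f`-component intertwines them
    -- with zero flows on `ℂ`.
    have := map_miwaOp (D := augFlow) (E := fun _ => (0 : ℂ →ₗ[ℂ] ℂ)) (LinearMap.fst ℂ ℂ resAlg)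
      (fun k hk x => by
        obtain ⟨A, hA, h⟩ := exists_aug_eq x
        rw [h, map_add, map_smul, augFlow_augF, augFlow_el hA, ← el_neg]
        simp only [LinearMap.fst_apply, Prod.fst_add, Prod.smul_fst, LinearMap.zero_apply]
        have e : ∀ A, (el A).1 = 0 := fun A => rfl
        rw [e, e]
        simp) m x
    simp only [LinearMap.fst_apply] at this
    rw [this, hx, map_zero]
  obtain ⟨A, hA, h⟩ := exists_leftPow_eq_el hμ hn
  exact exists_el_of_fst_eq_zero (this _ (by rw [h]; rfl))

/-- The coefficients of the doubly shifted expression, up to a symmetric part. -/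
theorem miwaOp_potential_coeff (m n : ℕ) :
    miwaOp D m (miwaOp D (n + 1) φ + φ * miwaOp D n φ) =
      -defect μ D u φ augF (miwaOp augFlow m (leftPow μ n)) -
        if n = 0 ∧ m ≠ 0 then defect μ D u φ (leftPow μ m) augF else 0 := by
  rw [potential_coeff u hμ hD hu hφ, map_neg, miwaOp_defect u hμ hD hu hφ]
  rcases Nat.eq_zero_or_pos m with rfl | hm
  · simp [miwaOp_zero]
  rw [Finset.Nat.sum_antidiagonal_eq_sum_range_succ_mk, Finset.sum_range_succ']
  simp only [Nat.sub_zero, miwaOp_augFlow_augF hμ]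
  -- The Leibniz sum consists of defects of `p_i f` and `p_{m-i} F_n`, where `p_j` denotes `miwaOp
  -- augFlow j`. For `i ≥ 1` the first argument lies in `𝒜`, and so does the second, except when `n
  -- = 0` and `i = m`, where it is `f` again.
  by_cases hn : n = 0
  · subst hn
    rw [if_pos ⟨rfl, by omega⟩]
    obtain ⟨k, rfl⟩ : ∃ k, m = k + 1 := ⟨m - 1, by omega⟩
    rw [Finset.sum_range_succ, Finset.sum_eq_zero]
    · simp only [Nat.sub_self, miwaOp_zero]
      rw [leftPow]
      abel
    · intro j hj
      rw [Finset.mem_range] at hj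
      obtain ⟨A, hA, h⟩ := exists_leftPow_eq_el hμ (by omega : 1 ≤ j + 1)
      obtain ⟨A', hA', h'⟩ := exists_leftPow_eq_el hμ (by omega : 1 ≤ k + 1 - (j + 1))
      rw [leftPow.eq_1, miwaOp_augFlow_augF hμ, h, h']
      exact defect_el_el u φ hμ hA hA'
  · rw [if_neg (by tauto), Finset.sum_eq_zero]
    · abel
    · intro j hj
      obtain ⟨A, hA, h⟩ := exists_leftPow_eq_el hμ (by omega : 1 ≤ j + 1)
      obtain ⟨A', hA', h'⟩ := exists_miwaOp_leftPow_eq_el hμ (m - (j + 1))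
        (Nat.pos_of_ne_zero hn)
      rw [h, h']
      exact defect_el_el u φ hμ hA hA'

omit hD hu hφ in
theorem miwaOp_leftPow_comm (m n : ℕ) :
    miwaOp augFlow m (leftPow μ n) = miwaOp augFlow n (leftPow μ m) := by
  rw [← miwaOp_augFlow_augF hμ, ← miwaOp_augFlow_augF hμ,
    miwaOp_comm (fun m n hm hn x => augFlow_comm hμ hm hn x)]

/-- Expand `p_1 F_3` and `p_2 F_2` by the Leibniz rule, where `p_j` denotes `miwaOp augFlow j`. As
`p_1 F_2 = p_2 F_1`, the terms with left factor `f` cancel in the difference. Only products inside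
`𝒜` remain, and evaluation respects these. -/
theorem pkpEquation_of_isPotential : PKPEquation D φ := by
  have hder : ∀ k, 1 ≤ k → IsDerivationOf μ (augFlow k) :=
    fun k hk => augFlow_isDerivationOf hμ hk
  have h1 : ∀ x, miwaOp D 1 x = D 1 x := fun x => by
    have := miwaOp_newton D 1 x
    simpa [Finset.Nat.antidiagonal_succ, posPart, miwaOp_zero] using this
  have h2 : ∀ x, miwaOp D 2 x = (2 : ℂ)⁻¹ • (D 2 x + D 1 (D 1 x)) := fun x => by
    have := miwaOp_newton D 2 x
    simp [Finset.Nat.antidiagonal_succ, posPart, miwaOp_zero, h1] at this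
    rw [eq_inv_smul_iff₀ two_ne_zero, this, add_comm]
  have h3 : ∀ x, miwaOp D 3 x = (3 : ℂ)⁻¹ • (D 3 x + D 2 (D 1 x) + D 1 (miwaOp D 2 x)) :=
    fun x => by
    have := miwaOp_newton D 3 x
    simp [Finset.Nat.antidiagonal_succ, posPart, miwaOp_zero, h1] at this
    rw [eq_inv_smul_iff₀ three_ne_zero, this]
    abel
  let F := leftPow μ
  have hF0 : leftPow μ 0 = augF := rfl
  have hF1 : miwaOp augFlow 1 (F 3) = μ augF (miwaOp augFlow 1 (F 2)) + μ (F 1) (F 2) := by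
    have := miwaOp_mul hder 1 augF (F 2)
    simp [Finset.Nat.antidiagonal_succ, miwaOp_zero, miwaOp_augFlow_augF hμ, hF0] at this
    exact this
  have hF2 : miwaOp augFlow 2 (F 2) = μ augF (miwaOp augFlow 2 (F 1)) +
      μ (F 1) (miwaOp augFlow 1 (F 1)) + μ (F 2) (F 1) := by
    have := miwaOp_mul hder 2 augF (F 1)
    simp [Finset.Nat.antidiagonal_succ, miwaOp_zero, miwaOp_augFlow_augF hμ, hF0] at this
    rw [add_assoc]
    exact this
  have hmul : ∀ (x y : Aug), (∃ A ∈ opSpace, x = el A) → (∃ A ∈ opSpace, y = el A) →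
      evalAug D u φ (μ x y) = evalAug D u φ x * evalAug D u φ y := by
    rintro _ _ ⟨A, hA, rfl⟩ ⟨A', hA', rfl⟩
    exact sub_eq_zero.mp (defect_el_el u φ hμ hA hA')
  have key : evalAug D u φ (miwaOp augFlow 1 (F 3)) - evalAug D u φ (miwaOp augFlow 2 (F 2)) =
      evalAug D u φ (F 1) * evalAug D u φ (F 2) -
        evalAug D u φ (F 1) * evalAug D u φ (miwaOp augFlow 1 (F 1)) -
        evalAug D u φ (F 2) * evalAug D u φ (F 1) := by
    have e1 := exists_leftPow_eq_el hμ (le_refl 1)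
    have e2 := exists_leftPow_eq_el hμ (by norm_num : 1 ≤ 2)
    have e3 := exists_miwaOp_leftPow_eq_el hμ 1 (le_refl 1)
    rw [hF1, hF2, ← hmul _ _ e1 e2, ← hmul _ _ e1 e3, ← hmul _ _ e2 e1,
      miwaOp_leftPow_comm hμ 1 2]
    simp only [map_add]
    abel
  have hev : ∀ n, evalAug D u φ (F n) = -miwaOp D n φ := fun n => by
    rw [miwaOp_potential u hμ hD hu hφ, neg_neg]
  have hc := fun m n x => hD.comm (m + 1) (n + 1) (by omega) (by omega) x
  have hc12 : ∀ x, D 2 (D 1 x) = D 1 (D 2 x) := hc 1 0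
  simp only [evalAug_miwaOp u hD hu hφ, hev, h1, h2, h3, map_neg, map_smul, map_add, smul_add,
    mul_neg, neg_mul, neg_neg, smul_mul_assoc, mul_smul_comm, mul_add, add_mul, hc12] at key
  simp only [PKPEquation, map_sub, map_smul, hD.mul le_rfl]
  -- The factor `-12` clears the denominators of `-φ_{t_1t_3}/3 + φ_{t_1t_1t_1t_1}/12 +
  -- φ_{t_2t_2}/4`.
  have h0 := congrArg (fun b => (-12 : ℂ) • b) (sub_eq_zero.mpr key)
  simp only [smul_zero] at h0
  rw [← h0]
  module

end Potential

/-! ### The functional pKP hierarchy, coefficient by coefficient. -/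

section Hierarchy

variable {B : Type*} [Ring B] [Algebra ℂ B] {D : ℕ → B →ₗ[ℂ] B}

theorem coeff_miwa_C (hD : IsTimes D) (φ : B) (i : Fin 3) (α : Fin 3 →₀ ℕ) :
    MvPowerSeries.coeff α (miwa D i (MvPowerSeries.C φ)) =
      if α = Finsupp.single i (α i) then miwaOp D (α i) φ else 0 := by
  change ∑ j ∈ Finset.range (α i + 1),
    shiftCoeff D j (MvPowerSeries.coeff (α - Finsupp.single i j) (MvPowerSeries.C φ)) = _
  have h : ∀ j ≤ α i, α - Finsupp.single i j = 0 → j = α i ∧ α = Finsupp.single i (α i) := by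
    intro j hj h
    have hi := DFunLike.congr_fun h i
    simp only [Finsupp.coe_tsub, Pi.sub_apply, Finsupp.single_eq_same, Finsupp.coe_zero,
      Pi.zero_apply] at hi
    obtain rfl : j = α i := by omega
    refine ⟨rfl, le_antisymm (tsub_eq_zero_iff_le.mp h) ?_⟩
    rw [Finsupp.single_le_iff]
  classical
  simp only [MvPowerSeries.coeff_C]
  rw [Finset.sum_eq_single (α i)]
  · rw [shiftCoeff_eq_miwaOp hD]
    by_cases hα : α = Finsupp.single i (α i)
    · rw [if_pos hα, if_pos (tsub_eq_zero_iff_le.mpr hα.le)]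
    · rw [if_neg hα, if_neg fun h0 => hα (h _ le_rfl h0).2, map_zero]
  · intro j hj hne
    rw [if_neg fun h0 => hne (h j (Nat.lt_succ_iff.mp (Finset.mem_range.mp hj)) h0).1, map_zero]
  · intro h0
    exact absurd (Finset.mem_range.mpr (Nat.lt_succ_self _)) h0

/-- A series in `λ_i` alone acquires only powers of `λ_k` under the shift, and the exponent of `λ_k`
tells which shift coefficient acted. -/
theorem coeff_miwa_of_axis (hD : IsTimes D) {G : MvPowerSeries (Fin 3) B} {i k : Fin 3}
    (hik : i ≠ k) (h : ℕ → B)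
    (hG : ∀ β, MvPowerSeries.coeff β G = if β = Finsupp.single i (β i) then h (β i) else 0)
    (α : Fin 3 →₀ ℕ) :
    MvPowerSeries.coeff α (miwa D k G) =
      if α = Finsupp.single i (α i) + Finsupp.single k (α k) then miwaOp D (α k) (h (α i))
      else 0 := by
  change ∑ j ∈ Finset.range (α k + 1),
    shiftCoeff D j (MvPowerSeries.coeff (α - Finsupp.single k j) G) = _
  have hi : ∀ j, (α - Finsupp.single k j : Fin 3 →₀ ℕ) i = α i := fun j => by
    simp [Finsupp.single_eq_of_ne hik]
  have hle : Finsupp.single k (α k) ≤ α := by rw [Finsupp.single_le_iff]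
  have hk : ∀ j ≤ α k, α - Finsupp.single k j = Finsupp.single i (α i) → j = α k := by
    intro j hj h0
    have := DFunLike.congr_fun h0 k
    simp only [Finsupp.coe_tsub, Pi.sub_apply, Finsupp.single_eq_same,
      Finsupp.single_eq_of_ne hik.symm] at this
    omega
  simp only [hG, hi]
  rw [Finset.sum_eq_single (α k)]
  · rw [shiftCoeff_eq_miwaOp hD]
    simp only [tsub_eq_iff_eq_add_of_le hle]
    split_ifs
    · rfl
    · rw [map_zero]
  · intro j hj hne
    rw [if_neg fun h0 => hne (hk j (Nat.lt_succ_iff.mp (Finset.mem_range.mp hj)) h0), map_zero]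
  · intro h0
    exact absurd (Finset.mem_range.mpr (Nat.lt_succ_self _)) h0

theorem coeff_potential (hD : IsTimes D) (φ : B) (i : Fin 3) (β : Fin 3 →₀ ℕ) :
    MvPowerSeries.coeff β (divVar i (miwa D i (MvPowerSeries.C φ) - MvPowerSeries.C φ) +
        MvPowerSeries.C φ * miwa D i (MvPowerSeries.C φ)) =
      if β = Finsupp.single i (β i) then miwaOp D (β i + 1) φ + φ * miwaOp D (β i) φ else 0 := by
  classical
  have e : MvPowerSeries.coeff β
      (divVar i (miwa D i (MvPowerSeries.C φ) - MvPowerSeries.C φ)) =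
      MvPowerSeries.coeff (β + Finsupp.single i 1)
        (miwa D i (MvPowerSeries.C φ) - MvPowerSeries.C φ) := rfl
  have h0 : β + Finsupp.single i 1 ≠ 0 := fun h => by
    have := DFunLike.congr_fun h i
    simp at this
  rw [map_add, e, map_sub, MvPowerSeries.coeff_C_mul, coeff_miwa_C hD, coeff_miwa_C hD,
    MvPowerSeries.coeff_C, if_neg h0, sub_zero]
  simp only [Finsupp.coe_add, Pi.add_apply, Finsupp.single_eq_same, Finsupp.single_add,
    add_left_inj]
  split_ifs <;> simp

theorem sum_sign_smul_eq_zero {ι A : Type*} [Fintype ι] [DecidableEq ι] [AddCommGroup A]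
    {i j : ι} (hij : i ≠ j) (F : Equiv.Perm ι → A) (h : ∀ σ, F (σ * Equiv.swap i j) = F σ) :
    ∑ σ : Equiv.Perm ι, ((Equiv.Perm.sign σ : ℤˣ) : ℤ) • F σ = 0 := by
  refine Finset.sum_involution (fun σ _ => σ * Equiv.swap i j) ?_ ?_ ?_ ?_
  · intro σ _
    simp [h, Equiv.Perm.sign_swap hij]
  · intro σ _ _ h1
    exact hij (Equiv.swap_eq_one_iff.mp (mul_eq_left.mp h1))
  · intro σ _
    exact Finset.mem_univ _
  · intro σ _
    simp [mul_assoc]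

variable (u : ℕ → B) {φ : B} {μ : Aug →ₗ[ℂ] Aug →ₗ[ℂ] Aug}

theorem pkpHierarchy_of_isPotential (hμ : IsAugProduct μ) (hD : IsTimes D)
    (hu : GelfandDickey D u) (hφ : IsPotential D u φ) : PKPHierarchy D φ := by
  simp only [PKPHierarchy]
  ext α
  simp only [map_sum, map_zsmul, map_zero]
  -- `Y` is symmetric in `i, k` because the flows commute, so the swap of positions `0, 2` kills it.
  -- `K` depends on `k` only and is killed by the swap of positions `0, 1`.
  let Y : Fin 3 → Fin 3 → B := fun i k =>
    if α = Finsupp.single i (α i) + Finsupp.single k (α k) then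
      -defect μ D u φ augF (miwaOp augFlow (α k) (leftPow μ (α i))) else 0
  let K : Fin 3 → B := fun k =>
    if α = Finsupp.single k (α k) ∧ α k ≠ 0 then defect μ D u φ (leftPow μ (α k)) augF else 0
  have hY : ∀ i k, Y k i = Y i k := fun i k => by
    simp only [Y]
    rw [add_comm, miwaOp_leftPow_comm hμ]
  have key : ∀ σ : Equiv.Perm (Fin 3), MvPowerSeries.coeff α (miwa D (σ 2)
      (divVar (σ 0) (miwa D (σ 0) (MvPowerSeries.C φ) - MvPowerSeries.C φ) +
        MvPowerSeries.C φ * miwa D (σ 0) (MvPowerSeries.C φ))) = Y (σ 0) (σ 2) - K (σ 2) := by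
    intro σ
    have hne : σ 0 ≠ σ 2 := σ.injective.ne (by decide)
    rw [coeff_miwa_of_axis hD hne (fun n => miwaOp D (n + 1) φ + φ * miwaOp D n φ)
      (coeff_potential hD φ (σ 0)), miwaOp_potential_coeff u hμ hD hu hφ]
    generalize σ 0 = i at hne
    generalize σ 2 = k at hne
    have hK : α = Finsupp.single k (α k) ↔
        α = Finsupp.single i (α i) + Finsupp.single k (α k) ∧ α i = 0 := by
      constructor
      · intro h
        have h0 : α i = 0 := by rw [h, Finsupp.single_eq_of_ne hne]
        exact ⟨by rw [h0, Finsupp.single_zero, zero_add]; exact h, h0⟩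
      · rintro ⟨h, h0⟩
        rwa [h0, Finsupp.single_zero, zero_add] at h
    simp only [Y, K, hK, and_assoc]
    by_cases h : α = Finsupp.single i (α i) + Finsupp.single k (α k)
    · simp only [← h, if_true, true_and]
    · simp only [h, false_and, if_false, sub_zero]
  simp only [key, smul_sub, Finset.sum_sub_distrib]
  rw [sum_sign_smul_eq_zero (by decide : (0 : Fin 3) ≠ 2)
      (fun σ => Y (σ 0) (σ 2)) fun σ => by simp [hY (σ 0) (σ 2)],
    sum_sign_smul_eq_zero (by decide : (0 : Fin 3) ≠ 1)
      (fun σ => K (σ 2)) fun σ => by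
        rw [Equiv.Perm.mul_apply, Equiv.swap_apply_of_ne_of_ne (by decide) (by decide)], sub_zero]

end Hierarchy

/-! ### The products of all orders as residues -/

theorem isElt_circ {μ : Aug →ₗ[ℂ] Aug →ₗ[ℂ] Aug} (hμ : IsAugProduct μ) {n : ℕ} (hn : 1 ≤ n) :
    IsElt (circ μ augF n augF augF) (-res (pow dPoly genLax n)) ∧
    (∀ A ∈ opSpace, ∀ x : Aug, IsElt x (resAt A) →
      IsElt (circ μ augF n augF x)
        (res (mul dPoly (pow dPoly genLax n) (projNeg (A one)))) ∧
      IsElt (circ μ augF n x augF) (-res (A (projPos (pow dPoly genLax n))))) ∧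
    (∀ A ∈ opSpace, ∀ B ∈ opSpace, ∀ x y : Aug, IsElt x (resAt A) → IsElt y (resAt B) →
      IsElt (circ μ augF n x y)
        (res (A (projPos (mul dPoly (pow dPoly genLax n) (projNeg (B one))))))) ∧
    (∀ m, 1 ≤ m → ∀ x : Aug, IsElt x (res (pow dPoly genLax m)) →
      IsElt (circ μ augF n x augF)
        (-res (mul dPoly (projNeg (pow dPoly genLax m)) (pow dPoly genLax n)))) := by
  obtain ⟨h1, h2, h3, h4⟩ := circ_eq hμ hn
  have hS := opS_pow_mem hn
  have hr : ∀ A ∈ opSpace, ∀ x : Aug, IsElt x (resAt A) →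
      IsElt (circ μ augF n x augF) (-res (A (projPos (pow dPoly genLax n)))) := by
    intro A hA x hx
    rw [eq_el hA hx, h3 A hA, ← opS_pow_one n]
    exact isElt_neg_el (mul_projPos_mul_mem hA hS)
  refine ⟨?_, fun A hA x hx => ⟨?_, hr A hA x hx⟩, fun A hA B hB x y hx hy => ?_,
    fun m hm x hx => ?_⟩
  · rw [h1, ← opS_pow_one n]
    exact isElt_neg_el hS
  · rw [eq_el hA hx, h2 A hA, ← opS_pow_apply n]
    exact isElt_el (mul_projNeg_mul_mem hS hA)
  · rw [eq_el hA hx, eq_el hB hy, h4 A hA B hB, ← opS_pow_apply n]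
    exact isElt_el (mul_projNeg_mul_mem (mul_projPos_mul_mem hA hS) hB)
  · rw [← opS_pow_one m] at hx
    have := hr _ (opS_pow_mem hm) x hx
    rwa [opS_pow_apply, res_mul_projPos_right] at this

end

end WNAGD

theorem mainTheorem4 :
    -- the residue algebra is a subalgebra isomorphic to the operator algebra
    (∀ A ∈ WNAGD.opSpace, WNAGD.resAt A = 0 → A = 0) ∧
    (∀ A ∈ WNAGD.opSpace, ∀ B ∈ WNAGD.opSpace, WNAGD.opMul A B ∈ WNAGD.opSpace ∧
      WNAGD.resAt (WNAGD.opMul A B) = WNAGD.resAt A * WNAGD.resAt B) ∧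
    -- the augmented product is well defined
    (∃! μ : WNAGD.Aug →ₗ[ℂ] WNAGD.Aug →ₗ[ℂ] WNAGD.Aug, WNAGD.IsAugProduct μ) ∧
    ∀ μ : WNAGD.Aug →ₗ[ℂ] WNAGD.Aug →ₗ[ℂ] WNAGD.Aug, WNAGD.IsAugProduct μ →
      -- it is a weakly nonassociative algebra generated by `f`
      WNAGD.IsWNA μ ∧
      WNAGD.middleNucleus μ = {x : WNAGD.Aug | x.1 = 0} ∧
      WNAGD.IsGeneratedBy μ WNAGD.augF ∧
      -- the products of all orders
      (∀ n, 1 ≤ n →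
        WNAGD.IsElt (WNAGD.circ μ WNAGD.augF n WNAGD.augF WNAGD.augF)
          (-WNAGD.res (WNAGD.pow WNAGD.dPoly WNAGD.genLax n)) ∧
        (∀ A ∈ WNAGD.opSpace, ∀ x : WNAGD.Aug, WNAGD.IsElt x (WNAGD.resAt A) →
          WNAGD.IsElt (WNAGD.circ μ WNAGD.augF n WNAGD.augF x)
            (WNAGD.res (WNAGD.mul WNAGD.dPoly (WNAGD.pow WNAGD.dPoly WNAGD.genLax n)
              (WNAGD.projNeg (A WNAGD.one)))) ∧
          WNAGD.IsElt (WNAGD.circ μ WNAGD.augF n x WNAGD.augF)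
            (-WNAGD.res (A (WNAGD.projPos (WNAGD.pow WNAGD.dPoly WNAGD.genLax n))))) ∧
        (∀ A ∈ WNAGD.opSpace, ∀ B ∈ WNAGD.opSpace, ∀ x y : WNAGD.Aug,
          WNAGD.IsElt x (WNAGD.resAt A) → WNAGD.IsElt y (WNAGD.resAt B) →
          WNAGD.IsElt (WNAGD.circ μ WNAGD.augF n x y)
            (WNAGD.res (A (WNAGD.projPos
              (WNAGD.mul WNAGD.dPoly (WNAGD.pow WNAGD.dPoly WNAGD.genLax n)
                (WNAGD.projNeg (B WNAGD.one))))))) ∧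
        (∀ m, 1 ≤ m → ∀ x : WNAGD.Aug,
          WNAGD.IsElt x (WNAGD.res (WNAGD.pow WNAGD.dPoly WNAGD.genLax m)) →
          WNAGD.IsElt (WNAGD.circ μ WNAGD.augF n x WNAGD.augF)
            (-WNAGD.res (WNAGD.mul WNAGD.dPoly
              (WNAGD.projNeg (WNAGD.pow WNAGD.dPoly WNAGD.genLax m))
              (WNAGD.pow WNAGD.dPoly WNAGD.genLax n))))) ∧
      -- the `u_n` depend on times, as elements of an arbitrary associative algebra
      ∀ (B : Type u) [Ring B] [Algebra ℂ B] (D : ℕ → B →ₗ[ℂ] B) (v : ℕ → B),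
        WNAGD.IsTimes D →
        (WNAGD.ODEHierarchy μ D v →
          (∀ m n, 1 ≤ m → 1 ≤ n →
            D n (WNAGD.res (WNAGD.pow (D 1) (WNAGD.lax v) m)) =
              WNAGD.res (WNAGD.bracket (D 1)
                (WNAGD.projPos (WNAGD.pow (D 1) (WNAGD.lax v) n))
                (WNAGD.pow (D 1) (WNAGD.lax v) m)) ∧
            D n (WNAGD.res (WNAGD.pow (D 1) (WNAGD.lax v) m)) =
              D m (WNAGD.res (WNAGD.pow (D 1) (WNAGD.lax v) n))) ∧
          (∃ (C : Type u) (_ : Ring C) (_ : Algebra ℂ C) (E : ℕ → C →ₗ[ℂ] C)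
            (j : B →ₐ[ℂ] C) (φ : C), WNAGD.IsTimes E ∧ Function.Injective j ∧
              (∀ n, 1 ≤ n → ∀ b : B, E n (j b) = j (D n b)) ∧
              WNAGD.IsPotential E (fun k => j (v k)) φ) ∧
          (∀ φ : B, WNAGD.IsPotential D v φ →
            WNAGD.PKPEquation D φ ∧ WNAGD.PKPHierarchy D φ)) ∧
        (WNAGD.ODEHierarchy μ D v ↔ WNAGD.GelfandDickey D v) ∧
        (WNAGD.GelfandDickeyPowers D v ↔ WNAGD.GelfandDickey D v) := by
  open WNAGD in
  refine ⟨fun A hA h => resAt_injective hA h,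
    fun A hA B hB => ⟨opMul_mem hA hB, resAt_opMul hA B⟩,
    ⟨augMul, isAugProduct_augMul, fun μ' h => augProduct_unique isAugProduct_augMul h⟩,
    fun μ hμ => ⟨isWNA_of_isAugProduct hμ, middleNucleus_eq hμ, isGeneratedBy_augF hμ,
      fun n hn => ?_, fun B _ _ D v hD => ⟨fun hode => ?_, odeHierarchy_iff hD v hμ,
        gelfandDickeyPowers_iff hD v⟩⟩⟩
  · exact isElt_circ hμ hn
  · have h := (odeHierarchy_iff hD v hμ).mp hode
    exact ⟨fun m n hm hn => ⟨res_pow_flow hD v h hn, res_pow_flow_symm hD v h hm hn⟩,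
      exists_potential hD v h, fun φ hφ => ⟨pkpEquation_of_isPotential v hμ hD h hφ,
        pkpHierarchy_of_isPotential v hμ hD h hφ⟩⟩
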